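/- Let $\mathcal M$ be a von Neumann algebra on a complex Hilbert space with a normal faithful semifinite trace $\tau$, let $\mathcal D\subseteq\mathcal M$ be a von Neumann subalgebra such that $\tau|_{\mathcal D}$ is still semifinite, and let $\mathcal E:\mathcal M\to\mathcal D$ be the normal positive faithful conditional expectation with $\tau\circ\mathcal E=\tau$. Let $\mathcal A$ be a subdiagonal algebra of $\mathcal M$ with respect to $\mathcal E$, that is, a w*-closed subalgebra of $\mathcal M$ such that, with $J(\mathcal A)=\{a^*:a\in\mathcal A\}$, (i) $\mathcal A+J(\mathcal A)$ is w*-dense in $\mathcal M$, (ii) $\mathcal E(xy)=\mathcal E(x)\mathcal E(y)$ for all $x,y\in\mathcal A$, and (iii) $\mathcal A\cap J(\mathcal A)=\mathcal D$. For $0<p<\infty$ let $L^p(\mathcal M)$ be the noncommutative $L^p$-space of $(\mathcal M,\tau)$, i.e. the completion of $\{x\in\mathcal M:\tau(|x|^p)<\infty\}$ for $\|x\|_p=\tau(|x|^p)^{1/p}$, and let $L^\infty(\mathcal M)=\mathcal M$ with the operator norm. Let $H^p(\mathcal A)$ be the closure of $\mathcal A\cap L^p(\mathcal M)$ in $L^p(\mathcal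 M)$ for $0<p<\infty$, and $H^\infty(\mathcal A)=\mathcal A$. Let $0<p,q,r\le\infty$ with $\frac1r=\frac1p+\frac1q$. Let $H^p(\mathcal A)\odot H^q(\mathcal A)$ be the set of all $x\in H^r(\mathcal A)$ for which there are sequences $(a_n)_{n\ge1}$ in $H^p(\mathcal A)$ and $(b_n)_{n\ge1}$ in $H^q(\mathcal A)$ with $$\sum_{n\ge1}\|a_n\|_p^{\min\{1,r\}}\|b_n\|_q^{\min\{1,r\}}<\infty\quad\text{and}\quad x=\sum_{n\ge1}a_nb_n\ \text{ in } L^r(\mathcal M),$$ and for such $x$ define $\|x\|_{p\odot q}$ by $$\|x\|_{p\odot q}^{\min\{1,r\}}=\inf\sum_{n\ge1}\|a_n\|_p^{\min\{1,r\}}\|b_n\|_q^{\min\{1,r\}},$$ the infimum being over all such pairs of sequences. Then $H^p(\mathcal A)\odot H^q(\mathcal A)$ is a linear subspace of $L^r(\mathcal M)$ and $\|\cdot\|_{p\odot q}$ is finite on it. If $r\ge1$, then $\|\cdot\|_{p\odot q}$ is a norm for which $H^p(\mathcal A)\odot H^q(\mathcal A)$ is a Banach space; if $r<1$, then $\|\cdot\|_{p\odot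 q}$ is a quasi-norm for which it is a quasi-Banach space. -/

import Mathlib

open scoped ENNReal Topology
open Filter

noncomputable section

namespace NCHardy

variable {H : Type*} [NormedAddCommGroup H] [InnerProductSpace ℂ H] [CompleteSpace H]

/-! ### Traces, conditional expectations, subdiagonal algebras -/

/-- `τ` is semifinite on the positive cone of the von Neumann algebra `N`: every nonzero positive
element of `N` dominates a nonzero positive element of `N` of finite trace. -/
def IsSemifiniteOn (N : VonNeumannAlgebra H) (τ : (H →L[ℂ] H) → ℝ≥0∞) : Prop :=
  ∀ x ∈ N, 0 ≤ x → x ≠ 0 → ∃ y ∈ N, 0 ≤ y ∧ y ≤ x ∧ y ≠ 0 ∧ τ y < ∞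

/-- `τ` is a normal faithful semifinite trace on (the positive cone of) `M`. Only the values of `τ`
at positive elements of `M` matter; all other values are ignored. The order on operators is the
Loewner order. -/
structure IsNormalFaithfulSemifiniteTrace (M : VonNeumannAlgebra H)
    (τ : (H →L[ℂ] H) → ℝ≥0∞) : Prop where
  add : ∀ x ∈ M, ∀ y ∈ M, 0 ≤ x → 0 ≤ y → τ (x + y) = τ x + τ y
  smul : ∀ (c : NNReal), ∀ x ∈ M, 0 ≤ x → τ (((c : ℝ) : ℂ) • x) = (c : ℝ≥0∞) * τ x
  tracial : ∀ x ∈ M, τ (star x * x) = τ (x * star x)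
  faithful : ∀ x ∈ M, 0 ≤ x → τ x = 0 → x = 0
  normal : ∀ S : Set (H →L[ℂ] H), S.Nonempty → DirectedOn (· ≤ ·) S →
    (∀ y ∈ S, y ∈ M ∧ 0 ≤ y) → ∀ x ∈ M, IsLUB S x → τ x = ⨆ y ∈ S, τ y
  semifinite : IsSemifiniteOn M τ

/-- `E` is a normal positive faithful conditional expectation of `M` onto the von Neumann
subalgebra `D` that preserves the trace `τ`. -/
structure IsTracePreservingCondExp (M D : VonNeumannAlgebra H) (τ : (H →L[ℂ] H) → ℝ≥0∞)
    (E : M.toStarSubalgebra →ₗ[ℂ] M.toStarSubalgebra) : Prop where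
  mem : ∀ x : M.toStarSubalgebra, (E x : H →L[ℂ] H) ∈ D
  fix : ∀ x : M.toStarSubalgebra, (x : H →L[ℂ] H) ∈ D → E x = x
  bimodule : ∀ a b x : M.toStarSubalgebra, (a : H →L[ℂ] H) ∈ D → (b : H →L[ℂ] H) ∈ D →
    E (a * x * b) = a * E x * b
  positive : ∀ x : M.toStarSubalgebra, 0 ≤ (x : H →L[ℂ] H) → 0 ≤ (E x : H →L[ℂ] H)
  faithful : ∀ x : M.toStarSubalgebra, 0 ≤ (x : H →L[ℂ] H) → E x = 0 → x = 0
  normal : ∀ S : Set (H →L[ℂ] H), S.Nonempty → DirectedOn (· ≤ ·) S →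
    (∀ y ∈ S, y ∈ M ∧ 0 ≤ y) → ∀ x : M.toStarSubalgebra, IsLUB S (x : H →L[ℂ] H) →
      IsLUB {z : H →L[ℂ] H | ∃ y : M.toStarSubalgebra, (y : H →L[ℂ] H) ∈ S ∧ z = E y}
        (E x : H →L[ℂ] H)
  trace_eq : ∀ x : M.toStarSubalgebra, 0 ≤ (x : H →L[ℂ] H) → τ (E x) = τ x

variable (H) in
/-- The σ-weak (ultraweak) topology on bounded operators, i.e. the w*-topology: the coarsest
topology making `x ↦ ∑ₙ ⟪ηₙ, x ξₙ⟫` continuous for all square-summable sequences `ξ`, `η`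
of vectors. -/
abbrev sigmaWeak : TopologicalSpace (H →L[ℂ] H) :=
  TopologicalSpace.induced
    (fun (x : H →L[ℂ] H) (ω : lp (fun _ : ℕ => H) 2 × lp (fun _ : ℕ => H) 2) =>
      ∑' n : ℕ, inner ℂ (ω.2 n) (x (ω.1 n)))
    Pi.topologicalSpace

/-- `A` is a subdiagonal algebra of `M` with respect to the conditional expectation `E` onto `D`. -/
structure IsSubdiagonal (M D : VonNeumannAlgebra H)
    (E : M.toStarSubalgebra →ₗ[ℂ] M.toStarSubalgebra) (A : Subalgebra ℂ (H →L[ℂ] H)) : Prop where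
  le : ∀ x ∈ A, x ∈ M
  closed : IsClosed[sigmaWeak H] (A : Set (H →L[ℂ] H))
  dense : ∀ x ∈ M, x ∈ @closure _ (sigmaWeak H) {z | ∃ a ∈ A, ∃ b ∈ A, z = a + star b}
  mul : ∀ x y : M.toStarSubalgebra, (x : H →L[ℂ] H) ∈ A → (y : H →L[ℂ] H) ∈ A →
    E (x * y) = E x * E y
  diag : ∀ x, (x ∈ A ∧ star x ∈ A) ↔ x ∈ D

/-! ### Noncommutative `L^p` spaces

`L^p(M)` is the completion of `{x ∈ M | τ(|x|^p) < ∞}` for the (quasi-)norm `τ(|x|^p)^(1/p)`; it is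
constructed as the space of Cauchy sequences modulo null sequences. For `p = ∞` the completion
of `M` in the operator norm is `M` itself. -/

/-- `‖x‖_p = τ(|x|^p)^(1/p)` for a bounded operator `x`, and the operator norm for `p = ∞`. -/
def opNorm (τ : (H →L[ℂ] H) → ℝ≥0∞) (p : ℝ≥0∞) (x : H →L[ℂ] H) : ℝ≥0∞ :=
  if p = ∞ then ‖x‖ₑ else τ (CFC.abs x ^ p.toReal) ^ (1 / p.toReal)

/-- Sequences in `M`, with termwise operations. -/
abbrev Seqs (M : VonNeumannAlgebra H) : Type _ := ℕ → M.toStarSubalgebra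

/-- The sequences in `M` that tend to `0` for `‖·‖_p`. (These form a subspace by the (quasi-)triangle
inequality of `‖·‖_p`, so passing to the span adds nothing.) -/
def nullSeqs (M : VonNeumannAlgebra H) (τ : (H →L[ℂ] H) → ℝ≥0∞) (p : ℝ≥0∞) :
    Submodule ℂ (Seqs M) :=
  Submodule.span ℂ {u | Tendsto (fun n => opNorm τ p (u n)) atTop (𝓝 0)}

/-- Sequences in `M` modulo `‖·‖_p`-null sequences; the vector space in which `L^p(M)` lives. -/
abbrev SeqSpace (M : VonNeumannAlgebra H) (τ : (H →L[ℂ] H) → ℝ≥0∞) (p : ℝ≥0∞) : Type _ :=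
  Seqs M ⧸ nullSeqs M τ p

variable {M : VonNeumannAlgebra H} {τ : (H →L[ℂ] H) → ℝ≥0∞}

/-- The class of a sequence. -/
def cls (M : VonNeumannAlgebra H) (τ : (H →L[ℂ] H) → ℝ≥0∞) (p : ℝ≥0∞) (u : Seqs M) :
    SeqSpace M τ p :=
  (nullSeqs M τ p).mkQ u

/-- The class of a constant sequence: the canonical map of `{x ∈ M | ‖x‖_p < ∞}` to `L^p(M)`. -/
def ofOp (M : VonNeumannAlgebra H) (τ : (H →L[ℂ] H) → ℝ≥0∞) (p : ℝ≥0∞)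
    (x : M.toStarSubalgebra) : SeqSpace M τ p :=
  cls M τ p (fun _ => x)

/-- `L^p(M)`: the classes of the `‖·‖_p`-Cauchy sequences in `{x ∈ M | ‖x‖_p < ∞}`. -/
def LpSpace (M : VonNeumannAlgebra H) (τ : (H →L[ℂ] H) → ℝ≥0∞) (p : ℝ≥0∞) :
    Set (SeqSpace M τ p) :=
  {ξ | ∃ u : Seqs M, (∀ n, opNorm τ p (u n) < ∞) ∧
    (∀ ε : ℝ≥0∞, 0 < ε → ∃ N, ∀ m ≥ N, ∀ n ≥ N, opNorm τ p ((u m : H →L[ℂ] H) - u n) < ε) ∧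
    cls M τ p u = ξ}

/-- The (quasi-)norm of `L^p(M)`: the limit of `‖uₙ‖_p` for a representing Cauchy sequence `u`.
(The value is the same for all representatives.) -/
def lpNorm {p : ℝ≥0∞} (ξ : SeqSpace M τ p) : ℝ≥0∞ :=
  ⨅ (u : Seqs M) (_ : cls M τ p u = ξ), limsup (fun n => opNorm τ p (u n)) atTop

/-- The product `L^p(M) × L^q(M) → L^r(M)`, `1/r = 1/p + 1/q`: the extension by continuity of the
product of operators, i.e. the class of the termwise product of representing Cauchy sequences.
(By Hölder's inequality it does not depend on the representatives.) -/
def lpMul {p q : ℝ≥0∞} (r : ℝ≥0∞) (ξ : SeqSpace M τ p) (η : SeqSpace M τ q) : SeqSpace M τ r :=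
  cls M τ r (Function.surjInv (nullSeqs M τ p).mkQ_surjective ξ *
    Function.surjInv (nullSeqs M τ q).mkQ_surjective η)

/-! ### Hardy spaces and their product -/

/-- The Hardy space `H^p(A)`: the closure of `A ∩ L^p(M)` in `L^p(M)` for `p < ∞`,
and `A` for `p = ∞`. -/
def hardy (M : VonNeumannAlgebra H) (τ : (H →L[ℂ] H) → ℝ≥0∞) (A : Subalgebra ℂ (H →L[ℂ] H))
    (p : ℝ≥0∞) : Set (SeqSpace M τ p) :=
  if p = ∞ then {ξ | ∃ a : M.toStarSubalgebra, (a : H →L[ℂ] H) ∈ A ∧ ofOp M τ p a = ξ}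
  else {ξ | ξ ∈ LpSpace M τ p ∧ ∀ ε : ℝ≥0∞, 0 < ε → ∃ a : M.toStarSubalgebra,
    (a : H →L[ℂ] H) ∈ A ∧ opNorm τ p a < ∞ ∧ lpNorm (ξ - ofOp M τ p a) < ε}

/-- The real number `min {1, r}`. -/
def minExp (r : ℝ≥0∞) : ℝ := (min 1 r).toReal

/-- `∑ₙ ‖aₙ‖_p^min{1,r} ‖bₙ‖_q^min{1,r}`. -/
def factCost {p q : ℝ≥0∞} (r : ℝ≥0∞) (a : ℕ → SeqSpace M τ p) (b : ℕ → SeqSpace M τ q) : ℝ≥0∞ :=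
  ∑' n, lpNorm (a n) ^ minExp r * lpNorm (b n) ^ minExp r

/-- `x = ∑ₙ aₙ bₙ` (convergence in `L^r(M)`) with `aₙ ∈ H^p(A)`, `bₙ ∈ H^q(A)` and
`∑ₙ ‖aₙ‖_p^min{1,r} ‖bₙ‖_q^min{1,r} < ∞`. -/
structure IsFactorization (A : Subalgebra ℂ (H →L[ℂ] H)) {p q r : ℝ≥0∞} (x : SeqSpace M τ r)
    (a : ℕ → SeqSpace M τ p) (b : ℕ → SeqSpace M τ q) : Prop where
  left_mem : ∀ n, a n ∈ hardy M τ A p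
  right_mem : ∀ n, b n ∈ hardy M τ A q
  cost_lt_top : factCost r a b < ∞
  hasSum : Tendsto (fun N => lpNorm (x - ∑ n ∈ Finset.range N, lpMul r (a n) (b n))) atTop (𝓝 0)

/-- The space `H^p(A) ⊙ H^q(A)`, a subset of `H^r(A)`. -/
def hardyProd (M : VonNeumannAlgebra H) (τ : (H →L[ℂ] H) → ℝ≥0∞) (A : Subalgebra ℂ (H →L[ℂ] H))
    (p q r : ℝ≥0∞) : Set (SeqSpace M τ r) :=
  {x | x ∈ hardy M τ A r ∧ ∃ (a : ℕ → SeqSpace M τ p) (b : ℕ → SeqSpace M τ q),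
    IsFactorization A x a b}

/-- `‖x‖_{p⊙q}`, defined by `‖x‖_{p⊙q}^min{1,r} = inf ∑ₙ ‖aₙ‖_p^min{1,r} ‖bₙ‖_q^min{1,r}` over all
factorizations of `x`. -/
def prodNorm (A : Subalgebra ℂ (H →L[ℂ] H)) (p q : ℝ≥0∞) {r : ℝ≥0∞} (x : SeqSpace M τ r) : ℝ≥0∞ :=
  (⨅ (a : ℕ → SeqSpace M τ p) (b : ℕ → SeqSpace M τ q) (_ : IsFactorization A x a b),
    factCost r a b) ^ (1 / minExp r)

/-! ### Banach and quasi-Banach spaces -/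

/-- `ν` is a complete quasi-norm on the complex vector space `V`, with constant `K` in the
quasi-triangle inequality. -/
structure IsCompleteQuasiNorm {V : Type*} [AddCommGroup V] [Module ℂ V] (K : ℝ) (ν : V → ℝ) :
    Prop where
  nonneg : ∀ x, 0 ≤ ν x
  eq_zero_iff : ∀ x, ν x = 0 ↔ x = 0
  smul : ∀ (c : ℂ) (x : V), ν (c • x) = ‖c‖ * ν x
  add_le : ∀ x y, ν (x + y) ≤ K * (ν x + ν y)
  complete : ∀ u : ℕ → V, (∀ ε > 0, ∃ N, ∀ m ≥ N, ∀ n ≥ N, ν (u m - u n) < ε) →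
    ∃ x, Tendsto (fun n => ν (u n - x)) atTop (𝓝 0)

/-- `(V, ν)` is a Banach space. -/
def IsBanachNorm {V : Type*} [AddCommGroup V] [Module ℂ V] (ν : V → ℝ) : Prop :=
  IsCompleteQuasiNorm 1 ν

/-- `(V, ν)` is a quasi-Banach space. -/
def IsQuasiBanachNorm {V : Type*} [AddCommGroup V] [Module ℂ V] (ν : V → ℝ) : Prop :=
  ∃ K : ℝ, IsCompleteQuasiNorm K ν

end NCHardy

end

/-! The space is a space of atomic decompositions: the atoms are the products `ab` with `a` in
`H^p(A)`, `b` in `H^q(A)`, of weight `(‖a‖_p ‖b‖_q)^e`, where `e = min {1, r}`, and `‖x‖_{p⊙q}^e` is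
the least total weight of a series of atoms with sum `x`. Interleaving two series makes this cost
subadditive, and rescaling the left factors makes it homogeneous of degree `e`. Hölder's inequality
bounds `‖x‖_r^e` by a multiple of the cost, so the cost is definite. For completeness, a subsequence
of a Cauchy sequence has differences of cost below `2^(-j)`; near-optimal series for these
differences combine into one double series that represents the limit minus a term of the sequence.
Taking the power `1/e` costs the factor `2^(1/e - 1)` in the triangle inequality, which is `1` when
`r ≥ 1`.

Since `‖·‖_r` serves only to make sense of convergence and to compare with the cost, constants in
the `L^p` inequalities are harmless, provided that those in the triangle inequality do not grow with
the number of summands. It suffices that `‖∑ xᵢ‖_p^min{1,p} ≤ 4 ∑ ‖xᵢ‖_p^min{1,p}`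
(`isGauge_opNorm`) and `‖xy‖_r ≤ K ‖x‖_p ‖y‖_q` (`exists_opNorm_mul_le`). A gauge with such a
uniform constant is equivalent, after the power `e`, to a group norm
(`IsGauge.exists_addGroupNorm`), so the theory of absolutely convergent series applies.

The trace inequalities rest on the Löwner–Heinz theorem and on `τ((x*x)^s) = τ((xx*)^s)`. Together
they give monotonicity of `τ(a^s)` for every `s > 0`, then Rotfel'd's inequality for `s ≤ 1` and
Young and Minkowski inequalities for positive operators. General operators are reduced to positive
ones by `2 Re(w*x) ≤ w*|x*|w + |x|` for contractions `w`. The regularised polar part `x(|x| + ε)⁻¹`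
replaces the polar decomposition, and normality of `τ` removes `ε`.

The algebra `A` enters as a norm-closed subalgebra: the Hardy spaces are then complete, and products
of their elements lie in `H^r(A)`. -/

open scoped NNReal

noncomputable section

namespace NCHardy

/-! ### Continuous functional calculus -/

section

section CFCPrelim

/-- The continuous functional calculus intertwines: `x f(x*x) = f(xx*) x`. -/
theorem mul_cfc_star_mul_self_real {𝔄 : Type*} [CStarAlgebra 𝔄] (x : 𝔄) (f : ℝ → ℝ) (hf : Continuous f) :
    x * cfc f (star x * x) = cfc f (x * star x) * x := by
  rcases subsingleton_or_nontrivial 𝔄 with h | h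
  · exact Subsingleton.elim _ _
  have hsa : IsSelfAdjoint (star x * x) := .star_mul_self x
  have hsb : IsSelfAdjoint (x * star x) := .mul_star_self x
  have hbound : ∀ ε : ℝ, 0 < ε →
      ‖x * cfc f (star x * x) - cfc f (x * star x) * x‖ ≤ ‖x‖ * ε + ε * ‖x‖ := by
    intro ε hε
    -- `R` bounds the spectra of both `x*x` and `xx*`, so one polynomial approximates `f` on both;
    -- for polynomials the identity is algebraic.
    set R : ℝ := ‖x‖ * ‖x‖ with hR
    obtain ⟨P, hP⟩ := exists_polynomial_near_of_continuousOn (-R) R f hf.continuousOn ε hε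
    have near : ∀ a : 𝔄, IsSelfAdjoint a → ‖a‖ ≤ R → ‖cfc f a - Polynomial.aeval a P‖ ≤ ε := by
      intro a ha hn
      rw [← cfc_polynomial P a, ← cfc_sub ..]
      refine norm_cfc_le hε.le fun t ht => ?_
      have ht' : ‖t‖ ≤ R := (spectrum.norm_le_norm_of_mem ht).trans hn
      rw [Real.norm_eq_abs, abs_le] at ht'
      rw [Real.norm_eq_abs, abs_sub_comm]
      exact (hP t ⟨ht'.1, ht'.2⟩).le
    have hcomm : x * Polynomial.aeval (star x * x) P = Polynomial.aeval (x * star x) P * x := by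
      have hpow : ∀ n : ℕ, x * (star x * x) ^ n = (x * star x) ^ n * x := by
        intro n
        induction n with
        | zero => simp
        | succ k ih => rw [pow_succ, ← mul_assoc, ih, pow_succ]; simp only [mul_assoc]
      rw [Polynomial.aeval_eq_sum_range, Polynomial.aeval_eq_sum_range, Finset.mul_sum,
        Finset.sum_mul]
      refine Finset.sum_congr rfl fun n _ => ?_
      rw [mul_smul_comm, smul_mul_assoc, hpow]
    have e : x * cfc f (star x * x) - cfc f (x * star x) * x
        = x * (cfc f (star x * x) - Polynomial.aeval (star x * x) P)
          - (cfc f (x * star x) - Polynomial.aeval (x * star x) P) * x := by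
      rw [mul_sub, sub_mul, hcomm]; abel
    rw [e]
    refine (norm_sub_le _ _).trans (add_le_add ?_ ?_)
    · refine (norm_mul_le _ _).trans (mul_le_mul_of_nonneg_left (near _ hsa ?_) (norm_nonneg _))
      exact (norm_mul_le _ _).trans (by rw [norm_star])
    · refine (norm_mul_le _ _).trans (mul_le_mul_of_nonneg_right (near _ hsb ?_) (norm_nonneg _))
      exact (norm_mul_le _ _).trans (by rw [norm_star])
  have hlim : Tendsto (fun ε : ℝ => ‖x‖ * ε + ε * ‖x‖) (𝓝[>] 0) (𝓝 0) := by
    have : Continuous (fun ε : ℝ => ‖x‖ * ε + ε * ‖x‖) := by fun_prop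
    simpa using (this.tendsto 0).mono_left nhdsWithin_le_nhds
  have := ge_of_tendsto hlim (eventually_nhdsWithin_of_forall fun ε hε => hbound ε hε)
  exact sub_eq_zero.1 (norm_le_zero_iff.1 this)

variable {𝔄 : Type*} [CStarAlgebra 𝔄] [PartialOrder 𝔄] [StarOrderedRing 𝔄]

theorem mul_cfc_star_mul_self (x : 𝔄) (f : ℝ≥0 → ℝ≥0) (hf : Continuous f) :
    x * cfc f (star x * x) = cfc f (x * star x) * x := by
  rw [cfc_nnreal_eq_real f _ (star_mul_self_nonneg x), cfc_nnreal_eq_real f _ (mul_star_self_nonneg x)]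
  exact mul_cfc_star_mul_self_real x _ (by fun_prop)

theorem cfc_nnreal_mem (S : StarSubalgebra ℂ 𝔄) (hS : IsClosed (S : Set 𝔄)) (f : ℝ≥0 → ℝ≥0) {a : 𝔄}
    (ha : a ∈ S) : cfc f a ∈ S := by
  by_cases h : 0 ≤ a
  · rw [cfc_nnreal_eq_real f a h]
    have : IsClosed (S : Set 𝔄) := hS
    exact cfc_mem (𝕜 := ℝ) (𝕜' := ℂ) _ ha
  · rw [cfc_apply_of_not_predicate a h]; exact zero_mem S

/-- Dini's theorem: a monotone pointwise limit with continuous limit function is uniform on the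
compact spectrum. This turns pointwise cut-offs into norm limits. -/
theorem tendsto_cfc_of_monotone (a : 𝔄) (F : ℕ → ℝ≥0 → ℝ≥0) (f : ℝ≥0 → ℝ≥0)
    (hF : ∀ n, Continuous (F n)) (hmono : Monotone F) (hf : Continuous f)
    (hlim : ∀ t, Tendsto (fun n => F n t) atTop (𝓝 (f t))) :
    Tendsto (fun n => cfc (F n) a) atTop (𝓝 (cfc f a)) := by
  apply tendsto_cfc_fun _ (Eventually.of_forall fun n => (hF n).continuousOn)
  have key : TendstoLocallyUniformly (fun n (t : ℝ≥0) => ((F n t : ℝ≥0) : ℝ))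
      (fun t => ((f t : ℝ≥0) : ℝ)) atTop := by
    refine Monotone.tendstoLocallyUniformly_of_forall_tendsto (fun n => by have := hF n; fun_prop)
      (fun m n hmn t => NNReal.coe_le_coe.2 (hmono hmn t)) (by fun_prop) fun t => ?_
    exact (NNReal.tendsto_coe).2 (hlim t)
  have hc : IsCompact (spectrum ℝ≥0 a) := ContinuousFunctionalCalculus.isCompact_spectrum a
  have := (tendstoLocallyUniformlyOn_iff_tendstoUniformlyOn_of_compact hc).1
    (key.tendstoLocallyUniformlyOn (s := spectrum ℝ≥0 a))
  rw [Metric.tendstoUniformlyOn_iff] at this ⊢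
  exact this

/-- Nonnegative exponents make the scalar identity valid at `0`, so `a` need not be invertible; if
`a` is not positive, all the powers are the default value `0`. -/
theorem rpow_mul_rpow_of_nonneg {a : 𝔄} {s t : ℝ} (hs : 0 ≤ s) (ht : 0 ≤ t) :
    a ^ s * a ^ t = a ^ (s + t) := by
  rw [CFC.rpow_def, CFC.rpow_def, CFC.rpow_def, ← cfc_mul _ _ a
    (NNReal.continuous_rpow_const hs).continuousOn (NNReal.continuous_rpow_const ht).continuousOn]
  simp_rw [NNReal.rpow_add_of_nonneg _ hs ht]

theorem smul_rpow_of_nonneg {a : 𝔄} (ha : 0 ≤ a) {s : ℝ} (hs : 0 ≤ s) (c : ℝ≥0) :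
    (c • a) ^ s = (c ^ s) • a ^ s := by
  have hc := NNReal.continuous_rpow_const hs
  rw [CFC.rpow_def, CFC.rpow_def, ← cfc_comp_smul c (fun x : ℝ≥0 => x ^ s) a hc.continuousOn ha,
    ← cfc_smul _ _ _ hc.continuousOn]
  simp [NNReal.mul_rpow]

theorem isSelfAdjoint_cfc_nnreal (f : ℝ≥0 → ℝ≥0) (a : 𝔄) : IsSelfAdjoint (cfc f a) :=
  (cfc_nonneg_of_predicate (f := f) (a := a)).isSelfAdjoint

theorem isSelfAdjoint_rpow (a : 𝔄) (s : ℝ) : IsSelfAdjoint (a ^ s) :=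
  CFC.rpow_nonneg.isSelfAdjoint

theorem rpow_half_mul_self {a : 𝔄} (ha : 0 ≤ a) : a ^ (1 / 2 : ℝ) * a ^ (1 / 2 : ℝ) = a := by
  rw [rpow_mul_rpow_of_nonneg (by norm_num) (by norm_num)]
  norm_num
  exact CFC.rpow_one a

end CFCPrelim

end

/-! ### Normal traces: swapping and monotonicity of powers -/

section

/-- The part of the theory of a normal trace `τ` on the closed `*`-subalgebra `S` of a C*-algebra
that the Hölder and Minkowski inequalities depend on. -/
structure IsTraceOn {𝔄 : Type*} [CStarAlgebra 𝔄] [PartialOrder 𝔄] (S : StarSubalgebra ℂ 𝔄)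
    (τ : 𝔄 → ℝ≥0∞) : Prop where
  closed : IsClosed (S : Set 𝔄)
  add : ∀ x ∈ S, ∀ y ∈ S, 0 ≤ x → 0 ≤ y → τ (x + y) = τ x + τ y
  smul : ∀ (c : ℝ≥0), ∀ x ∈ S, 0 ≤ x → τ (c • x) = c * τ x
  tracial : ∀ x ∈ S, τ (star x * x) = τ (x * star x)
  -- Norm-convergent increasing sequences are enough: each use is a cut-off inside the functional
  -- calculus.
  normal : ∀ x : ℕ → 𝔄, Monotone x → (∀ n, x n ∈ S ∧ 0 ≤ x n) → ∀ y, Tendsto x atTop (𝓝 y) →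
    τ y = ⨆ n, τ (x n)

/-- The functions `t ↦ t / (t + 1/(n+1))`, which increase to the indicator of `(0, ∞)`. -/
def cutoff (n : ℕ) (t : ℝ≥0) : ℝ≥0 := t * (t + ((n : ℝ≥0) + 1)⁻¹)⁻¹

theorem continuous_cutoff (n : ℕ) : Continuous (cutoff n) := by
  unfold cutoff
  refine continuous_id.mul (Continuous.inv₀ (by fun_prop) fun t => ?_)
  positivity

theorem monotone_cutoff : Monotone cutoff := by
  intro m n hmn t
  unfold cutoff
  gcongr

theorem tendsto_cutoff {t : ℝ≥0} (ht : t ≠ 0) : Tendsto (fun n => cutoff n t) atTop (𝓝 1) := by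
  unfold cutoff
  have h0 : Tendsto (fun n : ℕ => ((n : ℝ≥0) + 1)⁻¹) atTop (𝓝 0) := by
    rw [← NNReal.tendsto_coe]
    simpa using tendsto_one_div_add_atTop_nhds_zero_nat (𝕜 := ℝ)
  have h1 : Tendsto (fun n : ℕ => t * (t + ((n : ℝ≥0) + 1)⁻¹)⁻¹) atTop (𝓝 (t * (t + 0)⁻¹)) :=
    tendsto_const_nhds.mul ((tendsto_const_nhds.add h0).inv₀ (by simpa using ht))
  simpa [ht] using h1

section

variable {𝔄 : Type*} [CStarAlgebra 𝔄] [PartialOrder 𝔄] [StarOrderedRing 𝔄]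
  {S : StarSubalgebra ℂ 𝔄} {τ : 𝔄 → ℝ≥0∞}

theorem rpow_mem (hS : IsClosed (S : Set 𝔄)) {a : 𝔄} (ha : a ∈ S) (s : ℝ) : a ^ s ∈ S :=
  cfc_nnreal_mem S hS _ ha

theorem nnreal_smul_mem {𝔄 : Type*} [CStarAlgebra 𝔄] {S : StarSubalgebra ℂ 𝔄} {a : 𝔄} (ha : a ∈ S) (c : ℝ≥0) : c • a ∈ S := by
  have : c • a = ((c : ℝ) : ℂ) • a := by simp [NNReal.smul_def]
  rw [this]
  exact S.smul_mem ha _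

theorem rpow_rpow_mul {a : 𝔄} (ha : 0 ≤ a) {s t : ℝ} (hs : 0 ≤ s) (ht : 0 ≤ t) :
    (a ^ s) ^ t = a ^ (s * t) := CFC.rpow_rpow_of_exponent_nonneg a s t hs ht ha

theorem mul_self_rpow {a : 𝔄} (ha : 0 ≤ a) {t : ℝ} (ht : 0 ≤ t) : (a * a) ^ t = a ^ (2 * t) := by
  rw [← rpow_rpow_mul ha (by norm_num) ht]
  congr 1
  nth_rw 1 2 [← CFC.rpow_one a ha]
  rw [rpow_mul_rpow_of_nonneg (by norm_num) (by norm_num)]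
  norm_num

theorem rpow_conj_half {a : 𝔄} {s t : ℝ} (hs : 0 ≤ s) (ht : 0 ≤ t) :
    a ^ s * a ^ t * a ^ s = a ^ (s + t + s) := by
  rw [rpow_mul_rpow_of_nonneg hs ht, rpow_mul_rpow_of_nonneg (by positivity) hs]

namespace IsTraceOn

theorem mono (h : IsTraceOn S τ) {a b : 𝔄} (ha : a ∈ S) (hb : b ∈ S) (h0 : 0 ≤ a) (hab : a ≤ b) :
    τ a ≤ τ b := by
  have : τ b = τ a + τ (b - a) := by
    rw [← h.add a ha (b - a) (S.sub_mem hb ha) h0 (sub_nonneg.2 hab)]; simp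
  rw [this]; exact le_self_add

omit [StarOrderedRing 𝔄] in
theorem map_zero (h : IsTraceOn S τ) : τ 0 = 0 := by
  have := h.smul 0 0 S.zero_mem le_rfl
  simpa using this

/-- The cut-off functions increase to `f`, also at `0` because `f 0 = 0`. The free exponent `σ` is
chosen at each use to give the truncated function a convenient factorisation. -/
theorem cfc_eq_iSup (h : IsTraceOn S τ) {a : 𝔄} (ha : a ∈ S) {f : ℝ≥0 → ℝ≥0} (hf : Continuous f)
    (hf0 : f 0 = 0) {σ : ℝ} (hσ : 0 ≤ σ) :
    τ (cfc f a) = ⨆ n, τ (cfc (fun t => f t * cutoff n t ^ σ) a) := by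
  have hcont : ∀ n, Continuous (fun t => f t * cutoff n t ^ σ) := fun n =>
    hf.mul ((NNReal.continuous_rpow_const hσ).comp (continuous_cutoff n))
  have hmono : Monotone (fun (n : ℕ) (t : ℝ≥0) => f t * cutoff n t ^ σ) := by
    intro m n hmn t
    exact mul_le_mul_right (NNReal.rpow_le_rpow (monotone_cutoff hmn t) hσ) _
  refine h.normal _ (fun m n hmn => cfc_mono (fun t _ => hmono hmn t) (hcont m).continuousOn
    (hcont n).continuousOn) (fun n => ⟨cfc_nnreal_mem S h.closed _ ha, cfc_nonneg_of_predicate⟩) _ ?_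
  refine tendsto_cfc_of_monotone a _ f hcont hmono hf fun t => ?_
  rcases eq_or_ne t 0 with rfl | ht
  · simp [hf0]
  · have := ((tendsto_cutoff ht).nnrpow (tendsto_const_nhds (x := σ)) (Or.inl one_ne_zero)).const_mul (f t)
    simpa using this

/-- Traciality for `y = x k(x*x)`: intertwining moves `k` through `x`, so that `yy* = k(xx*) xx*
k(xx*)`. -/
theorem cfc_mul_sq_swap (h : IsTraceOn S τ) {x : 𝔄} (hx : x ∈ S) {k : ℝ≥0 → ℝ≥0}
    (hk : Continuous k) :
    τ (cfc (fun t => k t * t * k t) (star x * x)) = τ (cfc (fun t => k t * t * k t) (x * star x)) := by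
  have e : ∀ a : 𝔄, 0 ≤ a → cfc k a * a * cfc k a = cfc (fun t => k t * t * k t) a := by
    intro a ha
    rw [cfc_mul (fun t => k t * t) k a (by fun_prop) (by fun_prop), cfc_mul k (fun t => t) a
      (by fun_prop) (by fun_prop), cfc_id' ℝ≥0 a]
  have hy : x * cfc k (star x * x) ∈ S :=
    mul_mem hx (cfc_nnreal_mem S h.closed _ (mul_mem (star_mem hx) hx))
  have := h.tracial _ hy
  nth_rw 3 [mul_cfc_star_mul_self x k hk] at this
  nth_rw 3 [mul_cfc_star_mul_self x k hk] at this
  rw [star_mul, star_mul, (isSelfAdjoint_cfc_nnreal _ _).star_eq,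
    (isSelfAdjoint_cfc_nnreal _ _).star_eq] at this
  rw [← e _ (star_mul_self_nonneg x), ← e _ (mul_star_self_nonneg x)]
  simpa only [mul_assoc] using this

/-- `τ((x*x)^s) = τ((xx*)^s)`. -/
theorem rpow_swap (h : IsTraceOn S τ) {x : 𝔄} (hx : x ∈ S) {s : ℝ} (hs : 0 < s) :
    τ ((star x * x) ^ s) = τ ((x * star x) ^ s) := by
  have hxx := mul_mem (star_mem hx) hx
  have hxx' := mul_mem hx (star_mem hx)
  have hc := NNReal.continuous_rpow_const hs.le
  have h0 : (0 : ℝ≥0) ^ s = 0 := NNReal.zero_rpow hs.ne'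
  rw [CFC.rpow_def, CFC.rpow_def, h.cfc_eq_iSup hxx hc h0 zero_le_one,
    h.cfc_eq_iSup hxx' hc h0 zero_le_one]
  refine iSup_congr fun n => ?_
  -- The cut-off (with `σ = 1`) supplies a factor `t`, so `t^s` times the cut-off is `k t k` for
  -- this continuous `k`, even when `s < 1`.
  have hk : Continuous fun t : ℝ≥0 => t ^ (s / 2) * (t + ((n : ℝ≥0) + 1)⁻¹)⁻¹ ^ (1 / 2 : ℝ) := by
    refine (NNReal.continuous_rpow_const (by positivity)).mul
      ((NNReal.continuous_rpow_const (by positivity)).comp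
        (Continuous.inv₀ (by fun_prop) fun t => ?_))
    positivity
  have e : (fun t : ℝ≥0 => t ^ s * cutoff n t ^ (1 : ℝ)) = fun t =>
      (t ^ (s / 2) * (t + ((n : ℝ≥0) + 1)⁻¹)⁻¹ ^ (1 / 2 : ℝ)) * t *
      (t ^ (s / 2) * (t + ((n : ℝ≥0) + 1)⁻¹)⁻¹ ^ (1 / 2 : ℝ)) := by
    funext t
    have h1 : t ^ s = t ^ (s / 2) * t ^ (s / 2) := by
      rw [← NNReal.rpow_add_of_nonneg _ (by positivity) (by positivity)]; simp
    have h2 : (t + ((n : ℝ≥0) + 1)⁻¹)⁻¹ =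
        (t + ((n : ℝ≥0) + 1)⁻¹)⁻¹ ^ (1 / 2 : ℝ) * (t + ((n : ℝ≥0) + 1)⁻¹)⁻¹ ^ (1 / 2 : ℝ) := by
      rw [← NNReal.rpow_add_of_nonneg _ (by positivity) (by positivity)]; norm_num
    rw [h1, NNReal.rpow_one, cutoff]
    generalize t ^ (s / 2) = u
    nth_rw 1 [h2]
    generalize (t + ((n : ℝ≥0) + 1)⁻¹)⁻¹ ^ (1 / 2 : ℝ) = v
    ring
  rw [e]
  exact h.cfc_mul_sq_swap hx hk

/-- `τ((c*ac)^s) = τ((a^½cc*a^½)^s)`. -/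
theorem rpow_swap_conj (h : IsTraceOn S τ) {a c : 𝔄} (ha : a ∈ S) (hc : c ∈ S) (h0 : 0 ≤ a)
    {s : ℝ} (hs : 0 < s) :
    τ ((star c * a * c) ^ s) = τ ((a ^ (1 / 2 : ℝ) * (c * star c) * a ^ (1 / 2 : ℝ)) ^ s) := by
  have := h.rpow_swap (x := a ^ (1 / 2 : ℝ) * c) (mul_mem (rpow_mem h.closed ha _) hc) hs
  rw [star_mul, (isSelfAdjoint_rpow a _).star_eq] at this
  convert this using 3
  · rw [mul_assoc, mul_assoc, ← mul_assoc (a ^ (1 / 2 : ℝ)), rpow_half_mul_self h0]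
  · simp only [mul_assoc]

theorem rpow_mono_of_le_one (h : IsTraceOn S τ) {a b : 𝔄} (ha : a ∈ S) (hb : b ∈ S)
    (hab : a ≤ b) {s : ℝ} (hs : 0 ≤ s) (hs1 : s ≤ 1) : τ (a ^ s) ≤ τ (b ^ s) :=
  h.mono (rpow_mem h.closed ha _) (rpow_mem h.closed hb _) CFC.rpow_nonneg
    (CFC.rpow_le_rpow ⟨hs, hs1⟩ hab)

theorem conj_rpow_mem (h : IsTraceOn S τ) {a b : 𝔄} (ha : a ∈ S) (hb : b ∈ S) (s : ℝ) :
    a ^ s * b * a ^ s ∈ S :=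
  mul_mem (mul_mem (rpow_mem h.closed ha _) hb) (rpow_mem h.closed ha _)

theorem conj_rpow_le {a b : 𝔄} (c : 𝔄) (s : ℝ) (hab : a ≤ b) :
    c ^ s * a * c ^ s ≤ c ^ s * b * c ^ s := by
  have := star_left_conjugate_le_conjugate hab (c ^ s)
  rwa [(isSelfAdjoint_rpow c s).star_eq] at this

/-- The trace of a power is monotone: `0 ≤ a ≤ b` implies `τ(a^s) ≤ τ(b^s)`. -/
theorem rpow_mono (h : IsTraceOn S τ) {a b : 𝔄} (ha : a ∈ S) (hb : b ∈ S) (h0 : 0 ≤ a)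
    (hab : a ≤ b) {s : ℝ} (hs : 0 < s) : τ (a ^ s) ≤ τ (b ^ s) := by
  -- Induction on `n` with `s < 2^n`: Löwner–Heinz covers `s ≤ 1`, and each step halves the
  -- exponent.
  obtain ⟨n, hn⟩ := pow_unbounded_of_one_lt s one_lt_two
  induction n generalizing s a b with
  | zero => exact h.rpow_mono_of_le_one ha hb hab hs.le (by simpa using hn.le)
  | succ n ih =>
    have hb0 := h0.trans hab
    have hs2 : 0 < s / 2 := by positivity
    -- Writing `c²` as `c^½ c c^½` lets `a` be replaced by `b` one factor at a time, with the swap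
    -- `a^½ b a^½ ↔ b^½ a b^½` in between; squaring itself is not operator monotone.
    have key : ∀ c : 𝔄, 0 ≤ c → (c ^ (1 / 2 : ℝ) * c * c ^ (1 / 2 : ℝ)) ^ (s / 2) = c ^ s := by
      intro c hc
      have : c ^ (1 / 2 : ℝ) * c * c ^ (1 / 2 : ℝ) = c * c := by
        nth_rw 2 4 5 [← CFC.rpow_one c hc]
        rw [rpow_conj_half (by norm_num) (by norm_num),
          rpow_mul_rpow_of_nonneg (by norm_num) (by norm_num)]
        norm_num
      rw [this, mul_self_rpow hc hs2.le]
      congr 1; ring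
    have nn : ∀ c d : 𝔄, 0 ≤ d → 0 ≤ c ^ (1 / 2 : ℝ) * d * c ^ (1 / 2 : ℝ) := by
      intro c d hd
      simpa using conj_rpow_le c (1 / 2) hd
    have hlt : s / 2 < 2 ^ n := by rw [pow_succ] at hn; linarith
    calc τ (a ^ s) = τ ((a ^ (1 / 2 : ℝ) * a * a ^ (1 / 2 : ℝ)) ^ (s / 2)) := by rw [key a h0]
      _ ≤ τ ((a ^ (1 / 2 : ℝ) * b * a ^ (1 / 2 : ℝ)) ^ (s / 2)) :=
        ih (h.conj_rpow_mem ha ha _) (h.conj_rpow_mem ha hb _) (nn _ _ h0) (conj_rpow_le _ _ hab)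
          hs2 hlt
      _ = τ ((b ^ (1 / 2 : ℝ) * a * b ^ (1 / 2 : ℝ)) ^ (s / 2)) := by
        have := h.rpow_swap_conj (c := a ^ (1 / 2 : ℝ)) hb (rpow_mem h.closed ha _) hb0 hs2
        rwa [(isSelfAdjoint_rpow a _).star_eq, rpow_half_mul_self h0] at this
      _ ≤ τ ((b ^ (1 / 2 : ℝ) * b * b ^ (1 / 2 : ℝ)) ^ (s / 2)) :=
        ih (h.conj_rpow_mem hb ha _) (h.conj_rpow_mem hb hb _) (nn _ _ h0) (conj_rpow_le _ _ hab)
          hs2 hlt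
      _ = τ (b ^ s) := by rw [key b hb0]

/-- After the swap the compressed operator is `a^½ ww* a^½ ≤ a`. -/
theorem rpow_conj_le (h : IsTraceOn S τ) {a w : 𝔄} (ha : a ∈ S) (hw : w ∈ S) (h0 : 0 ≤ a)
    (hw1 : w * star w ≤ 1) {s : ℝ} (hs : 0 < s) : τ ((star w * a * w) ^ s) ≤ τ (a ^ s) := by
  rw [h.rpow_swap_conj ha hw h0 hs]
  refine h.rpow_mono (h.conj_rpow_mem ha (mul_mem hw (star_mem hw)) _) ha ?_ ?_ hs
  · simpa using conj_rpow_le a (1 / 2) (mul_star_self_nonneg w)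
  · have := conj_rpow_le a (1 / 2) hw1
    rwa [mul_one, rpow_half_mul_self h0] at this

theorem rpow_smul (h : IsTraceOn S τ) {a : 𝔄} (ha : a ∈ S) (h0 : 0 ≤ a) (c : ℝ≥0) {s : ℝ}
    (hs : 0 ≤ s) : τ ((c • a) ^ s) = (c : ℝ≥0∞) ^ s * τ (a ^ s) := by
  rw [smul_rpow_of_nonneg h0 hs, h.smul _ _ (rpow_mem h.closed ha _) CFC.rpow_nonneg,
    ENNReal.coe_rpow_of_nonneg _ hs]

end IsTraceOn

end

end

/-! ### Rotfel'd and Young inequalities for positive operators -/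

section

section

variable {𝔄 : Type*} [CStarAlgebra 𝔄] [PartialOrder 𝔄] [StarOrderedRing 𝔄]
  {S : StarSubalgebra ℂ 𝔄} {τ : 𝔄 → ℝ≥0∞}

theorem continuous_add_rpow {ε : ℝ≥0} (hε : 0 < ε) (u : ℝ) :
    Continuous fun t : ℝ≥0 => (t + ε) ^ u := by
  refine continuous_iff_continuousAt.2 fun t => ?_
  have h : t + ε ≠ 0 := by positivity
  exact (NNReal.continuousAt_rpow (x := t + ε) (y := u) (Or.inl h)).comp
    (f := fun t : ℝ≥0 => (t + ε, u)) (by fun_prop)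

theorem cfc_add_rpow {a : 𝔄} (ha : 0 ≤ a) {ε : ℝ≥0} (hε : 0 < ε) (u : ℝ) :
    cfc (fun t : ℝ≥0 => (t + ε) ^ u) a = (a + algebraMap ℝ≥0 𝔄 ε) ^ u := by
  have h1 : cfc (fun t : ℝ≥0 => t + ε) a = a + algebraMap ℝ≥0 𝔄 ε := by
    rw [cfc_add a (fun t => t) (fun _ => ε) (by fun_prop) (by fun_prop), cfc_id' ℝ≥0 a,
      cfc_const ε a]
  rw [CFC.rpow_def, ← h1, ← cfc_comp' (fun t : ℝ≥0 => t ^ u) (fun t => t + ε) a _ (by fun_prop) ha]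
  rintro _ ⟨t, _, rfl⟩
  have h : t + ε ≠ 0 := by positivity
  exact ((NNReal.continuousAt_rpow (x := t + ε) (y := u) (Or.inl h)).comp
    (f := fun t : ℝ≥0 => (t, u)) (by fun_prop)).continuousWithinAt

/-- `t ↦ (t + ε)^(-u)` is operator antitone for `0 < u ≤ 1`. -/
theorem cfc_add_rpow_antitone {a c : 𝔄} (ha : 0 ≤ a) (hac : a ≤ c) {ε : ℝ≥0} (hε : 0 < ε) {u : ℝ}
    (hu : 0 < u) (hu1 : u ≤ 1) :
    cfc (fun t : ℝ≥0 => (t + ε) ^ (-u)) c ≤ cfc (fun t : ℝ≥0 => (t + ε) ^ (-u)) a := by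
  have hε' : IsStrictlyPositive (algebraMap ℝ≥0 𝔄 ε) := by
    have : algebraMap ℝ≥0 𝔄 ε = algebraMap ℝ 𝔄 ε := rfl
    rw [this, IsStrictlyPositive.iff_of_unital]
    refine ⟨algebraMap_nonneg 𝔄 ε.2, ?_⟩
    exact (IsUnit.mk0 (ε : ℝ) (by exact_mod_cast hε.ne')).map (algebraMap ℝ 𝔄)
  have hpa : IsStrictlyPositive (a + algebraMap ℝ≥0 𝔄 ε) := IsStrictlyPositive.nonneg_add ha hε'
  have hle : a + algebraMap ℝ≥0 𝔄 ε ≤ c + algebraMap ℝ≥0 𝔄 ε := by gcongr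
  have hpc : IsStrictlyPositive (c + algebraMap ℝ≥0 𝔄 ε) :=
    IsStrictlyPositive.nonneg_add (ha.trans hac) hε'
  rw [cfc_add_rpow ha hε, cfc_add_rpow (ha.trans hac) hε]
  -- Antitonicity is Löwner–Heinz for the exponent `u` followed by inversion.
  have e : ∀ d : 𝔄, IsStrictlyPositive d → d ^ (-u) = (d ^ u) ^ (-1 : ℝ) := by
    intro d hd
    rw [CFC.rpow_rpow d u (-1) hu.ne' hd]; simp
  rw [e _ hpa, e _ hpc]
  exact CStarAlgebra.rpow_neg_one_le_rpow_neg_one (CFC.rpow_le_rpow ⟨hu.le, hu1⟩ hle) (hpa.rpow _ _)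

theorem conj_cfc (f g : ℝ≥0 → ℝ≥0) (hf : Continuous f) (hg : Continuous g) (a : 𝔄) :
    cfc f a * cfc g a * cfc f a = cfc (fun t => f t * g t * f t) a := by
  rw [cfc_mul (fun t => f t * g t) f a (by fun_prop) (by fun_prop), cfc_mul f g a (by fun_prop)
    (by fun_prop)]

namespace IsTraceOn

/-- `τ(b^u a^(2v) b^u) = τ(a^v b^(2u) a^v)`. -/
theorem conj_rpow_swap (h : IsTraceOn S τ) {a b : 𝔄} (ha : a ∈ S) (hb : b ∈ S) {u v : ℝ}
    (hu : 0 ≤ u) (hv : 0 ≤ v) :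
    τ (b ^ u * a ^ (2 * v) * b ^ u) = τ (a ^ v * b ^ (2 * u) * a ^ v) := by
  have := h.tracial (a ^ v * b ^ u) (mul_mem (rpow_mem h.closed ha _) (rpow_mem h.closed hb _))
  rw [star_mul, (isSelfAdjoint_rpow a v).star_eq, (isSelfAdjoint_rpow b u).star_eq] at this
  rw [two_mul, two_mul, ← rpow_mul_rpow_of_nonneg hu hu, ← rpow_mul_rpow_of_nonneg hv hv]
  simpa only [mul_assoc] using this

/-- `τ(b^½ f(a) b^½) = τ(f(a)^½ b f(a)^½)` for `f = k²`. -/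
theorem conj_cfc_swap (h : IsTraceOn S τ) {a c : 𝔄} (ha : a ∈ S) (hc : c ∈ S) (h0 : 0 ≤ a)
    (k : ℝ≥0 → ℝ≥0) (hk : Continuous k) :
    τ (cfc k c * a * cfc k c) =
      τ (a ^ (1 / 2 : ℝ) * cfc (fun t => k t * k t) c * a ^ (1 / 2 : ℝ)) := by
  have := h.tracial (a ^ (1 / 2 : ℝ) * cfc k c)
    (mul_mem (rpow_mem h.closed ha _) (cfc_nnreal_mem S h.closed _ hc))
  rw [star_mul, (isSelfAdjoint_rpow a _).star_eq, (isSelfAdjoint_cfc_nnreal k c).star_eq] at this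
  rw [cfc_mul k k c (by fun_prop) (by fun_prop)]
  nth_rw 1 [← rpow_half_mul_self h0]
  simpa only [mul_assoc] using this

/-- With `c = a + b`, the regularised power `c (c + ε)^(s-1)` equals `k(c) a k(c) + k(c) b k(c)`,
where `k² = (t + ε)^(s-1)`. For `d = a, b` one has `d ≤ c`, so after a swap operator antitonicity
replaces `(c + ε)^(s-1)` by `(d + ε)^(s-1)`, and `t (t + ε)^(s-1) ≤ t^s` finishes. -/
theorem rpow_add_le (h : IsTraceOn S τ) {a b : 𝔄} (ha : a ∈ S) (hb : b ∈ S) (ha0 : 0 ≤ a)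
    (hb0 : 0 ≤ b) {s : ℝ} (hs : 0 < s) (hs1 : s ≤ 1) : τ ((a + b) ^ s) ≤ τ (a ^ s) + τ (b ^ s) := by
  have hab0 : 0 ≤ a + b := add_nonneg ha0 hb0
  rcases hs1.eq_or_lt with rfl | hs1
  · rw [CFC.rpow_one a ha0, CFC.rpow_one b hb0, CFC.rpow_one _ hab0, h.add a ha b hb ha0 hb0]
  have habm : a + b ∈ S := add_mem ha hb
  have hu : 0 < 1 - s := by linarith
  -- The choice `σ = 1 - s` turns the truncated power into `t (t + ε)^(s-1)`.
  rw [CFC.rpow_def (a := a + b), h.cfc_eq_iSup habm (NNReal.continuous_rpow_const hs.le)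
    (NNReal.zero_rpow hs.ne') hu.le]
  refine iSup_le fun n => ?_
  set ε : ℝ≥0 := ((n : ℝ≥0) + 1)⁻¹ with hεd
  have hε : 0 < ε := by positivity
  set k : ℝ≥0 → ℝ≥0 := fun t => (t + ε) ^ (-((1 - s) / 2)) with hkd
  have hk : Continuous k := continuous_add_rpow hε _
  have hkk : (fun t => k t * k t) = fun t => (t + ε) ^ (-(1 - s)) := by
    funext t
    have h' : t + ε ≠ 0 := by positivity
    simp only [hkd]
    rw [← NNReal.rpow_add h']
    congr 1; ring
  have hg : Continuous fun t : ℝ≥0 => (t + ε) ^ (-(1 - s)) := continuous_add_rpow hε _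
  have e : (fun t : ℝ≥0 => t ^ s * cutoff n t ^ (1 - s)) = fun t => k t * t * k t := by
    funext t
    have h' : t + ε ≠ 0 := by positivity
    have h2 : k t * t * k t = t * (k t * k t) := by ring
    rw [h2, show k t * k t = (t + ε) ^ (-(1 - s)) from congrFun hkk t, cutoff, NNReal.mul_rpow,
      ← mul_assoc, ← NNReal.rpow_add_of_nonneg _ hs.le hu.le, NNReal.inv_rpow, ← NNReal.rpow_neg]
    simp [hεd]
  have e2 : ∀ d : 𝔄, d ∈ S → 0 ≤ d → d ≤ a + b → τ (cfc k (a + b) * d * cfc k (a + b)) ≤ τ (d ^ s) := by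
    intro d hd hd0 hdc
    rw [h.conj_cfc_swap hd habm hd0 k hk, hkk]
    have hm : cfc (fun t : ℝ≥0 => (t + ε) ^ (-(1 - s))) d ∈ S := cfc_nnreal_mem S h.closed _ hd
    have hm' : cfc (fun t : ℝ≥0 => (t + ε) ^ (-(1 - s))) (a + b) ∈ S :=
      cfc_nnreal_mem S h.closed _ habm
    have hh := NNReal.continuous_rpow_const (y := (1 / 2 : ℝ)) (by norm_num)
    refine h.mono (h.conj_rpow_mem hd hm' _) (rpow_mem h.closed hd _) ?_ ?_
    · simpa using conj_rpow_le d (1 / 2) (cfc_nonneg_of_predicate (a := a + b)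
        (f := fun t : ℝ≥0 => (t + ε) ^ (-(1 - s))))
    · refine (conj_rpow_le d (1 / 2) (cfc_add_rpow_antitone hd0 hdc hε hu (by linarith))).trans ?_
      rw [CFC.rpow_def, conj_cfc _ _ hh hg, CFC.rpow_def]
      refine cfc_mono (fun t _ => ?_) (by fun_prop) (NNReal.continuous_rpow_const hs.le).continuousOn
      have h3 : t ^ (1 / 2 : ℝ) * (t + ε) ^ (-(1 - s)) * t ^ (1 / 2 : ℝ)
          = t * (t + ε) ^ (-(1 - s)) := by
        rw [mul_right_comm, ← NNReal.rpow_add_of_nonneg _ (by norm_num) (by norm_num)]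
        norm_num
      rw [h3]
      rcases eq_or_ne t 0 with rfl | ht
      · simp
      have h4 : t ^ s = t * t ^ (-(1 - s)) := by
        nth_rw 2 [← NNReal.rpow_one t]
        rw [← NNReal.rpow_add ht]; congr 1; ring
      rw [h4]
      gcongr 1
      rw [NNReal.rpow_neg, NNReal.rpow_neg]
      gcongr
      simp
  have e3 : cfc (fun t : ℝ≥0 => t ^ s * cutoff n t ^ (1 - s)) (a + b)
      = cfc k (a + b) * a * cfc k (a + b) + cfc k (a + b) * b * cfc k (a + b) := by
    rw [e, ← conj_cfc k (fun t => t) hk continuous_id, cfc_id' ℝ≥0 (a + b)]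
    noncomm_ring
  have hK : cfc k (a + b) ∈ S := cfc_nnreal_mem S h.closed _ habm
  have nn : ∀ d : 𝔄, 0 ≤ d → 0 ≤ cfc k (a + b) * d * cfc k (a + b) := by
    intro d hd
    have := star_left_conjugate_nonneg hd (cfc k (a + b))
    rwa [(isSelfAdjoint_cfc_nnreal k (a + b)).star_eq] at this
  rw [e3, h.add _ (mul_mem (mul_mem hK ha) hK) _ (mul_mem (mul_mem hK hb) hK) (nn _ ha0) (nn _ hb0)]
  exact add_le_add (e2 a ha ha0 (le_add_of_nonneg_right hb0)) (e2 b hb hb0 (le_add_of_nonneg_left ha0))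

theorem rpow_zero' (h : IsTraceOn S τ) {s : ℝ} (hs : 0 < s) : τ ((0 : 𝔄) ^ s) = 0 := by
  have : (0 : 𝔄) ^ s = 0 := CFC.zero_rpow hs.ne'
  rw [this, h.map_zero]

/-- Rotfel'd's inequality: `τ((∑ aᵢ)^s) ≤ ∑ τ(aᵢ^s)` for positive `aᵢ` and `0 < s ≤ 1`. -/
theorem rpow_sum_le (h : IsTraceOn S τ) {ι : Type*} (F : Finset ι) {a : ι → 𝔄} (ha : ∀ i, a i ∈ S)
    (h0 : ∀ i, 0 ≤ a i) {s : ℝ} (hs : 0 < s) (hs1 : s ≤ 1) :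
    τ ((∑ i ∈ F, a i) ^ s) ≤ ∑ i ∈ F, τ (a i ^ s) := by
  classical
  induction F using Finset.induction_on with
  | empty => simp [h.rpow_zero' hs]
  | insert i F hi ih =>
    rw [Finset.sum_insert hi, Finset.sum_insert hi]
    exact (h.rpow_add_le (ha i) (sum_mem fun j _ => ha j) (h0 i) (Finset.sum_nonneg fun j _ => h0 j)
      hs hs1).trans (by gcongr)

/-- A quasi-triangle inequality for positive operators, for all exponents. -/
theorem exists_rpow_add_le (h : IsTraceOn S τ) {s : ℝ} (hs : 0 < s) : ∃ K : ℝ≥0, ∀ a ∈ S, ∀ b ∈ S,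
    0 ≤ a → 0 ≤ b → τ ((a + b) ^ s) ≤ K * (τ (a ^ s) + τ (b ^ s)) := by
  obtain ⟨n, hn⟩ := pow_unbounded_of_one_lt s one_lt_two
  induction n generalizing s with
  | zero =>
    refine ⟨1, fun a ha b hb ha0 hb0 => ?_⟩
    simpa using h.rpow_add_le ha hb ha0 hb0 hs (by simpa using hn.le)
  | succ n ih =>
    have hs2 : 0 < s / 2 := by positivity
    obtain ⟨K, hK⟩ := ih hs2 (by rw [pow_succ] at hn; linarith)
    refine ⟨2 ^ (s / 2) * K, fun a ha b hb ha0 hb0 => ?_⟩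
    have e : ∀ c : 𝔄, 0 ≤ c → c ^ s = (c * c) ^ (s / 2) := by
      intro c hc
      rw [mul_self_rpow hc hs2.le]; congr 1; ring
    have hsq : ∀ c : 𝔄, 0 ≤ c → 0 ≤ c * c := by
      intro c hc
      have := star_mul_self_nonneg c
      rwa [hc.isSelfAdjoint.star_eq] at this
    have hle : (a + b) * (a + b) ≤ (2 : ℝ≥0) • (a * a + b * b) := by
      have h1 := star_mul_self_nonneg (a - b)
      rw [star_sub, ha0.isSelfAdjoint.star_eq, hb0.isSelfAdjoint.star_eq] at h1
      rw [← sub_nonneg]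
      convert h1 using 1
      have : (2 : ℝ≥0) • (a * a + b * b) = (a * a + b * b) + (a * a + b * b) := two_smul _ _
      rw [this]
      noncomm_ring
    have hsum : a * a + b * b ∈ S := add_mem (mul_mem ha ha) (mul_mem hb hb)
    have hsum0 := add_nonneg (hsq a ha0) (hsq b hb0)
    calc τ ((a + b) ^ s) = τ (((a + b) * (a + b)) ^ (s / 2)) := by rw [e _ (add_nonneg ha0 hb0)]
      _ ≤ τ (((2 : ℝ≥0) • (a * a + b * b)) ^ (s / 2)) :=
        h.rpow_mono (mul_mem (add_mem ha hb) (add_mem ha hb)) (nnreal_smul_mem hsum 2)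
          (hsq _ (add_nonneg ha0 hb0)) hle hs2
      _ = ((2 : ℝ≥0) : ℝ≥0∞) ^ (s / 2) * τ ((a * a + b * b) ^ (s / 2)) :=
        h.rpow_smul hsum hsum0 2 hs2.le
      _ ≤ ((2 : ℝ≥0) : ℝ≥0∞) ^ (s / 2) * (K * (τ ((a * a) ^ (s / 2)) + τ ((b * b) ^ (s / 2)))) := by
        gcongr
        exact hK _ (mul_mem ha ha) _ (mul_mem hb hb) (hsq a ha0) (hsq b hb0)
      _ = _ := by
        rw [← e a ha0, ← e b hb0, ENNReal.coe_mul, ENNReal.coe_rpow_of_nonneg _ hs2.le, mul_assoc]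

/-- Both `α` and `β` are at most `α + β`, and `1 - θ` and `θ` are exponents in the Löwner–Heinz
range. Replacing each in turn by `α + β`, with a swap in between, leaves `τ(α + β)`. -/
theorem young (h : IsTraceOn S τ) {α β : 𝔄} (hα : α ∈ S) (hβ : β ∈ S) (hα0 : 0 ≤ α) (hβ0 : 0 ≤ β)
    {θ : ℝ} (h0 : 0 ≤ θ) (h1 : θ ≤ 1) :
    τ (β ^ (θ / 2) * α ^ (1 - θ) * β ^ (θ / 2)) ≤ τ α + τ β := by
  rw [← h.add _ hα _ hβ hα0 hβ0]
  have hc : α + β ∈ S := add_mem hα hβ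
  have hc0 := add_nonneg hα0 hβ0
  have nn : ∀ (c d : 𝔄) (u v : ℝ), 0 ≤ c ^ u * d ^ v * c ^ u := fun c d u v => by
    simpa using conj_rpow_le c u (CFC.rpow_nonneg (a := d) (y := v))
  calc τ (β ^ (θ / 2) * α ^ (1 - θ) * β ^ (θ / 2))
      ≤ τ (β ^ (θ / 2) * (α + β) ^ (1 - θ) * β ^ (θ / 2)) :=
        h.mono (h.conj_rpow_mem hβ (rpow_mem h.closed hα _) _)
          (h.conj_rpow_mem hβ (rpow_mem h.closed hc _) _) (nn _ _ _ _)
          (conj_rpow_le _ _ (CFC.rpow_le_rpow ⟨by linarith, by linarith⟩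
            (le_add_of_nonneg_right hβ0)))
    _ = τ ((α + β) ^ ((1 - θ) / 2) * β ^ θ * (α + β) ^ ((1 - θ) / 2)) := by
        have := h.conj_rpow_swap hc hβ (u := θ / 2) (v := (1 - θ) / 2) (by linarith) (by linarith)
        rwa [show 2 * ((1 - θ) / 2) = 1 - θ by ring, show 2 * (θ / 2) = θ by ring] at this
    _ ≤ τ ((α + β) ^ ((1 - θ) / 2) * (α + β) ^ θ * (α + β) ^ ((1 - θ) / 2)) :=
        h.mono (h.conj_rpow_mem hc (rpow_mem h.closed hβ _) _)
          (h.conj_rpow_mem hc (rpow_mem h.closed hc _) _) (nn _ _ _ _)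
          (conj_rpow_le _ _ (CFC.rpow_le_rpow ⟨by linarith, by linarith⟩
            (le_add_of_nonneg_left hα0)))
    _ = τ (α + β) := by
        rw [rpow_conj_half (by linarith) h0, show (1 - θ) / 2 + θ + (1 - θ) / 2 = 1 by ring,
          CFC.rpow_one _ hc0]

/-- The multiplicative form, from the additive one for `α/s` and `β/t`, each of trace at most `1`;
hence the constant `2`. -/
theorem young_scaled (h : IsTraceOn S τ) {α β : 𝔄} (hα : α ∈ S) (hβ : β ∈ S) (hα0 : 0 ≤ α)
    (hβ0 : 0 ≤ β) {θ : ℝ} (h0 : 0 ≤ θ) (h1 : θ ≤ 1) {s t : ℝ≥0} (hs : s ≠ 0) (ht : t ≠ 0)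
    (hαs : τ α ≤ s) (hβt : τ β ≤ t) :
    τ (β ^ (θ / 2) * α ^ (1 - θ) * β ^ (θ / 2)) ≤ 2 * (s ^ (1 - θ) * t ^ θ : ℝ≥0) := by
  have hθ : 0 ≤ θ / 2 := by linarith
  have hθ' : 0 ≤ 1 - θ := by linarith
  have key := h.young (nnreal_smul_mem hα s⁻¹) (nnreal_smul_mem hβ t⁻¹) (smul_nonneg zero_le hα0)
    (smul_nonneg zero_le hβ0) h0 h1
  rw [smul_rpow_of_nonneg hα0 hθ', smul_rpow_of_nonneg hβ0 hθ, h.smul _ _ hα hα0,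
    h.smul _ _ hβ hβ0] at key
  have e : ((t⁻¹ ^ (θ / 2)) • β ^ (θ / 2) * (s⁻¹ ^ (1 - θ)) • α ^ (1 - θ)
      * (t⁻¹ ^ (θ / 2)) • β ^ (θ / 2)) = (t⁻¹ ^ θ * s⁻¹ ^ (1 - θ)) •
        (β ^ (θ / 2) * α ^ (1 - θ) * β ^ (θ / 2)) := by
    simp only [smul_mul_assoc, mul_smul_comm, smul_smul]
    congr 1
    have : t⁻¹ ^ θ = t⁻¹ ^ (θ / 2) * t⁻¹ ^ (θ / 2) := by
      rw [← NNReal.rpow_add_of_nonneg _ hθ hθ]; congr 1; ring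
    rw [this]; ring
  have hm := h.conj_rpow_mem hβ (rpow_mem h.closed hα (1 - θ)) (θ / 2)
  have nn : 0 ≤ β ^ (θ / 2) * α ^ (1 - θ) * β ^ (θ / 2) := by
    simpa using conj_rpow_le β (θ / 2) (CFC.rpow_nonneg (a := α) (y := 1 - θ))
  rw [e, h.smul _ _ hm nn] at key
  have hb : (s⁻¹ : ℝ≥0) * τ α + (t⁻¹ : ℝ≥0) * τ β ≤ 2 := by
    have h2 : (s⁻¹ : ℝ≥0) * τ α ≤ 1 := by
      refine (mul_le_mul_right hαs _).trans ?_
      rw [← ENNReal.coe_mul, inv_mul_cancel₀ hs]; simp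
    have h3 : (t⁻¹ : ℝ≥0) * τ β ≤ 1 := by
      refine (mul_le_mul_right hβt _).trans ?_
      rw [← ENNReal.coe_mul, inv_mul_cancel₀ ht]; simp
    calc _ ≤ (1 : ℝ≥0∞) + 1 := add_le_add h2 h3
      _ = 2 := one_add_one_eq_two
  have key2 := key.trans hb
  have hprod : (s ^ (1 - θ) * t ^ θ) * (t⁻¹ ^ θ * s⁻¹ ^ (1 - θ)) = 1 := by
    rw [NNReal.inv_rpow, NNReal.inv_rpow]
    have hs' : s ^ (1 - θ) ≠ 0 := (NNReal.rpow_pos (pos_iff_ne_zero.2 hs)).ne'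
    have ht' : t ^ θ ≠ 0 := (NNReal.rpow_pos (pos_iff_ne_zero.2 ht)).ne'
    field_simp
  calc τ (β ^ (θ / 2) * α ^ (1 - θ) * β ^ (θ / 2))
      = ((s ^ (1 - θ) * t ^ θ : ℝ≥0) : ℝ≥0∞) * (((t⁻¹ ^ θ * s⁻¹ ^ (1 - θ) : ℝ≥0) : ℝ≥0∞) *
        τ (β ^ (θ / 2) * α ^ (1 - θ) * β ^ (θ / 2))) := by
        rw [← mul_assoc, ← ENNReal.coe_mul, hprod]; simp
    _ ≤ ((s ^ (1 - θ) * t ^ θ : ℝ≥0) : ℝ≥0∞) * 2 := by gcongr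
    _ = _ := mul_comm _ _

end IsTraceOn

end

end

/-! ### Polar parts and Minkowski's inequality for positive operators -/

section

/-- `τ(|x|^s)`. -/
def absPow {𝔄 : Type*} [CStarAlgebra 𝔄] [PartialOrder 𝔄] [StarOrderedRing 𝔄] (τ : 𝔄 → ℝ≥0∞)
    (s : ℝ) (x : 𝔄) : ℝ≥0∞ := τ ((star x * x) ^ (s / 2))

section

variable {𝔄 : Type*} [CStarAlgebra 𝔄] [PartialOrder 𝔄] [StarOrderedRing 𝔄]
  {S : StarSubalgebra ℂ 𝔄} {τ : 𝔄 → ℝ≥0∞}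

theorem mul_star_self_le_one {w : 𝔄} (hw : ‖w‖ ≤ 1) : w * star w ≤ 1 := by
  refine (CStarAlgebra.norm_le_one_iff_of_nonneg _ (mul_star_self_nonneg w)).1 ?_
  refine (norm_mul_le _ _).trans ?_
  rw [norm_star]; nlinarith [norm_nonneg w]

theorem star_mul_self_le_one {w : 𝔄} (hw : ‖w‖ ≤ 1) : star w * w ≤ 1 := by
  have := mul_star_self_le_one (w := star w) (by rwa [norm_star])
  rwa [star_star] at this

theorem norm_le_one_of_star_mul_self_le_one {w : 𝔄} (hw : star w * w ≤ 1) : ‖w‖ ≤ 1 := by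
  have := (CStarAlgebra.norm_le_one_iff_of_nonneg _ (star_mul_self_nonneg w)).2 hw
  rw [CStarRing.norm_star_mul_self] at this
  nlinarith [norm_nonneg w]

theorem continuous_add_inv {ε : ℝ≥0} (hε : 0 < ε) : Continuous fun t : ℝ≥0 => (t + ε)⁻¹ :=
  Continuous.inv₀ (by fun_prop) fun t => by positivity

/-- The regularised polar part `x (|x| + ε)⁻¹` is a contraction. -/
theorem norm_polar_le_one (x : 𝔄) {ε : ℝ≥0} (hε : 0 < ε) :
    ‖x * cfc (fun t : ℝ≥0 => (t + ε)⁻¹) ((star x * x) ^ (1 / 2 : ℝ))‖ ≤ 1 := by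
  set h : 𝔄 := (star x * x) ^ (1 / 2 : ℝ) with hh
  have h0 : 0 ≤ h := CFC.rpow_nonneg
  have hsq : h * h = star x * x := rpow_half_mul_self (star_mul_self_nonneg x)
  have hc := continuous_add_inv hε
  apply norm_le_one_of_star_mul_self_le_one
  rw [star_mul, (isSelfAdjoint_cfc_nnreal _ _).star_eq]
  have e : cfc (fun t : ℝ≥0 => (t + ε)⁻¹) h * star x * (x * cfc (fun t : ℝ≥0 => (t + ε)⁻¹) h)
      = cfc (fun t : ℝ≥0 => (t + ε)⁻¹ * (t * t) * (t + ε)⁻¹) h := by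
    rw [← conj_cfc (fun t : ℝ≥0 => (t + ε)⁻¹) (fun t => t * t) hc (by fun_prop),
      cfc_mul (fun t : ℝ≥0 => t) (fun t => t) h (by fun_prop) (by fun_prop), cfc_id' ℝ≥0 h, hsq]
    simp only [mul_assoc]
  rw [e]
  have h1 : cfc (fun _ : ℝ≥0 => (1 : ℝ≥0)) h = 1 := by rw [cfc_const (1 : ℝ≥0) h]; simp
  rw [← h1]
  refine cfc_mono (fun t _ => ?_) (by fun_prop) (by fun_prop)
  have h2 : (t + ε)⁻¹ * t ≤ 1 := by
    rw [inv_mul_le_iff₀ (by positivity)]; simp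
  calc (t + ε)⁻¹ * (t * t) * (t + ε)⁻¹ = ((t + ε)⁻¹ * t) * ((t + ε)⁻¹ * t) := by ring
    _ ≤ 1 * 1 := mul_le_mul' h2 h2
    _ = 1 := one_mul 1

/-- Regularised form of `u|x|u* = |x*|`: intertwining makes the left side a function of `xx*`,
namely `√t (√t/(√t + ε))² ≤ √t`. -/
theorem polar_conj_le (x : 𝔄) {ε : ℝ≥0} (hε : 0 < ε) :
    x * cfc (fun t : ℝ≥0 => (t + ε)⁻¹) ((star x * x) ^ (1 / 2 : ℝ)) * (star x * x) ^ (1 / 2 : ℝ) *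
      star (x * cfc (fun t : ℝ≥0 => (t + ε)⁻¹) ((star x * x) ^ (1 / 2 : ℝ))) ≤
      (x * star x) ^ (1 / 2 : ℝ) := by
  set h : 𝔄 := (star x * x) ^ (1 / 2 : ℝ) with hh
  set b : 𝔄 := (x * star x) ^ (1 / 2 : ℝ) with hb
  have hc := continuous_add_inv hε
  set g : 𝔄 := cfc (fun t : ℝ≥0 => (t + ε)⁻¹) h with hg
  set v : 𝔄 := x * g with hv
  have hG : Continuous fun t : ℝ≥0 => (t ^ (1 / 2 : ℝ) + ε)⁻¹ :=
    hc.comp (NNReal.continuous_rpow_const (by norm_num))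
  have hhalf : Continuous fun t : ℝ≥0 => t ^ (1 / 2 : ℝ) :=
    NNReal.continuous_rpow_const (by norm_num)
  set G : ℝ≥0 → ℝ≥0 := fun t => (t ^ (1 / 2 : ℝ) + ε)⁻¹ * t ^ (1 / 2 : ℝ) *
    (t ^ (1 / 2 : ℝ) + ε)⁻¹ with hGd
  have hGc : Continuous G := (hG.mul hhalf).mul hG
  have e1 : g = cfc (fun t : ℝ≥0 => (t ^ (1 / 2 : ℝ) + ε)⁻¹) (star x * x) := by
    rw [hg, hh, CFC.rpow_def, ← cfc_comp' (fun t : ℝ≥0 => (t + ε)⁻¹) _ (star x * x)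
      hc.continuousOn hhalf.continuousOn (star_mul_self_nonneg x)]
  have e2 : g * h * g = cfc G (star x * x) := by
    rw [e1, hh, CFC.rpow_def, conj_cfc _ _ hG hhalf]
  have e3 : v * h * star v = cfc G (x * star x) * (x * star x) := by
    rw [hv, star_mul, (isSelfAdjoint_cfc_nnreal _ _).star_eq]
    calc x * g * h * (g * star x) = x * (g * h * g) * star x := by simp only [mul_assoc]
      _ = _ := by rw [e2, mul_cfc_star_mul_self x G hGc, mul_assoc]
  have e4 : cfc G (x * star x) * (x * star x) = cfc (fun t => G t * t) (x * star x) := by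
    rw [cfc_mul G (fun t => t) _ (by fun_prop) (by fun_prop),
      cfc_id' ℝ≥0 (x * star x) (mul_star_self_nonneg x)]
  rw [e3, e4, hb, CFC.rpow_def]
  refine cfc_mono (fun t _ => ?_) (by fun_prop) hhalf.continuousOn
  have ht : t = t ^ (1 / 2 : ℝ) * t ^ (1 / 2 : ℝ) := by
    rw [← NNReal.rpow_add_of_nonneg _ (by norm_num) (by norm_num)]; norm_num
  have hGt : G t = (t ^ (1 / 2 : ℝ) + ε)⁻¹ * t ^ (1 / 2 : ℝ) * (t ^ (1 / 2 : ℝ) + ε)⁻¹ := rfl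
  generalize t ^ (1 / 2 : ℝ) = u at ht hGt ⊢
  have h2 : (u + ε)⁻¹ * u ≤ 1 := by
    rw [inv_mul_le_iff₀ (by positivity)]; simp
  calc G t * t = ((u + ε)⁻¹ * u) * ((u + ε)⁻¹ * u) * u := by rw [hGt, ht]; ring
    _ ≤ 1 * 1 * u := by gcongr
    _ = u := by simp

/-- `2 Re(w*x) ≤ w*|x*|w + |x|` for a contraction `w`. -/
theorem star_mul_add_le (x w : 𝔄) (hw : ‖w‖ ≤ 1) :
    star w * x + star x * w ≤
      star w * (x * star x) ^ (1 / 2 : ℝ) * w + (star x * x) ^ (1 / 2 : ℝ) := by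
  set h : 𝔄 := (star x * x) ^ (1 / 2 : ℝ) with hh
  set b : 𝔄 := (x * star x) ^ (1 / 2 : ℝ) with hb
  have h0 : 0 ≤ h := CFC.rpow_nonneg
  have key : ∀ ε : ℝ≥0, 0 < ε →
      star w * x + star x * w ≤ star w * b * w + h + (ε : ℝ) • (1 + 1 : 𝔄) := by
    intro ε hε
    have hc := continuous_add_inv hε
    set g : 𝔄 := cfc (fun t : ℝ≥0 => (t + ε)⁻¹) h with hg
    set v : 𝔄 := x * g with hv
    have hvn : ‖v‖ ≤ 1 := norm_polar_le_one x hε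
    -- The identity `v (|x| + ε) = x` replaces the polar decomposition at the price of an error of
    -- size `ε`.
    have hx : x = v * h + (ε : ℝ) • v := by
      have e : g * (h + algebraMap ℝ≥0 𝔄 ε) = 1 := by
        have h1 : cfc (fun t : ℝ≥0 => t + ε) h = h + algebraMap ℝ≥0 𝔄 ε := by
          rw [cfc_add h (fun t => t) (fun _ => ε) (by fun_prop) (by fun_prop), cfc_id' ℝ≥0 h,
            cfc_const ε h]
        rw [← h1, hg, ← cfc_mul _ _ h hc.continuousOn (by fun_prop)]
        have : (fun t : ℝ≥0 => (t + ε)⁻¹ * (t + ε)) = fun _ => 1 := by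
          funext t
          exact inv_mul_cancel₀ (by positivity)
        rw [this, cfc_const (1 : ℝ≥0) h]; simp
      have e2 : v * (h + algebraMap ℝ≥0 𝔄 ε) = x := by rw [hv, mul_assoc, e, mul_one]
      have e3 : v * algebraMap ℝ≥0 𝔄 ε = (ε : ℝ) • v := by
        rw [← Algebra.commutes, ← Algebra.smul_def]; rfl
      rw [← e3, ← mul_add, e2]
    have hstar : star x = h * star v + (ε : ℝ) • star v := by
      conv_lhs => rw [hx]
      rw [star_add, star_mul, star_smul, h0.isSelfAdjoint.star_eq]; simp
    -- Expansion of `z*z ≥ 0` for `z = |x|^½ (v*w - 1)`.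
    have p1 : star w * (v * h) + h * star v * w ≤ star w * (v * h * star v) * w + h := by
      have := star_mul_self_nonneg (h ^ (1 / 2 : ℝ) * (star v * w) - h ^ (1 / 2 : ℝ))
      rw [star_sub, star_mul, star_mul, star_star, (isSelfAdjoint_rpow h _).star_eq] at this
      rw [← sub_nonneg]
      convert this using 1
      conv_lhs => rw [← rpow_half_mul_self h0]
      noncomm_ring
    have p2 : star w * v + star v * w ≤ 1 + 1 := by
      have h1 := star_mul_self_nonneg (w - v)
      have h2 := star_mul_self_le_one hw
      have h3 := star_mul_self_le_one hvn
      have h4 : star w * v + star v * w ≤ star w * w + star v * v := by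
        rw [← sub_nonneg]
        convert h1 using 1
        rw [star_sub]; noncomm_ring
      exact h4.trans (add_le_add h2 h3)
    have p3 : v * h * star v ≤ b := polar_conj_le x hε
    have p4 : star w * (v * h * star v) * w ≤ star w * b * w := star_left_conjugate_le_conjugate p3 w
    have e5 : star w * x + star x * w = (star w * (v * h) + h * star v * w) +
        (ε : ℝ) • (star w * v + star v * w) := by
      rw [hstar]
      conv_lhs => rw [hx]
      simp only [mul_add, add_mul, mul_smul_comm, smul_mul_assoc, smul_add]
      abel
    rw [e5]
    refine add_le_add (p1.trans (by gcongr)) (smul_le_smul_of_nonneg_left p2 ε.2)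
  have hlim : Tendsto (fun n : ℕ => star w * b * w + h + (((n : ℝ) + 1)⁻¹ : ℝ) • (1 + 1 : 𝔄)) atTop
      (𝓝 (star w * b * w + h + (0 : ℝ) • (1 + 1 : 𝔄))) := by
    refine tendsto_const_nhds.add (Tendsto.smul_const ?_ _)
    simpa using tendsto_one_div_add_atTop_nhds_zero_nat (𝕜 := ℝ)
  rw [zero_smul, add_zero] at hlim
  refine ge_of_tendsto' hlim fun n => ?_
  have := key ((n : ℝ≥0) + 1)⁻¹ (by positivity)
  simpa using this

namespace IsTraceOn

/-- Minkowski's inequality for positive operators, with a constant. -/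
theorem rpow_sum_le_of_one_le (h : IsTraceOn S τ) {ι : Type*} (F : Finset ι) {a : ι → 𝔄}
    (ha : ∀ i, a i ∈ S) (h0 : ∀ i, 0 ≤ a i) {p : ℝ} (hp : 1 ≤ p) {σ : ι → ℝ≥0}
    (hσ : ∀ i, σ i ≠ 0) (hτ : ∀ i, τ (a i ^ p) ≤ (σ i : ℝ≥0∞) ^ p) :
    τ ((∑ i ∈ F, a i) ^ p) ≤ ((2 * ∑ i ∈ F, σ i : ℝ≥0) : ℝ≥0∞) ^ p := by
  classical
  have hp0 : 0 < p := by linarith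
  set c := ∑ i ∈ F, a i with hc
  have hcm : c ∈ S := sum_mem fun i _ => ha i
  have hc0 : 0 ≤ c := Finset.sum_nonneg fun i _ => h0 i
  -- Finiteness permits division by a power of `τ(c^p)` below. The bound used here degrades with the
  -- size of `F`, but it does not enter the final estimate.
  have hfin : τ (c ^ p) ≠ ∞ := by
    obtain ⟨K, hK⟩ := h.exists_rpow_add_le hp0
    rw [hc]
    clear_value c
    clear hc hcm hc0
    induction F using Finset.induction_on with
    | empty => simp [h.rpow_zero' hp0]
    | insert i F hi ih =>
      rw [Finset.sum_insert hi]
      refine ne_top_of_le_ne_top ?_ (hK _ (ha i) _ (sum_mem fun j _ => ha j) (h0 i)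
        (Finset.sum_nonneg fun j _ => h0 j))
      refine ENNReal.mul_ne_top (by simp) (ENNReal.add_ne_top.2 ⟨?_, ih⟩)
      exact ne_top_of_le_ne_top (by finiteness) (hτ i)
  rcases eq_or_ne (τ (c ^ p)) 0 with hz | hz
  · rw [hz]; exact zero_le
  lift τ (c ^ p) to ℝ≥0 using hfin with T hT
  have hT0 : T ≠ 0 := by simpa using hz
  have hθ : (0 : ℝ) ≤ 1 / p := by positivity
  have hθ1 : 1 / p ≤ 1 := by rw [div_le_one hp0]; exact hp
  have hpp : 0 ≤ (p - 1) / 2 := by linarith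
  -- Young's inequality for `c^p` and `aᵢ^p` with `θ = 1/p`. These terms add up to `τ(c^p) = T`, and
  -- cancelling `T^(1 - 1/p)` gives the claim.
  have each : ∀ i, τ (c ^ ((p - 1) / 2) * a i * c ^ ((p - 1) / 2)) ≤
      2 * (T ^ (1 - 1 / p) * σ i : ℝ≥0) := by
    intro i
    have hy := h.young_scaled (α := c ^ p) (β := a i ^ p) (rpow_mem h.closed hcm _)
      (rpow_mem h.closed (ha i) _) CFC.rpow_nonneg CFC.rpow_nonneg hθ hθ1 (s := T) (t := σ i ^ p)
      hT0 (NNReal.rpow_pos (pos_iff_ne_zero.2 (hσ i))).ne' hT.ge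
      (by rw [ENNReal.coe_rpow_of_nonneg _ hp0.le]; exact hτ i)
    rw [rpow_rpow_mul (h0 i) hp0.le (by positivity), rpow_rpow_mul hc0 hp0.le (by linarith),
      show p * (1 / p / 2) = 1 / 2 by field_simp, show p * (1 - 1 / p) = 2 * ((p - 1) / 2) by field_simp,
      h.conj_rpow_swap hcm (ha i) (by norm_num) hpp, ← NNReal.rpow_mul,
      show p * (1 / p) = 1 by field_simp, NNReal.rpow_one, show (2 : ℝ) * (1 / 2) = 1 by norm_num,
      CFC.rpow_one _ (h0 i)] at hy
    exact hy
  have hsum : τ (c ^ p) = ∑ i ∈ F, τ (c ^ ((p - 1) / 2) * a i * c ^ ((p - 1) / 2)) := by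
    have e : c ^ p = ∑ i ∈ F, c ^ ((p - 1) / 2) * a i * c ^ ((p - 1) / 2) := by
      rw [← Finset.sum_mul, ← Finset.mul_sum, ← hc]
      nth_rw 3 [← CFC.rpow_one c]
      rw [rpow_conj_half hpp (by norm_num)]
      congr 1; ring
    rw [e]
    clear_value c
    clear hc hT each e
    induction F using Finset.induction_on with
    | empty => simp [h.map_zero]
    | insert i F hi ih =>
      have hm : ∀ j, c ^ ((p - 1) / 2) * a j * c ^ ((p - 1) / 2) ∈ S := fun j =>
        h.conj_rpow_mem hcm (ha j) _
      have nn : ∀ j, 0 ≤ c ^ ((p - 1) / 2) * a j * c ^ ((p - 1) / 2) := fun j => by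
        simpa using conj_rpow_le c ((p - 1) / 2) (h0 j)
      rw [Finset.sum_insert hi, Finset.sum_insert hi, h.add _ (hm i) _ (sum_mem fun j _ => hm j)
        (nn i) (Finset.sum_nonneg fun j _ => nn j), ih]
  have hle : (T : ℝ≥0∞) ≤ ((T ^ (1 - 1 / p) * (2 * ∑ i ∈ F, σ i) : ℝ≥0) : ℝ≥0∞) := by
    rw [hT, hsum]
    refine (Finset.sum_le_sum fun i _ => each i).trans (le_of_eq ?_)
    rw [← Finset.mul_sum, ← ENNReal.ofNNReal_finsetSum, ← Finset.mul_sum]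
    push_cast
    ring
  rw [ENNReal.coe_le_coe] at hle
  rw [← ENNReal.coe_rpow_of_nonneg _ hp0.le, ENNReal.coe_le_coe]
  have hTe : T = T ^ (1 - 1 / p) * T ^ (1 / p) := by
    rw [← NNReal.rpow_add hT0]; simp
  have h3 : T ^ (1 / p) ≤ 2 * ∑ i ∈ F, σ i := by
    have hpos : 0 < T ^ (1 - 1 / p) := NNReal.rpow_pos (pos_iff_ne_zero.2 hT0)
    refine le_of_mul_le_mul_left ?_ hpos
    rwa [← hTe]
  calc T = (T ^ (1 / p)) ^ p := by rw [← NNReal.rpow_mul, one_div_mul_cancel hp0.ne', NNReal.rpow_one]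
    _ ≤ _ := NNReal.rpow_le_rpow h3 hp0.le

theorem absPow_star (h : IsTraceOn S τ) {x : 𝔄} (hx : x ∈ S) {s : ℝ} (hs : 0 < s) :
    absPow τ s (star x) = absPow τ s x := by
  rw [absPow, absPow, star_star, h.rpow_swap hx (by positivity)]

/-- `τ(|x|^s)` is the supremum of `τ((w*x)^s)` over the contractions `w` with `w*x ≥ 0`. -/
theorem absPow_le_of_forall (h : IsTraceOn S τ) {x : 𝔄} (hx : x ∈ S) {s : ℝ} (hs : 0 < s)
    {B : ℝ≥0∞} (H : ∀ w ∈ S, ‖w‖ ≤ 1 → 0 ≤ star w * x → τ ((star w * x) ^ s) ≤ B) :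
    absPow τ s x ≤ B := by
  have hxx : star x * x ∈ S := mul_mem (star_mem hx) hx
  set k : 𝔄 := (star x * x) ^ (1 / 2 : ℝ) with hk
  have hk0 : 0 ≤ k := CFC.rpow_nonneg
  have hkm : k ∈ S := rpow_mem h.closed hxx _
  have hsq : k * k = star x * x := rpow_half_mul_self (star_mul_self_nonneg x)
  have e : absPow τ s x = τ (k ^ s) := by
    rw [absPow, hk, rpow_rpow_mul (star_mul_self_nonneg x) (by norm_num) hs.le]
    congr 2; ring
  -- With `σ = s` the truncated power is the `s`-th power of `t · cutoff n t`, which is `w*x` for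
  -- the regularised polar part `w = x(|x| + ε)⁻¹`.
  rw [e, CFC.rpow_def, h.cfc_eq_iSup hkm (NNReal.continuous_rpow_const hs.le)
    (NNReal.zero_rpow hs.ne') hs.le]
  refine iSup_le fun n => ?_
  have hε : (0 : ℝ≥0) < ((n : ℝ≥0) + 1)⁻¹ := by positivity
  have hc := continuous_add_inv hε
  set g : 𝔄 := cfc (fun t : ℝ≥0 => (t + ((n : ℝ≥0) + 1)⁻¹)⁻¹) k with hg
  have hgm : g ∈ S := cfc_nnreal_mem S h.closed _ hkm
  have e2 : star (x * g) * x = cfc (fun t => t * cutoff n t) k := by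
    rw [star_mul, (isSelfAdjoint_cfc_nnreal _ _).star_eq, mul_assoc, ← hsq]
    have e1 : k * k = cfc (fun t : ℝ≥0 => t * t) k := by
      rw [cfc_mul (fun t : ℝ≥0 => t) (fun t => t) k (by fun_prop) (by fun_prop), cfc_id' ℝ≥0 k]
    rw [e1, ← cfc_mul _ _ k hc.continuousOn (by fun_prop)]
    congr 1
    funext t
    rw [cutoff]; ring
  have hcut := continuous_cutoff n
  have e3 : cfc (fun t => t ^ s * cutoff n t ^ s) k = (star (x * g) * x) ^ s := by
    rw [e2, CFC.rpow_def, ← cfc_comp' (fun t : ℝ≥0 => t ^ s) (fun t => t * cutoff n t) k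
      (NNReal.continuous_rpow_const hs.le).continuousOn (by fun_prop) hk0]
    simp_rw [NNReal.mul_rpow]
  rw [e3]
  refine H _ (mul_mem hx hgm) (norm_polar_le_one x hε) ?_
  rw [e2]; exact cfc_nonneg_of_predicate

end IsTraceOn

end

end

/-! ### Triangle and Hölder inequalities for general operators -/

section

section

variable {𝔄 : Type*} [CStarAlgebra 𝔄] [PartialOrder 𝔄] [StarOrderedRing 𝔄]
  {S : StarSubalgebra ℂ 𝔄} {τ : 𝔄 → ℝ≥0∞}

namespace IsTraceOn

theorem rpow_half_abs (x : 𝔄) {s : ℝ} (hs : 0 < s) :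
    τ (((star x * x) ^ (1 / 2 : ℝ)) ^ s) = absPow τ s x := by
  rw [absPow, rpow_rpow_mul (star_mul_self_nonneg x) (by norm_num) hs.le]
  congr 2; ring

theorem rpow_half_abs_star (h : IsTraceOn S τ) {x : 𝔄} (hx : x ∈ S) {s : ℝ} (hs : 0 < s) :
    τ (((x * star x) ^ (1 / 2 : ℝ)) ^ s) = absPow τ s x := by
  rw [← h.absPow_star hx hs, ← rpow_half_abs _ hs, star_star]

/-- Positivity of `w*X`, with `X` the sum, gives `w*X ≤ w*X + X*w`, which is then estimated term by
term by positive operators. The factor `2` given away here is the source of the constants below. -/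
theorem star_mul_sum_le {ι : Type*} (F : Finset ι) (x : ι → 𝔄) {w : 𝔄} (hw : ‖w‖ ≤ 1)
    (h0 : 0 ≤ star w * ∑ i ∈ F, x i) : star w * ∑ i ∈ F, x i ≤
      ∑ i ∈ F, star w * (x i * star (x i)) ^ (1 / 2 : ℝ) * w +
        ∑ i ∈ F, (star (x i) * x i) ^ (1 / 2 : ℝ) := by
  calc star w * ∑ i ∈ F, x i
      ≤ star w * ∑ i ∈ F, x i + star w * ∑ i ∈ F, x i := le_add_of_nonneg_left h0
    _ = ∑ i ∈ F, (star w * x i + star (x i) * w) := by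
        nth_rw 2 [← h0.isSelfAdjoint.star_eq]
        rw [star_mul, star_star, star_sum, Finset.sum_mul, Finset.mul_sum, Finset.sum_add_distrib]
    _ ≤ _ := by
        rw [← Finset.sum_add_distrib]
        exact Finset.sum_le_sum fun i _ => star_mul_add_le (x i) w hw

/-- Rotfel'd's inequality for the positive majorant of `w*∑ xᵢ`; the constant `2` counts the
families built from `|xᵢ*|` and `|xᵢ|`. -/
theorem absPow_sum_le_of_le_one (h : IsTraceOn S τ) {ι : Type*} (F : Finset ι) {x : ι → 𝔄}
    (hx : ∀ i, x i ∈ S) {p : ℝ} (hp : 0 < p) (hp1 : p ≤ 1) :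
    absPow τ p (∑ i ∈ F, x i) ≤ 2 * ∑ i ∈ F, absPow τ p (x i) := by
  refine h.absPow_le_of_forall (sum_mem fun i _ => hx i) hp fun w hw hw1 h0 => ?_
  have hb : ∀ i, (x i * star (x i)) ^ (1 / 2 : ℝ) ∈ S := fun i =>
    rpow_mem h.closed (mul_mem (hx i) (star_mem (hx i))) _
  have hk : ∀ i, (star (x i) * x i) ^ (1 / 2 : ℝ) ∈ S := fun i =>
    rpow_mem h.closed (mul_mem (star_mem (hx i)) (hx i)) _
  have hwb : ∀ i, star w * (x i * star (x i)) ^ (1 / 2 : ℝ) * w ∈ S := fun i =>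
    mul_mem (mul_mem (star_mem hw) (hb i)) hw
  have hwb0 : ∀ i, 0 ≤ star w * (x i * star (x i)) ^ (1 / 2 : ℝ) * w := fun i =>
    star_left_conjugate_nonneg CFC.rpow_nonneg w
  have hk0 : ∀ i, 0 ≤ (star (x i) * x i) ^ (1 / 2 : ℝ) := fun i => CFC.rpow_nonneg
  refine (h.rpow_mono (mul_mem (star_mem hw) (sum_mem fun i _ => hx i))
    (add_mem (sum_mem fun i _ => hwb i) (sum_mem fun i _ => hk i)) h0
    (star_mul_sum_le F x hw1 h0) hp).trans ?_
  refine (h.rpow_add_le (sum_mem fun i _ => hwb i) (sum_mem fun i _ => hk i)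
    (Finset.sum_nonneg fun i _ => hwb0 i) (Finset.sum_nonneg fun i _ => hk0 i) hp hp1).trans ?_
  rw [two_mul]
  refine add_le_add ((h.rpow_sum_le F hwb hwb0 hp hp1).trans (Finset.sum_le_sum fun i _ => ?_))
    ((h.rpow_sum_le F hk hk0 hp hp1).trans (Finset.sum_le_sum fun i _ => ?_))
  · exact (h.rpow_conj_le (hb i) hw CFC.rpow_nonneg (mul_star_self_le_one hw1) hp).trans
      (h.rpow_half_abs_star (hx i) hp).le
  · exact (rpow_half_abs _ hp).le

/-- The constant `4` is the `2` of Minkowski's inequality for positive operators times the two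
families `|xᵢ*|` and `|xᵢ|`, indexed together by `ι ⊕ ι`. -/
theorem absPow_sum_le_of_one_le (h : IsTraceOn S τ) {ι : Type*} (F : Finset ι) {x : ι → 𝔄}
    (hx : ∀ i, x i ∈ S) {p : ℝ} (hp1 : 1 ≤ p) {σ : ι → ℝ≥0} (hσ : ∀ i, σ i ≠ 0)
    (hτ : ∀ i, absPow τ p (x i) ≤ (σ i : ℝ≥0∞) ^ p) :
    absPow τ p (∑ i ∈ F, x i) ≤ ((4 * ∑ i ∈ F, σ i : ℝ≥0) : ℝ≥0∞) ^ p := by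
  have hp : 0 < p := by linarith
  refine h.absPow_le_of_forall (sum_mem fun i _ => hx i) hp fun w hw hw1 h0 => ?_
  have hb : ∀ i, (x i * star (x i)) ^ (1 / 2 : ℝ) ∈ S := fun i =>
    rpow_mem h.closed (mul_mem (hx i) (star_mem (hx i))) _
  have hk : ∀ i, (star (x i) * x i) ^ (1 / 2 : ℝ) ∈ S := fun i =>
    rpow_mem h.closed (mul_mem (star_mem (hx i)) (hx i)) _
  let a : ι ⊕ ι → 𝔄 := Sum.elim (fun i => star w * (x i * star (x i)) ^ (1 / 2 : ℝ) * w)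
    (fun i => (star (x i) * x i) ^ (1 / 2 : ℝ))
  have ham : ∀ j, a j ∈ S := by
    rintro (i | i)
    · exact mul_mem (mul_mem (star_mem hw) (hb i)) hw
    · exact hk i
  have ha0 : ∀ j, 0 ≤ a j := by
    rintro (i | i)
    · exact star_left_conjugate_nonneg CFC.rpow_nonneg w
    · exact CFC.rpow_nonneg (a := star (x i) * x i)
  have haσ : ∀ j, τ (a j ^ p) ≤ ((Sum.elim σ σ j : ℝ≥0) : ℝ≥0∞) ^ p := by
    rintro (i | i)
    · exact (h.rpow_conj_le (hb i) hw CFC.rpow_nonneg (mul_star_self_le_one hw1) hp).trans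
        ((h.rpow_half_abs_star (hx i) hp).le.trans (hτ i))
    · exact (rpow_half_abs _ hp).le.trans (hτ i)
  have hsum : ∑ i ∈ F, star w * (x i * star (x i)) ^ (1 / 2 : ℝ) * w +
        ∑ i ∈ F, (star (x i) * x i) ^ (1 / 2 : ℝ) = ∑ j ∈ F.disjSum F, a j := by
    rw [Finset.sum_disjSum]; rfl
  have hle := star_mul_sum_le F x hw1 h0
  rw [hsum] at hle
  refine (h.rpow_mono (mul_mem (star_mem hw) (sum_mem fun i _ => hx i))
    (sum_mem fun i _ => ham i) h0 hle hp).trans ?_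
  refine (h.rpow_sum_le_of_one_le (F.disjSum F) ham ha0 hp1 (σ := Sum.elim σ σ)
    (by rintro (i | i) <;> exact hσ i) haσ).trans (le_of_eq ?_)
  congr 2
  rw [Finset.sum_disjSum]
  simp only [Sum.elim_inl, Sum.elim_inr]
  ring

/-- Cauchy–Schwarz: `L^(2s) · L^(2s) ⊆ L^s`. -/
theorem exists_absPow_mul_le_self (h : IsTraceOn S τ) {s : ℝ} (hs : 0 < s) : ∃ K : ℝ≥0,
    ∀ x ∈ S, ∀ y ∈ S, absPow τ s (x * y) ≤ K * (absPow τ (2 * s) x + absPow τ (2 * s) y) := by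
  obtain ⟨K, hK⟩ := h.exists_rpow_add_le hs
  refine ⟨K, fun x hx y hy => ?_⟩
  refine h.absPow_le_of_forall (mul_mem hx hy) hs fun w hw hw1 h0 => ?_
  have hxx : x * star x ∈ S := mul_mem hx (star_mem hx)
  have hyy : star y * y ∈ S := mul_mem (star_mem hy) hy
  have hwx : star w * (x * star x) * w ∈ S := mul_mem (mul_mem (star_mem hw) hxx) hw
  have hwx0 : 0 ≤ star w * (x * star x) * w := star_left_conjugate_nonneg (mul_star_self_nonneg x) w
  -- Expansion of `z*z ≥ 0` for `z = x*w - y`.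
  have hle : star w * (x * y) ≤ star w * (x * star x) * w + star y * y := by
    have h1 := star_mul_self_nonneg (star x * w - y)
    calc star w * (x * y) ≤ star w * (x * y) + star w * (x * y) := le_add_of_nonneg_left h0
      _ = star w * (x * y) + star y * star x * w := by
        nth_rw 2 [← h0.isSelfAdjoint.star_eq]
        rw [star_mul, star_star, star_mul]
      _ ≤ _ := by
        rw [← sub_nonneg]
        convert h1 using 1
        rw [star_sub, star_mul, star_star]
        noncomm_ring
  refine (h.rpow_mono (mul_mem (star_mem hw) (mul_mem hx hy)) (add_mem hwx hyy) h0 hle hs).trans ?_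
  refine (hK _ hwx _ hyy hwx0 (star_mul_self_nonneg y)).trans ?_
  have e : 2 * s / 2 = s := by ring
  gcongr
  · refine (h.rpow_conj_le hxx hw (mul_star_self_nonneg x) (mul_star_self_le_one hw1) hs).trans ?_
    rw [← h.absPow_star hx (by positivity), absPow, star_star, e]
  · rw [absPow, e]

/-- Hölder's inequality in additive form, for exponents at least `2`. -/
theorem absPow_mul_le_of_two_le (h : IsTraceOn S τ) {p q r : ℝ} (hp : 2 ≤ p) (hq : 2 ≤ q)
    (hr : 0 < r) (hpqr : r⁻¹ = p⁻¹ + q⁻¹) {x y : 𝔄} (hx : x ∈ S) (hy : y ∈ S) :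
    absPow τ r (x * y) ≤ absPow τ p x + absPow τ q y := by
  have hp0 : 0 < p := by linarith
  have hq0 : 0 < q := by linarith
  have hr2 : 0 < r / 2 := by positivity
  have hxx : star x * x ∈ S := mul_mem (star_mem hx) hx
  have hyy : y * star y ∈ S := mul_mem hy (star_mem hy)
  set α := (star x * x) ^ (p / 2) with hα
  set β := (y * star y) ^ (q / 2) with hβ
  have hαm : α ∈ S := rpow_mem h.closed hxx _
  have hβm : β ∈ S := rpow_mem h.closed hyy _
  have hα0 : 0 ≤ α := CFC.rpow_nonneg
  have hβ0 : 0 ≤ β := CFC.rpow_nonneg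
  have hτβ : τ β = absPow τ q y := by rw [← h.absPow_star hy hq0, absPow, star_star]
  have hτα : τ α = absPow τ p x := rfl
  rw [← hτα, ← hτβ, ← h.add _ hαm _ hβm hα0 hβ0]
  set c := α + β with hc
  have hcm : c ∈ S := add_mem hαm hβm
  have hc0 : 0 ≤ c := add_nonneg hα0 hβ0
  -- Since `p, q ≥ 2`, the exponents `2/p` and `2/q` lie in the Löwner–Heinz range. Both factors are
  -- thus dominated by powers of the single operator `c`, and `(2/p + 2/q) · r/2 = 1`.
  have h1 : star x * x ≤ c ^ (2 / p) := by
    calc star x * x = α ^ (2 / p) := by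
          rw [hα, rpow_rpow_mul (star_mul_self_nonneg x) (by positivity) (by positivity),
            show p / 2 * (2 / p) = 1 by field_simp, CFC.rpow_one _ (star_mul_self_nonneg x)]
      _ ≤ _ := CFC.rpow_le_rpow ⟨by positivity, by rw [div_le_one hp0]; exact hp⟩
          (le_add_of_nonneg_right hβ0)
  have h2 : y * star y ≤ c ^ (2 / q) := by
    calc y * star y = β ^ (2 / q) := by
          rw [hβ, rpow_rpow_mul (mul_star_self_nonneg y) (by positivity) (by positivity),
            show q / 2 * (2 / q) = 1 by field_simp, CFC.rpow_one _ (mul_star_self_nonneg y)]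
      _ ≤ _ := CFC.rpow_le_rpow ⟨by positivity, by rw [div_le_one hq0]; exact hq⟩
          (le_add_of_nonneg_left hα0)
  have hcp : c ^ (2 / p) ∈ S := rpow_mem h.closed hcm _
  have ehalf : (c ^ (2 / p)) ^ (1 / 2 : ℝ) = c ^ (1 / p) := by
    rw [rpow_rpow_mul hc0 (by positivity) (by norm_num)]; congr 1; ring
  calc absPow τ r (x * y) = τ ((star y * (star x * x) * y) ^ (r / 2)) := by
        rw [absPow, star_mul]; simp only [mul_assoc]
    _ ≤ τ ((star y * c ^ (2 / p) * y) ^ (r / 2)) :=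
        h.rpow_mono (mul_mem (mul_mem (star_mem hy) hxx) hy) (mul_mem (mul_mem (star_mem hy) hcp) hy)
          (star_left_conjugate_nonneg (star_mul_self_nonneg x) y)
          (star_left_conjugate_le_conjugate h1 y) hr2
    _ = τ ((c ^ (1 / p) * (y * star y) * c ^ (1 / p)) ^ (r / 2)) := by
        rw [h.rpow_swap_conj hcp hy CFC.rpow_nonneg hr2, ehalf]
    _ ≤ τ ((c ^ (1 / p) * c ^ (2 / q) * c ^ (1 / p)) ^ (r / 2)) :=
        h.rpow_mono (h.conj_rpow_mem hcm hyy _) (h.conj_rpow_mem hcm (rpow_mem h.closed hcm _) _)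
          (by simpa using conj_rpow_le c (1 / p) (mul_star_self_nonneg y)) (conj_rpow_le _ _ h2) hr2
    _ = τ c := by
        rw [rpow_conj_half (by positivity) (by positivity), rpow_rpow_mul hc0 (by positivity) hr2.le]
        have : (1 / p + 2 / q + 1 / p) * (r / 2) = 1 := by
          have : 1 / p + 2 / q + 1 / p = 2 * r⁻¹ := by rw [hpqr]; ring
          rw [this]; field_simp
        rw [this, CFC.rpow_one _ hc0]

theorem absPow_rpow {b : 𝔄} (hb : 0 ≤ b) {s u : ℝ} (hs : 0 < s) (hu : 0 ≤ u) :
    absPow τ s (b ^ u) = τ (b ^ (u * s)) := by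
  rw [absPow, (isSelfAdjoint_rpow b u).star_eq, rpow_mul_rpow_of_nonneg hu hu,
    rpow_rpow_mul hb (by positivity) (by positivity)]
  congr 2; ring

/-- Hölder's inequality in additive form. -/
theorem exists_absPow_mul_le (h : IsTraceOn S τ) {p q r : ℝ} (hp : 0 < p) (hq : 0 < q)
    (hr : 0 < r) (hpqr : r⁻¹ = p⁻¹ + q⁻¹) : ∃ K : ℝ≥0, ∀ x ∈ S, ∀ y ∈ S,
      absPow τ r (x * y) ≤ K * (absPow τ p x + absPow τ q y) := by
  -- Induction on `n` with `2 < 2^n r`: the base case `r > 2` forces `p, q ≥ 2`, and each step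
  -- doubles `r`.
  obtain ⟨n, hn⟩ := pow_unbounded_of_one_lt (2 / r) one_lt_two
  rw [div_lt_iff₀ hr] at hn
  induction n generalizing p q r with
  | zero =>
    simp only [pow_zero, one_mul] at hn
    have hinv : r⁻¹ < 2⁻¹ := by gcongr
    have hp2 : 2 ≤ p := by
      have : p⁻¹ ≤ 2⁻¹ := by have := inv_pos.2 hq; linarith
      exact (inv_le_inv₀ hp two_pos).1 this
    have hq2 : 2 ≤ q := by
      have : q⁻¹ ≤ 2⁻¹ := by have := inv_pos.2 hp; linarith
      exact (inv_le_inv₀ hq two_pos).1 this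
    exact ⟨1, fun x hx y hy => by
      simpa using h.absPow_mul_le_of_two_le hp2 hq2 hr hpqr hx hy⟩
  | succ n ih =>
    wlog hpq : q ≤ p generalizing p q
    · obtain ⟨K, hK⟩ := this hq hp (by rw [hpqr, add_comm]) (le_of_not_ge hpq)
      refine ⟨K, fun x hx y hy => ?_⟩
      have := hK _ (star_mem hy) _ (star_mem hx)
      rwa [← star_mul, h.absPow_star (mul_mem hx hy) hr, h.absPow_star hx hp, h.absPow_star hy hq,
        add_comm] at this
    rcases hpq.eq_or_lt with rfl | hlt
    · obtain ⟨K, hK⟩ := h.exists_absPow_mul_le_self hr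
      refine ⟨K, ?_⟩
      have : 2 * r = q := by
        have : r = q / 2 := by rw [← inv_inv r, hpqr]; field_simp; norm_num
        rw [this]; ring
      rwa [this] at hK
    -- This `θ` solves `(1 - θ) · 2r = q`. With `b = |y*|`, the product splits as `(x b^θ) b^(1-θ)`,
    -- both factors having exponent `2r`: the first by the induction hypothesis for `p` and `q/θ`,
    -- the second directly. The Cauchy–Schwarz case then applies.
    set θ : ℝ := (1 - q / p) / 2 with hθ
    have hqp : q / p < 1 := by rw [div_lt_one hp]; exact hlt
    have hqp0 : 0 < q / p := by positivity
    have hθ0 : 0 < θ := by rw [hθ]; linarith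
    have hθ1 : 0 < 1 - θ := by rw [hθ]; linarith
    have hr' : r = p * q / (p + q) := by rw [← inv_inv r, hpqr]; field_simp; ring
    have hpq0 : p + q ≠ 0 := by positivity
    have hrel : (2 * r)⁻¹ = p⁻¹ + (q / θ)⁻¹ := by
      rw [mul_inv, hpqr, hθ, inv_div]; field_simp; ring
    have hrel2 : (1 - θ) * (2 * r) = q := by
      rw [hr', hθ]; field_simp; ring
    obtain ⟨K₁, hK₁⟩ := ih (p := p) (q := q / θ) (r := 2 * r) hp (by positivity) (by positivity)
      hrel (by rw [pow_succ] at hn; linarith)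
    obtain ⟨K₂, hK₂⟩ := h.exists_absPow_mul_le_self hr
    refine ⟨K₂ * (K₁ + 1), fun x hx y hy => ?_⟩
    have hyy : y * star y ∈ S := mul_mem hy (star_mem hy)
    set b := (y * star y) ^ (1 / 2 : ℝ) with hb
    have hbm : b ∈ S := rpow_mem h.closed hyy _
    have hb0 : 0 ≤ b := CFC.rpow_nonneg
    have hbs : ∀ u : ℝ, b ^ u ∈ S := rpow_mem h.closed hbm
    have hτb : τ (b ^ q) = absPow τ q y := h.rpow_half_abs_star hy hq
    -- The adjoints of `xy` and `xb` have the same modulus, because `yy* = b²`.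
    have e1 : absPow τ r (x * y) = absPow τ r (x * b) := by
      rw [← h.absPow_star (mul_mem hx hy) hr, ← h.absPow_star (mul_mem hx hbm) hr, absPow, absPow,
        star_star, star_star, star_mul, star_mul, hb0.isSelfAdjoint.star_eq]
      congr 2
      rw [mul_assoc, ← mul_assoc y, mul_assoc x b, ← mul_assoc b, rpow_half_mul_self (mul_star_self_nonneg y)]
    have e2 : x * b = x * b ^ θ * b ^ (1 - θ) := by
      rw [mul_assoc, rpow_mul_rpow_of_nonneg hθ0.le hθ1.le]
      simp [CFC.rpow_one b hb0]
    rw [e1, e2]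
    have i1 := hK₁ x hx (b ^ θ) (hbs θ)
    have i2 := hK₂ (x * b ^ θ) (mul_mem hx (hbs θ)) (b ^ (1 - θ)) (hbs _)
    rw [absPow_rpow hb0 (by positivity) hθ0.le, mul_div_cancel₀ _ hθ0.ne', hτb] at i1
    rw [absPow_rpow hb0 (by positivity) hθ1.le, hrel2, hτb] at i2
    refine i2.trans ?_
    rw [ENNReal.coe_mul, mul_assoc, ENNReal.coe_add, ENNReal.coe_one]
    gcongr
    calc absPow τ (2 * r) (x * b ^ θ) + absPow τ q y
        ≤ K₁ * (absPow τ p x + absPow τ q y) + absPow τ q y := by gcongr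
      _ ≤ K₁ * (absPow τ p x + absPow τ q y) + (absPow τ p x + absPow τ q y) := by
        gcongr; exact le_add_self
      _ = _ := by ring

end IsTraceOn

end

end

/-! ### The quasi-norms of operators in the algebra -/

section

/-- A homogeneous gauge whose `e`-th power is subadditive up to the constant `C`, uniformly in the
number of summands. -/
structure IsGauge {R : Type*} [AddCommGroup R] [Module ℂ R] (e : ℝ) (C : ℝ≥0) (N : R → ℝ≥0∞) :
    Prop where
  pos : 0 < e
  le_one : e ≤ 1
  one_le : 1 ≤ C
  smul : ∀ (c : ℂ) (x : R), N (c • x) = ‖c‖ₑ * N x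
  sum_le : ∀ (ι : Type) (F : Finset ι) (x : ι → R),
    N (∑ i ∈ F, x i) ^ e ≤ C * ∑ i ∈ F, N (x i) ^ e

variable {H : Type*} [NormedAddCommGroup H] [InnerProductSpace ℂ H] [CompleteSpace H]
  {M : VonNeumannAlgebra H} {τ : (H →L[ℂ] H) → ℝ≥0∞}

theorem isClosed_vonNeumann (M : VonNeumannAlgebra H) :
    IsClosed (M.toStarSubalgebra : Set (H →L[ℂ] H)) := by
  have h : (M.toStarSubalgebra : Set (H →L[ℂ] H)) =
      Set.centralizer (Set.centralizer (M : Set (H →L[ℂ] H))) := M.centralizer_centralizer.symm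
  rw [h]
  exact Set.isClosed_centralizer _

theorem IsNormalFaithfulSemifiniteTrace.isTraceOn (hτ : IsNormalFaithfulSemifiniteTrace M τ) :
    IsTraceOn M.toStarSubalgebra τ where
  closed := isClosed_vonNeumann M
  add := hτ.add
  smul c x hx h0 := by
    rw [← hτ.smul c x hx h0]
    congr 1
  tracial := hτ.tracial
  normal x hx hmem y hy := by
    -- An increasing norm limit is the least upper bound, so normality for directed sets covers it.
    have hlub := isLUB_of_tendsto_atTop hx hy
    have hyM : y ∈ M.toStarSubalgebra :=
      (isClosed_vonNeumann M).mem_of_tendsto hy (Eventually.of_forall fun n => (hmem n).1)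
    have := hτ.normal (Set.range x) (Set.range_nonempty x) (directedOn_range.2 hx.directed_le)
      (by rintro _ ⟨n, rfl⟩; exact hmem n) y hyM hlub
    rw [this, iSup_range]

theorem opNorm_of_ne_top {p : ℝ≥0∞} (hp : p ≠ ∞) (hp0 : 0 < p) (x : H →L[ℂ] H) :
    opNorm τ p x = absPow τ p.toReal x ^ (1 / p.toReal) := by
  have hpos := ENNReal.toReal_pos hp0.ne' hp
  rw [opNorm, if_neg hp, absPow, CFC.abs, CFC.sqrt_eq_rpow,
    rpow_rpow_mul (star_mul_self_nonneg x) (by norm_num) hpos.le]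
  congr 3; ring

theorem opNorm_top (x : H →L[ℂ] H) : opNorm τ ∞ x = ‖x‖ₑ := if_pos rfl

theorem opNorm_rpow {p : ℝ≥0∞} (hp : p ≠ ∞) (hp0 : 0 < p) (x : H →L[ℂ] H) :
    opNorm τ p x ^ p.toReal = absPow τ p.toReal x := by
  have hpos := ENNReal.toReal_pos hp0.ne' hp
  rw [opNorm_of_ne_top hp hp0, ← ENNReal.rpow_mul, one_div_mul_cancel hpos.ne', ENNReal.rpow_one]

theorem opNorm_le_iff {p : ℝ≥0∞} (hp : p ≠ ∞) (hp0 : 0 < p) (x : H →L[ℂ] H) (B : ℝ≥0∞) :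
    opNorm τ p x ≤ B ↔ absPow τ p.toReal x ≤ B ^ p.toReal := by
  rw [← opNorm_rpow hp hp0, ENNReal.rpow_le_rpow_iff (ENNReal.toReal_pos hp0.ne' hp)]

theorem absPow_smul (h : IsTraceOn M.toStarSubalgebra τ) {s : ℝ} (hs : 0 < s) (c : ℂ)
    {x : H →L[ℂ] H} (hx : x ∈ M.toStarSubalgebra) : absPow τ s (c • x) = ‖c‖ₑ ^ s * absPow τ s x := by
  have e : star (c • x) * (c • x) = (‖c‖₊ ^ 2) • (star x * x) := by
    rw [star_smul, smul_mul_smul_comm, NNReal.smul_def]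
    have : star c * c = (((‖c‖₊ ^ 2 : ℝ≥0) : ℝ) : ℂ) := by
      rw [Complex.star_def, ← Complex.normSq_eq_conj_mul_self, Complex.normSq_eq_norm_sq]; simp
    rw [this, Complex.coe_smul]
  rw [absPow, e, h.rpow_smul (mul_mem (star_mem hx) hx) (star_mul_self_nonneg x) _ (by positivity),
    absPow]
  congr 1
  rw [ENNReal.coe_pow, ← ENNReal.rpow_natCast, ← ENNReal.rpow_mul]
  congr 1
  push_cast; ring

theorem opNorm_smul (h : IsTraceOn M.toStarSubalgebra τ) {p : ℝ≥0∞} (hp0 : 0 < p) (c : ℂ)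
    {x : H →L[ℂ] H} (hx : x ∈ M.toStarSubalgebra) : opNorm τ p (c • x) = ‖c‖ₑ * opNorm τ p x := by
  by_cases hp : p = ∞
  · subst hp; rw [opNorm_top, opNorm_top, enorm_smul]
  have hpos := ENNReal.toReal_pos hp0.ne' hp
  rw [opNorm_of_ne_top hp hp0, opNorm_of_ne_top hp hp0, absPow_smul h hpos c hx,
    ENNReal.mul_rpow_of_nonneg _ _ (by positivity), ← ENNReal.rpow_mul, mul_one_div_cancel hpos.ne',
    ENNReal.rpow_one]

theorem opNorm_star (h : IsTraceOn M.toStarSubalgebra τ) {p : ℝ≥0∞} (hp0 : 0 < p)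
    {x : H →L[ℂ] H} (hx : x ∈ M.toStarSubalgebra) : opNorm τ p (star x) = opNorm τ p x := by
  by_cases hp : p = ∞
  · subst hp; rw [opNorm_top, opNorm_top, ← ofReal_norm, ← ofReal_norm, norm_star]
  rw [opNorm_of_ne_top hp hp0, opNorm_of_ne_top hp hp0,
    h.absPow_star hx (ENNReal.toReal_pos hp0.ne' hp)]

theorem minExp_of_one_le {p : ℝ≥0∞} (hp : 1 ≤ p) : minExp p = 1 := by
  rw [minExp, min_eq_left hp]; simp

theorem minExp_of_lt_one {p : ℝ≥0∞} (hp : p < 1) : minExp p = p.toReal := by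
  rw [minExp, min_eq_right hp.le]

theorem minExp_pos {p : ℝ≥0∞} (hp : 0 < p) : 0 < minExp p :=
  ENNReal.toReal_pos (by simp [hp.ne']) (by simp)

theorem minExp_le_one (p : ℝ≥0∞) : minExp p ≤ 1 := by
  have := ENNReal.toReal_mono ENNReal.one_ne_top (min_le_left 1 p)
  simpa [minExp] using this

theorem opNorm_sum_le (h : IsTraceOn M.toStarSubalgebra τ) {p : ℝ≥0∞} (hp1 : 1 ≤ p) {ι : Type*}
    (F : Finset ι) {x : ι → H →L[ℂ] H} (hx : ∀ i, x i ∈ M.toStarSubalgebra) :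
    opNorm τ p (∑ i ∈ F, x i) ≤ 4 * ∑ i ∈ F, opNorm τ p (x i) := by
  have hp0 : 0 < p := one_pos.trans_le hp1
  by_cases hp : p = ∞
  · subst hp
    simp only [opNorm_top]
    refine (enorm_sum_le _ _).trans ?_
    nth_rw 1 [← one_mul (∑ i ∈ F, ‖x i‖ₑ)]
    gcongr
    norm_num
  have hpos := ENNReal.toReal_pos hp0.ne' hp
  by_cases hfin : ∀ i ∈ F, opNorm τ p (x i) ≠ ∞
  swap
  · push Not at hfin
    obtain ⟨i, hi, hi'⟩ := hfin
    rw [ENNReal.sum_eq_top.2 ⟨i, hi, hi'⟩]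
    simp
  -- The bounds in Minkowski's inequality must be nonzero; `δ` ensures this and then tends to `0`.
  have step : ∀ δ : ℝ≥0, 0 < δ →
      opNorm τ p (∑ i ∈ F, x i) ≤ 4 * ∑ i ∈ F, (opNorm τ p (x i) + δ) := by
    intro δ hδ
    rw [opNorm_le_iff hp hp0]
    have := h.absPow_sum_le_of_one_le F.attach (x := fun i => x i.1) (fun i => hx i.1)
      (p := p.toReal) (by simpa using ENNReal.toReal_mono hp hp1)
      (σ := fun i => (opNorm τ p (x i.1)).toNNReal + δ) (fun i => by positivity) (fun i => by
        rw [← opNorm_le_iff hp hp0, ENNReal.coe_add, ENNReal.coe_toNNReal (hfin _ i.2)]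
        exact le_self_add)
    rw [Finset.sum_attach F (fun i => x i), Finset.sum_attach F
      (fun i => (opNorm τ p (x i)).toNNReal + δ)] at this
    refine this.trans (le_of_eq ?_)
    congr 1
    rw [ENNReal.coe_mul, ENNReal.ofNNReal_finsetSum]
    congr 1
    refine Finset.sum_congr rfl fun i hi => ?_
    rw [ENNReal.coe_add, ENNReal.coe_toNNReal (hfin _ hi)]
  have hlim : Tendsto (fun δ : ℝ≥0 => 4 * ∑ i ∈ F, (opNorm τ p (x i) + δ)) (𝓝[>] 0)
      (𝓝 (4 * ∑ i ∈ F, (opNorm τ p (x i) + (0 : ℝ≥0)))) := by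
    refine Tendsto.mono_left (Continuous.tendsto ?_ _) nhdsWithin_le_nhds
    refine (ENNReal.continuous_const_mul (by norm_num)).comp ?_
    exact continuous_finsetSum _ fun i _ => continuous_const.add ENNReal.continuous_coe
  have := ge_of_tendsto hlim (eventually_nhdsWithin_of_forall fun δ hδ => step δ hδ)
  simpa using this

/-- The (quasi-)norm `‖·‖_p` is a gauge with exponent `min {1, p}`. -/
theorem isGauge_opNorm (h : IsTraceOn M.toStarSubalgebra τ) {p : ℝ≥0∞} (hp0 : 0 < p) :
    IsGauge (minExp p) 4 (fun x : M.toStarSubalgebra => opNorm τ p x) where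
  pos := minExp_pos hp0
  le_one := minExp_le_one p
  one_le := by norm_num
  smul c x := opNorm_smul h hp0 c x.2
  sum_le ι F x := by
    have e : ((∑ i ∈ F, x i : M.toStarSubalgebra) : H →L[ℂ] H) = ∑ i ∈ F, (x i : H →L[ℂ] H) := by
      simp
    rw [e]
    rcases le_or_gt 1 p with hp1 | hp1
    · simp only [minExp_of_one_le hp1, ENNReal.rpow_one]
      simpa using opNorm_sum_le h hp1 F (fun i => (x i).2)
    · have hp : p ≠ ∞ := hp1.ne_top
      rw [minExp_of_lt_one hp1]
      simp only [opNorm_rpow hp hp0]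
      refine (h.absPow_sum_le_of_le_one F (fun i => (x i).2) (ENNReal.toReal_pos hp0.ne' hp)
        (by simpa using ENNReal.toReal_mono ENNReal.one_ne_top hp1.le)).trans ?_
      gcongr
      norm_num

theorem opNorm_mul_le_top_left (h : IsTraceOn M.toStarSubalgebra τ) {q : ℝ≥0∞} (hq0 : 0 < q)
    {x y : H →L[ℂ] H} (hx : x ∈ M.toStarSubalgebra) (hy : y ∈ M.toStarSubalgebra) :
    opNorm τ q (x * y) ≤ ‖x‖ₑ * opNorm τ q y := by
  by_cases hq : q = ∞
  · subst hq
    rw [opNorm_top, opNorm_top]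
    rw [← ofReal_norm, ← ofReal_norm, ← ofReal_norm, ← ENNReal.ofReal_mul (norm_nonneg _)]
    exact ENNReal.ofReal_le_ofReal (norm_mul_le x y)
  have hpos := ENNReal.toReal_pos hq0.ne' hq
  rw [opNorm_le_iff hq hq0, ENNReal.mul_rpow_of_nonneg _ _ hpos.le, opNorm_rpow hq hq0]
  have hle : star (x * y) * (x * y) ≤ (‖x‖₊ ^ 2) • (star y * y) := by
    have h1 : star x * x ≤ algebraMap ℝ _ (‖x‖ ^ 2) := CStarAlgebra.star_mul_le_algebraMap_norm_sq
    have h2 := star_left_conjugate_le_conjugate h1 y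
    have e1 : star (x * y) * (x * y) = star y * (star x * x) * y := by
      rw [star_mul]; simp only [mul_assoc]
    have e2 : star y * algebraMap ℝ (H →L[ℂ] H) (‖x‖ ^ 2) * y = (‖x‖₊ ^ 2) • (star y * y) := by
      rw [← Algebra.commutes, mul_assoc, ← Algebra.smul_def]; rfl
    rw [e1, ← e2]; exact h2
  have hyy : star y * y ∈ M.toStarSubalgebra := mul_mem (star_mem hy) hy
  rw [absPow, absPow]
  refine (h.rpow_mono (mul_mem (star_mem (mul_mem hx hy)) (mul_mem hx hy)) (nnreal_smul_mem hyy _)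
    (star_mul_self_nonneg _) hle (by positivity)).trans (le_of_eq ?_)
  rw [h.rpow_smul hyy (star_mul_self_nonneg y) _ (by positivity)]
  congr 1
  rw [ENNReal.coe_pow, ← ENNReal.rpow_natCast, ← ENNReal.rpow_mul]
  congr 1
  push_cast; ring

theorem opNorm_mul_le_top_right (h : IsTraceOn M.toStarSubalgebra τ) {q : ℝ≥0∞} (hq0 : 0 < q)
    {x y : H →L[ℂ] H} (hx : x ∈ M.toStarSubalgebra) (hy : y ∈ M.toStarSubalgebra) :
    opNorm τ q (x * y) ≤ opNorm τ q x * ‖y‖ₑ := by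
  have := opNorm_mul_le_top_left h hq0 (star_mem hy) (star_mem hx)
  rw [← star_mul, opNorm_star h hq0 (mul_mem hx hy), opNorm_star h hq0 hx, ← opNorm_top (τ := τ),
    opNorm_star h (by simp) hy, opNorm_top, mul_comm] at this
  exact this

/-- Hölder's inequality with a constant. -/
theorem exists_opNorm_mul_le (h : IsTraceOn M.toStarSubalgebra τ) {p q r : ℝ≥0∞} (hp0 : 0 < p)
    (hq0 : 0 < q) (hr0 : 0 < r) (hpqr : r⁻¹ = p⁻¹ + q⁻¹) : ∃ K : ℝ≥0, ∀ x ∈ M.toStarSubalgebra,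
      ∀ y ∈ M.toStarSubalgebra, opNorm τ p x < ∞ → opNorm τ q y < ∞ →
        opNorm τ r (x * y) ≤ K * (opNorm τ p x * opNorm τ q y) := by
  by_cases hp : p = ∞
  · subst hp
    have : r = q := by simpa using hpqr
    subst this
    exact ⟨1, fun x hx y hy _ _ => by
      simpa [opNorm_top] using opNorm_mul_le_top_left h hq0 hx hy⟩
  by_cases hq : q = ∞
  · subst hq
    have : r = p := by simpa using hpqr
    subst this
    exact ⟨1, fun x hx y hy _ _ => by
      simpa [opNorm_top] using opNorm_mul_le_top_right h hp0 hx hy⟩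
  have hr : r ≠ ∞ := by
    rintro rfl
    have : p⁻¹ + q⁻¹ = 0 := by rw [← hpqr]; simp
    simp [hp] at this
  have hp' := ENNReal.toReal_pos hp0.ne' hp
  have hq' := ENNReal.toReal_pos hq0.ne' hq
  have hr' := ENNReal.toReal_pos hr0.ne' hr
  have hreal : r.toReal⁻¹ = p.toReal⁻¹ + q.toReal⁻¹ := by
    have := congrArg ENNReal.toReal hpqr
    rwa [ENNReal.toReal_add (by simp [hp0.ne']) (by simp [hq0.ne']), ENNReal.toReal_inv,
      ENNReal.toReal_inv, ENNReal.toReal_inv] at this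
  obtain ⟨K, hK⟩ := h.exists_absPow_mul_le hp' hq' hr' hreal
  refine ⟨(K * 2) ^ (1 / r.toReal), fun x hx y hy hxf hyf => ?_⟩
  -- Scaling `x/a` and `y/b` into the unit balls turns the additive Hölder inequality into the
  -- multiplicative one, with constant `(2K)^(1/r)`. Strict bounds keep `a` and `b` nonzero.
  have main : ∀ a b : ℝ≥0, opNorm τ p x < a → opNorm τ q y < b →
      opNorm τ r (x * y) ≤ ((K * 2) ^ (1 / r.toReal) : ℝ≥0) * ((a : ℝ≥0∞) * b) := by
    intro a b ha hb
    have unit : ∀ (s : ℝ≥0∞) (z : H →L[ℂ] H) (d : ℝ≥0), s ≠ ∞ → 0 < s → z ∈ M.toStarSubalgebra →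
        opNorm τ s z < d → absPow τ s.toReal (((d : ℝ) : ℂ)⁻¹ • z) ≤ 1 := by
      intro s z d hs hs0 hz hd
      have hd0 : (d : ℝ≥0∞) ≠ 0 := (zero_le.trans_lt hd).ne'
      have := (opNorm_le_iff hs hs0 (((d : ℝ) : ℂ)⁻¹ • z) 1 (τ := τ)).1 ?_
      · simpa using this
      rw [opNorm_smul h hs0 _ hz]
      have e : ‖((d : ℝ) : ℂ)⁻¹‖ₑ = (d : ℝ≥0∞)⁻¹ := by
        rw [enorm_inv (by simpa using hd0)]
        congr 1
        rw [← ofReal_norm]; simp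
      rw [e]
      calc (d : ℝ≥0∞)⁻¹ * opNorm τ s z ≤ (d : ℝ≥0∞)⁻¹ * d := by gcongr
        _ = 1 := ENNReal.inv_mul_cancel hd0 ENNReal.coe_ne_top
    have hx1 := unit p x a hp hp0 hx ha
    have hy1 := unit q y b hq hq0 hy hb
    have ha0 : a ≠ 0 := by rintro rfl; simp at ha
    have hb0 : b ≠ 0 := by rintro rfl; simp at hb
    have hprod := hK _ (M.toStarSubalgebra.smul_mem hx ((a : ℝ) : ℂ)⁻¹)
      _ (M.toStarSubalgebra.smul_mem hy ((b : ℝ) : ℂ)⁻¹)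
    have e : x * y = ((a * b : ℝ≥0) : ℂ) • ((((a : ℝ) : ℂ)⁻¹ • x) * (((b : ℝ) : ℂ)⁻¹ • y)) := by
      rw [smul_mul_smul_comm, smul_smul]
      have : ((a * b : ℝ≥0) : ℂ) * (((a : ℝ) : ℂ)⁻¹ * ((b : ℝ) : ℂ)⁻¹) = 1 := by
        have h1 : ((a : ℝ) : ℂ) ≠ 0 := by simpa using ha0
        have h2 : ((b : ℝ) : ℂ) ≠ 0 := by simpa using hb0
        push_cast
        field_simp
      rw [this, one_smul]
    have hmem : (((a : ℝ) : ℂ)⁻¹ • x) * (((b : ℝ) : ℂ)⁻¹ • y) ∈ M.toStarSubalgebra :=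
      mul_mem (M.toStarSubalgebra.smul_mem hx _) (M.toStarSubalgebra.smul_mem hy _)
    rw [e, opNorm_smul h hr0 _ hmem]
    have e2 : ‖((a * b : ℝ≥0) : ℂ)‖ₑ = (a : ℝ≥0∞) * b := by
      rw [← ofReal_norm]; simp
    rw [e2, mul_comm]
    gcongr
    rw [opNorm_le_iff hr hr0, ← ENNReal.coe_rpow_of_nonneg _ hr'.le, ← NNReal.rpow_mul,
      one_div_mul_cancel hr'.ne', NNReal.rpow_one]
    refine hprod.trans ?_
    rw [ENNReal.coe_mul]
    gcongr
    exact (add_le_add hx1 hy1).trans (by norm_num)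
  have hlim : Tendsto (fun δ : ℝ≥0 => (((K * 2) ^ (1 / r.toReal) : ℝ≥0) : ℝ≥0∞) *
      ((((opNorm τ p x).toNNReal + δ : ℝ≥0) : ℝ≥0∞) * (((opNorm τ q y).toNNReal + δ : ℝ≥0) : ℝ≥0∞)))
      (𝓝[>] 0) (𝓝 ((((K * 2) ^ (1 / r.toReal) : ℝ≥0) : ℝ≥0∞) *
      ((((opNorm τ p x).toNNReal + 0 : ℝ≥0) : ℝ≥0∞) * (((opNorm τ q y).toNNReal + 0 : ℝ≥0) : ℝ≥0∞)))) := by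
    simp only [← ENNReal.coe_mul]
    refine Tendsto.mono_left (Continuous.tendsto ?_ _) nhdsWithin_le_nhds
    fun_prop
  have := ge_of_tendsto hlim (eventually_nhdsWithin_of_forall fun δ (hδ : 0 < δ) => main _ _ ?_ ?_)
  · simpa [ENNReal.coe_toNNReal hxf.ne, ENNReal.coe_toNNReal hyf.ne] using this
  · rw [ENNReal.coe_add, ENNReal.coe_toNNReal hxf.ne]
    exact ENNReal.lt_add_right hxf.ne (by simpa using hδ.ne')
  · rw [ENNReal.coe_add, ENNReal.coe_toNNReal hyf.ne]
    exact ENNReal.lt_add_right hyf.ne (by simpa using hδ.ne')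

end

/-! ### Gauges and the sequence model of `L^p` -/

section

namespace IsGauge

variable {R : Type*} [AddCommGroup R] [Module ℂ R] {e : ℝ} {C : ℝ≥0} {N : R → ℝ≥0∞}

theorem map_zero (h : IsGauge e C N) : N 0 = 0 := by
  have := h.smul 0 0
  simpa using this

theorem map_neg (h : IsGauge e C N) (x : R) : N (-x) = N x := by
  have := h.smul (-1) x
  simpa using this

theorem map_sub_comm (h : IsGauge e C N) (x y : R) : N (x - y) = N (y - x) := by
  rw [← h.map_neg, neg_sub]

theorem add_le (h : IsGauge e C N) (x y : R) : N (x + y) ^ e ≤ C * (N x ^ e + N y ^ e) := by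
  have := h.sum_le (Fin 2) Finset.univ ![x, y]
  simpa [Fin.sum_univ_two] using this

theorem exists_add_le (h : IsGauge e C N) : ∃ K : ℝ≥0, K ≠ 0 ∧
    ∀ (b : ℝ≥0∞) (x y : R), N x ≤ b → N y ≤ b → N (x + y) ≤ K * b := by
  refine ⟨(C * 2) ^ (1 / e), ?_, fun b x y hx hy => ?_⟩
  · have : 0 < C := one_pos.trans_le h.one_le
    positivity
  · rw [← ENNReal.rpow_le_rpow_iff h.pos, ENNReal.mul_rpow_of_nonneg _ _ h.pos.le,
      ← ENNReal.coe_rpow_of_nonneg _ h.pos.le, ← NNReal.rpow_mul, one_div_mul_cancel h.pos.ne',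
      NNReal.rpow_one]
    refine (h.add_le x y).trans ?_
    rw [ENNReal.coe_mul, mul_assoc]
    gcongr
    calc N x ^ e + N y ^ e ≤ b ^ e + b ^ e := by
          gcongr
          exacts [h.pos.le, h.pos.le]
      _ = ((2 : ℝ≥0) : ℝ≥0∞) * b ^ e := by rw [ENNReal.coe_ofNat, two_mul]

theorem exists_delta (h : IsGauge e C N) {ε : ℝ≥0∞} (hε : 0 < ε) : ∃ δ : ℝ≥0∞, 0 < δ ∧
    ∀ x y z : R, N x ≤ δ → N y ≤ δ → N z ≤ δ → N (x + y + z) < ε := by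
  obtain ⟨K, hK0, hK⟩ := h.exists_add_le
  obtain ⟨ε', h0, h1⟩ := exists_between hε
  have hK' : (K : ℝ≥0∞) ≠ 0 := by simpa using hK0
  -- The quasi-triangle inequality is applied twice, hence the two divisions by `K`.
  refine ⟨min (ε' / K) (ε' / K / K), ?_, fun x y z hx hy hz => ?_⟩
  · have h2 : 0 < ε' / K := ENNReal.div_pos h0.ne' (by simp)
    exact lt_min h2 (ENNReal.div_pos h2.ne' (by simp))
  · have h3 : N (x + y) ≤ ε' / K :=
      (hK _ x y (hx.trans (min_le_right _ _)) (hy.trans (min_le_right _ _))).trans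
        ENNReal.mul_div_le
    exact ((hK _ _ z h3 (hz.trans (min_le_left _ _))).trans ENNReal.mul_div_le).trans_lt h1

theorem exists_delta_two (h : IsGauge e C N) {ε : ℝ≥0∞} (hε : 0 < ε) : ∃ δ : ℝ≥0∞, 0 < δ ∧
    ∀ x y : R, N x ≤ δ → N y ≤ δ → N (x + y) < ε := by
  obtain ⟨δ, h0, h1⟩ := h.exists_delta hε
  refine ⟨δ, h0, fun x y hx hy => ?_⟩
  simpa using h1 x y 0 hx hy (by rw [h.map_zero]; exact zero_le)

theorem tendsto_add (h : IsGauge e C N) {ι : Type*} {l : Filter ι} {u v : ι → R}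
    (hu : Tendsto (fun n => N (u n)) l (𝓝 0)) (hv : Tendsto (fun n => N (v n)) l (𝓝 0)) :
    Tendsto (fun n => N (u n + v n)) l (𝓝 0) := by
  rw [ENNReal.tendsto_nhds_zero] at *
  intro ε hε
  obtain ⟨δ, h0, h1⟩ := h.exists_delta_two hε
  filter_upwards [hu δ h0, hv δ h0] with n hn hn'
  exact (h1 _ _ hn hn').le

theorem tendsto_smul (h : IsGauge e C N) {ι : Type*} {l : Filter ι} {u : ι → R} (c : ℂ)
    (hu : Tendsto (fun n => N (u n)) l (𝓝 0)) : Tendsto (fun n => N (c • u n)) l (𝓝 0) := by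
  simp only [h.smul]
  have := ENNReal.Tendsto.const_mul (a := ‖c‖ₑ) hu (Or.inr (by simp))
  simpa using this

end IsGauge

/-- Cauchy sequences for a gauge. -/
def GaugeCauchy {R : Type*} [AddCommGroup R] (N : R → ℝ≥0∞) (u : ℕ → R) : Prop :=
  ∀ ε : ℝ≥0∞, 0 < ε → ∃ K, ∀ m ≥ K, ∀ n ≥ K, N (u m - u n) < ε

variable {H : Type*} [NormedAddCommGroup H] [InnerProductSpace ℂ H] [CompleteSpace H]
  {M : VonNeumannAlgebra H} {τ : (H →L[ℂ] H) → ℝ≥0∞}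

theorem mem_nullSeqs (h : IsTraceOn M.toStarSubalgebra τ) {p : ℝ≥0∞} (hp0 : 0 < p) {u : Seqs M} :
    u ∈ nullSeqs M τ p ↔ Tendsto (fun n => opNorm τ p (u n)) atTop (𝓝 0) := by
  have hg := isGauge_opNorm h hp0
  refine ⟨fun hu => ?_, fun hu => Submodule.subset_span hu⟩
  induction hu using Submodule.span_induction with
  | mem u hu => exact hu
  | zero => simpa using hg.map_zero
  | add u v _ _ hu hv => exact hg.tendsto_add hu hv
  | smul c u _ hu => exact hg.tendsto_smul c hu

theorem cls_eq_iff (h : IsTraceOn M.toStarSubalgebra τ) {p : ℝ≥0∞} (hp0 : 0 < p) {u v : Seqs M} :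
    cls M τ p u = cls M τ p v ↔
      Tendsto (fun n => opNorm τ p ((u n - v n : M.toStarSubalgebra) : H →L[ℂ] H)) atTop (𝓝 0) := by
  rw [cls, cls, Submodule.mkQ_apply, Submodule.mkQ_apply, Submodule.Quotient.eq, mem_nullSeqs h hp0]
  rfl

theorem exists_cls_eq {p : ℝ≥0∞} (ξ : SeqSpace M τ p) : ∃ u : Seqs M, cls M τ p u = ξ :=
  (nullSeqs M τ p).mkQ_surjective ξ

theorem cls_add {p : ℝ≥0∞} (u v : Seqs M) : cls M τ p (u + v) = cls M τ p u + cls M τ p v :=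
  _root_.map_add _ _ _

theorem cls_sub {p : ℝ≥0∞} (u v : Seqs M) : cls M τ p (u - v) = cls M τ p u - cls M τ p v :=
  _root_.map_sub _ _ _

theorem cls_smul {p : ℝ≥0∞} (c : ℂ) (u : Seqs M) : cls M τ p (c • u) = c • cls M τ p u :=
  _root_.map_smul _ _ _

theorem cls_sum {p : ℝ≥0∞} {ι : Type*} (F : Finset ι) (u : ι → Seqs M) :
    cls M τ p (∑ i ∈ F, u i) = ∑ i ∈ F, cls M τ p (u i) :=
  _root_.map_sum _ _ _

theorem lpNorm_cls_le {p : ℝ≥0∞} {u : Seqs M} {b : ℝ≥0∞}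
    (hu : ∀ᶠ n in atTop, opNorm τ p (u n) ≤ b) : lpNorm (cls M τ p u) ≤ b :=
  iInf₂_le_of_le u rfl (limsup_le_of_le (by isBoundedDefault) hu)

theorem exists_rep_of_lpNorm_lt {p : ℝ≥0∞} {ξ : SeqSpace M τ p} {b : ℝ≥0∞} (hb : lpNorm ξ < b) :
    ∃ u : Seqs M, cls M τ p u = ξ ∧ ∀ᶠ n in atTop, opNorm τ p (u n) < b := by
  obtain ⟨u, hu⟩ := iInf_lt_iff.1 hb
  obtain ⟨hu1, hu2⟩ := iInf_lt_iff.1 hu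
  exact ⟨u, hu1, eventually_lt_of_limsup_lt hu2 (by isBoundedDefault)⟩

/-- Any representative differs from a near-optimal one by a null sequence. So every representative
is controlled up to a constant, and exact independence of the representative is not needed. -/
theorem exists_eventually_opNorm_le (h : IsTraceOn M.toStarSubalgebra τ) {p : ℝ≥0∞} (hp0 : 0 < p) :
    ∃ K : ℝ≥0, K ≠ 0 ∧ ∀ (u : Seqs M) (b : ℝ≥0∞), lpNorm (cls M τ p u) < b →
      ∀ᶠ n in atTop, opNorm τ p (u n) ≤ K * b := by
  obtain ⟨K, hK0, hK⟩ := (isGauge_opNorm h hp0).exists_add_le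
  refine ⟨K, hK0, fun u b hb => ?_⟩
  obtain ⟨v, hv, hvb⟩ := exists_rep_of_lpNorm_lt hb
  have hnull := (cls_eq_iff h hp0).1 hv.symm
  rw [ENNReal.tendsto_nhds_zero] at hnull
  filter_upwards [hnull b (zero_le.trans_lt hb), hvb] with n h1 h2
  have := hK b (u n - v n) (v n) h1 h2.le
  simpa using this

theorem lpNorm_smul_le (h : IsTraceOn M.toStarSubalgebra τ) {p : ℝ≥0∞} (hp0 : 0 < p) {c : ℂ}
    (hc : c ≠ 0) (ξ : SeqSpace M τ p) : lpNorm (c • ξ) ≤ ‖c‖ₑ * lpNorm ξ := by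
  have hc0 : ‖c‖ₑ ≠ 0 := by simpa using hc
  rw [mul_comm, ← ENNReal.div_le_iff_le_mul (Or.inl hc0) (Or.inl (by simp))]
  refine le_of_forall_gt fun b hb => ?_
  obtain ⟨b', hb1, hb2⟩ := exists_between hb
  obtain ⟨u, hu, hub⟩ := exists_rep_of_lpNorm_lt hb1
  refine lt_of_le_of_lt ?_ hb2
  rw [ENNReal.div_le_iff_le_mul (Or.inl hc0) (Or.inl (by simp)), mul_comm, ← hu, ← cls_smul]
  refine lpNorm_cls_le ?_
  filter_upwards [hub] with n hn
  have := (isGauge_opNorm h hp0).smul c (u n)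
  rw [Pi.smul_apply, this]
  gcongr

/-- Representatives that are optimal up to `δ` reduce the claim to the operator inequality at all
late indices, without loss in the constant. -/
theorem isGauge_lpNorm (h : IsTraceOn M.toStarSubalgebra τ) {p : ℝ≥0∞} (hp0 : 0 < p) :
    IsGauge (minExp p) 4 (lpNorm : SeqSpace M τ p → ℝ≥0∞) := by
  have hg := isGauge_opNorm h hp0
  have hz : lpNorm (0 : SeqSpace M τ p) = 0 := by
    have : (0 : SeqSpace M τ p) = cls M τ p 0 := (_root_.map_zero _).symm
    rw [this, ← nonpos_iff_eq_zero]
    exact lpNorm_cls_le (Eventually.of_forall fun n => hg.map_zero.le)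
  refine ⟨minExp_pos hp0, minExp_le_one p, by norm_num, fun c ξ => ?_, fun ι F ξ => ?_⟩
  · rcases eq_or_ne c 0 with rfl | hc
    · simp [hz]
    refine le_antisymm (lpNorm_smul_le h hp0 hc ξ) ?_
    have := lpNorm_smul_le h hp0 (inv_ne_zero hc) (c • ξ)
    rw [smul_smul, inv_mul_cancel₀ hc, one_smul, enorm_inv hc] at this
    have hc0 : ‖c‖ₑ ≠ 0 := by simpa using hc
    calc ‖c‖ₑ * lpNorm ξ ≤ ‖c‖ₑ * (‖c‖ₑ⁻¹ * lpNorm (c • ξ)) := by gcongr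
      _ = lpNorm (c • ξ) := by
        rw [← mul_assoc, ENNReal.mul_inv_cancel hc0 (by simp), one_mul]
  · set e := minExp p with he
    have hepos : 0 < e := minExp_pos hp0
    by_cases hfin : ∀ i ∈ F, lpNorm (ξ i) ≠ ∞
    swap
    · push Not at hfin
      obtain ⟨i, hi, hi'⟩ := hfin
      rw [ENNReal.sum_eq_top.2 ⟨i, hi, by rw [hi', ENNReal.top_rpow_of_pos hepos]⟩]
      simp
    have step : ∀ δ : ℝ≥0, 0 < δ → lpNorm (∑ i ∈ F, ξ i) ^ e ≤
        ((4 : ℝ≥0) : ℝ≥0∞) * ∑ i ∈ F, (lpNorm (ξ i) + δ) ^ e := by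
      intro δ hδ
      have hex : ∀ i, ∃ u : Seqs M, cls M τ p u = ξ i ∧ (i ∈ F → ∀ᶠ n in atTop,
          opNorm τ p (u n) < lpNorm (ξ i) + δ) := by
        intro i
        by_cases hi : i ∈ F
        · obtain ⟨u, hu1, hu2⟩ := exists_rep_of_lpNorm_lt
            (ENNReal.lt_add_right (hfin i hi) (by simpa using hδ.ne') : lpNorm (ξ i) < _ + δ)
          exact ⟨u, hu1, fun _ => hu2⟩
        · obtain ⟨u, hu⟩ := exists_cls_eq (ξ i)
          exact ⟨u, hu, fun hi' => absurd hi' hi⟩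
      choose u hu1 hu2 using hex
      have hall : ∀ᶠ n in atTop, ∀ i ∈ F, opNorm τ p (u i n) < lpNorm (ξ i) + δ :=
        (Filter.eventually_all_finset F).2 hu2
      have e1 : ∑ i ∈ F, ξ i = cls M τ p (∑ i ∈ F, u i) := by
        rw [cls_sum]; exact Finset.sum_congr rfl fun i _ => (hu1 i).symm
      rw [e1, ← ENNReal.le_rpow_inv_iff hepos]
      refine lpNorm_cls_le ?_
      filter_upwards [hall] with n hn
      rw [ENNReal.le_rpow_inv_iff hepos, Finset.sum_apply]
      refine (hg.sum_le ι F fun i => u i n).trans ?_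
      gcongr with i hi
      exact (hn i hi).le
    have hlim : Tendsto (fun δ : ℝ≥0 => ((4 : ℝ≥0) : ℝ≥0∞) * ∑ i ∈ F, (lpNorm (ξ i) + δ) ^ e) (𝓝[>] 0)
        (𝓝 (((4 : ℝ≥0) : ℝ≥0∞) * ∑ i ∈ F, (lpNorm (ξ i) + (0 : ℝ≥0)) ^ e)) := by
      refine Tendsto.mono_left (Continuous.tendsto ?_ _) nhdsWithin_le_nhds
      refine (ENNReal.continuous_const_mul (by simp)).comp ?_
      exact continuous_finsetSum _ fun i _ => ENNReal.continuous_rpow_const.comp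
        (continuous_const.add ENNReal.continuous_coe)
    have := ge_of_tendsto hlim (eventually_nhdsWithin_of_forall fun δ hδ => step δ hδ)
    simpa using this

theorem eq_zero_of_lpNorm_eq_zero (h : IsTraceOn M.toStarSubalgebra τ) {p : ℝ≥0∞} (hp0 : 0 < p)
    {ξ : SeqSpace M τ p} (hξ : lpNorm ξ = 0) : ξ = 0 := by
  obtain ⟨u, rfl⟩ := exists_cls_eq ξ
  obtain ⟨K, hK0, hK⟩ := exists_eventually_opNorm_le h hp0
  have : (0 : SeqSpace M τ p) = cls M τ p 0 := (_root_.map_zero _).symm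
  rw [this, cls_eq_iff h hp0, ENNReal.tendsto_nhds_zero]
  intro ε hε
  have hK' : (K : ℝ≥0∞) ≠ 0 := by simpa using hK0
  filter_upwards [hK u (ε / K) (by rw [hξ]; exact ENNReal.div_pos hε.ne' (by simp))] with n hn
  simpa using hn.trans ENNReal.mul_div_le

theorem exists_opNorm_le_lpNorm (h : IsTraceOn M.toStarSubalgebra τ) {p : ℝ≥0∞} (hp0 : 0 < p) :
    ∃ K : ℝ≥0, K ≠ 0 ∧ ∀ (x : M.toStarSubalgebra) (b : ℝ≥0∞), lpNorm (ofOp M τ p x) < b →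
      opNorm τ p x ≤ K * b := by
  obtain ⟨K, hK0, hK⟩ := exists_eventually_opNorm_le h hp0
  refine ⟨K, hK0, fun x b hb => ?_⟩
  exact (hK (fun _ => x) b hb).exists.choose_spec

theorem lpNorm_cls_sub_ofOp_le {p : ℝ≥0∞} {u : Seqs M} {ε : ℝ≥0∞} {K : ℕ} {x : M.toStarSubalgebra}
    (hu : ∀ m ≥ K, opNorm τ p ((u m - x : M.toStarSubalgebra) : H →L[ℂ] H) ≤ ε) :
    lpNorm (cls M τ p u - ofOp M τ p x) ≤ ε := by
  rw [ofOp, ← cls_sub]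
  exact lpNorm_cls_le (eventually_atTop.2 ⟨K, hu⟩)

theorem tendsto_lpNorm_cls_sub_ofOp {p : ℝ≥0∞} {u : Seqs M}
    (hu : GaugeCauchy (fun x : M.toStarSubalgebra => opNorm τ p x) u) :
    Tendsto (fun n => lpNorm (cls M τ p u - ofOp M τ p (u n))) atTop (𝓝 0) := by
  rw [ENNReal.tendsto_nhds_zero]
  intro ε hε
  obtain ⟨K, hK⟩ := hu ε hε
  filter_upwards [eventually_ge_atTop K] with n hn
  exact lpNorm_cls_sub_ofOp_le (K := K) fun m hm => (hK m hm n hn).le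

theorem ofOp_sub {p : ℝ≥0∞} (x y : M.toStarSubalgebra) :
    ofOp M τ p (x - y) = ofOp M τ p x - ofOp M τ p y := by
  rw [ofOp, ofOp, ofOp, ← cls_sub]; rfl

/-- A Cauchy sequence in `L^p` that is asymptotic to a sequence of operators converges to the
class of that sequence. -/
theorem tendsto_cls_of_asymptotic (h : IsTraceOn M.toStarSubalgebra τ) {p : ℝ≥0∞} (hp0 : 0 < p)
    {ξ : ℕ → SeqSpace M τ p} (hξ : GaugeCauchy lpNorm ξ) {x : Seqs M}
    (hx : Tendsto (fun n => lpNorm (ξ n - ofOp M τ p (x n))) atTop (𝓝 0)) :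
    GaugeCauchy (fun x : M.toStarSubalgebra => opNorm τ p x) x ∧
      Tendsto (fun n => lpNorm (ξ n - cls M τ p x)) atTop (𝓝 0) := by
  have hg := isGauge_lpNorm h hp0
  have hc : GaugeCauchy (fun x : M.toStarSubalgebra => opNorm τ p x) x := by
    intro ε hε
    obtain ⟨K, hK0, hK⟩ := exists_opNorm_le_lpNorm h hp0
    have hK' : (K : ℝ≥0∞) ≠ 0 := by simpa using hK0
    obtain ⟨ε', h0, h1⟩ := exists_between hε
    obtain ⟨δ, hδ0, hδ⟩ := hg.exists_delta (ENNReal.div_pos h0.ne' (by simp) : 0 < ε' / K)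
    obtain ⟨n₁, hn₁⟩ := hξ δ hδ0
    obtain ⟨n₂, hn₂⟩ := eventually_atTop.1 (ENNReal.tendsto_nhds_zero.1 hx δ hδ0)
    refine ⟨max n₁ n₂, fun m hm n hn => ?_⟩
    refine (((hK _ _ ?_)).trans ENNReal.mul_div_le).trans_lt h1
    have e : ofOp M τ p (x m - x n) = (ξ m - ξ n) + (ofOp M τ p (x m) - ξ m) +
        (ξ n - ofOp M τ p (x n)) := by
      rw [ofOp_sub]; abel
    rw [e]
    refine hδ _ _ _ (hn₁ m (le_trans (le_max_left _ _) hm) n (le_trans (le_max_left _ _) hn)).le ?_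
      (hn₂ n (le_trans (le_max_right _ _) hn))
    rw [hg.map_sub_comm]
    exact hn₂ m (le_trans (le_max_right _ _) hm)
  refine ⟨hc, ?_⟩
  have h2 := tendsto_lpNorm_cls_sub_ofOp hc
  simp only [hg.map_sub_comm (cls M τ p x)] at h2
  have := hg.tendsto_add hx h2
  simpa using this

end

/-! ### Hardy spaces -/

section

variable {H : Type*} [NormedAddCommGroup H] [InnerProductSpace ℂ H] [CompleteSpace H]
  {M : VonNeumannAlgebra H} {τ : (H →L[ℂ] H) → ℝ≥0∞} {A : Subalgebra ℂ (H →L[ℂ] H)}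

/-- A Cauchy sequence of elements of `A` of finite `p`-norm. -/
structure IsHardySeq (τ : (H →L[ℂ] H) → ℝ≥0∞) (A : Subalgebra ℂ (H →L[ℂ] H)) (p : ℝ≥0∞)
    (u : Seqs M) : Prop where
  mem : ∀ n, (u n : H →L[ℂ] H) ∈ A
  finite : ∀ n, opNorm τ p (u n) < ∞
  cauchy : GaugeCauchy (fun x : M.toStarSubalgebra => opNorm τ p x) u

/-- One description for all exponents. For `p = ∞` a Cauchy sequence in `A` converges because `A` is
norm closed; for `p < ∞` approximants of `ξ` from `A` form a Cauchy sequence with class `ξ`. -/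
theorem mem_hardy_iff (h : IsTraceOn M.toStarSubalgebra τ)
    (hA : IsClosed (A : Set (H →L[ℂ] H))) {p : ℝ≥0∞} (hp0 : 0 < p) {ξ : SeqSpace M τ p} :
    ξ ∈ hardy M τ A p ↔ ∃ u : Seqs M, IsHardySeq τ A p u ∧ cls M τ p u = ξ := by
  have hg := isGauge_opNorm h hp0
  have hG := isGauge_lpNorm h hp0
  by_cases hp : p = ∞
  · subst hp
    rw [hardy, if_pos rfl]
    constructor
    · rintro ⟨a, ha, rfl⟩
      refine ⟨fun _ => a, ⟨fun _ => ha, fun _ => by rw [opNorm_top]; exact enorm_lt_top,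
        fun ε hε => ⟨0, fun m _ n _ => ?_⟩⟩, rfl⟩
      have := hg.map_zero
      simp only [sub_self]
      rwa [this]
    · rintro ⟨u, hu, rfl⟩
      have hc : CauchySeq fun n => (u n : H →L[ℂ] H) := by
        rw [EMetric.cauchySeq_iff]
        intro ε hε
        obtain ⟨K, hK⟩ := hu.cauchy ε hε
        refine ⟨K, fun m hm n hn => ?_⟩
        have : opNorm τ ∞ ((u m - u n : M.toStarSubalgebra) : H →L[ℂ] H) < ε := hK m hm n hn
        rw [opNorm_top] at this
        rwa [edist_eq_enorm_sub]
      obtain ⟨a, ha⟩ := cauchySeq_tendsto_of_complete hc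
      have haA : a ∈ A := hA.mem_of_tendsto ha (Eventually.of_forall hu.mem)
      have haM : a ∈ M.toStarSubalgebra :=
        (isClosed_vonNeumann M).mem_of_tendsto ha (Eventually.of_forall fun n => (u n).2)
      refine ⟨⟨a, haM⟩, haA, ?_⟩
      rw [ofOp, cls_eq_iff h hp0]
      simp only [opNorm_top]
      have := tendsto_iff_edist_tendsto_0.1 ha
      refine this.congr fun n => ?_
      rw [edist_comm, edist_eq_enorm_sub]; rfl
  · rw [hardy, if_neg hp]
    constructor
    · rintro ⟨-, hξ⟩
      have hpos : ∀ n : ℕ, (0 : ℝ≥0∞) < ((n : ℝ≥0∞) + 1)⁻¹ := fun n =>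
        ENNReal.inv_pos.2 (by finiteness)
      choose a ha haf han using fun n : ℕ => hξ _ (hpos n)
      have hlim : Tendsto (fun n : ℕ => ((n : ℝ≥0∞) + 1)⁻¹) atTop (𝓝 0) := by
        have := (tendsto_add_atTop_iff_nat 1).2 ENNReal.tendsto_inv_nat_nhds_zero
        simpa using this
      have hx : Tendsto (fun n => lpNorm (ξ - ofOp M τ p (a n))) atTop (𝓝 0) :=
        tendsto_of_tendsto_of_tendsto_of_le_of_le tendsto_const_nhds hlim (fun _ => zero_le)
          fun n => (han n).le
      obtain ⟨h1, h2⟩ := tendsto_cls_of_asymptotic h hp0 (ξ := fun _ => ξ)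
        (fun ε hε => ⟨0, fun m _ n _ => by rwa [sub_self, hG.map_zero]⟩) hx
      refine ⟨a, ⟨ha, haf, h1⟩, ?_⟩
      have h3 := tendsto_nhds_unique h2 tendsto_const_nhds
      exact (sub_eq_zero.1 (eq_zero_of_lpNorm_eq_zero h hp0 h3.symm)).symm
    · rintro ⟨u, hu, rfl⟩
      refine ⟨⟨u, hu.finite, hu.cauchy, rfl⟩, fun ε hε => ?_⟩
      obtain ⟨ε', h0, h1⟩ := exists_between hε
      obtain ⟨n, hn⟩ := (ENNReal.tendsto_nhds_zero.1 (tendsto_lpNorm_cls_sub_ofOp hu.cauchy) ε'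
        h0).exists
      exact ⟨u n, hu.mem n, hu.finite n, hn.trans_lt h1⟩

theorem IsHardySeq.zero (h : IsTraceOn M.toStarSubalgebra τ) {p : ℝ≥0∞} (hp0 : 0 < p) :
    IsHardySeq τ A p (0 : Seqs M) := by
  have := (isGauge_opNorm h hp0).map_zero
  refine ⟨fun _ => A.zero_mem, fun _ => ?_, fun ε hε => ⟨0, fun m _ n _ => ?_⟩⟩
  · exact this.trans_lt (by simp)
  · simp only [Pi.zero_apply, sub_self]; exact this.trans_lt hε

theorem IsHardySeq.add (h : IsTraceOn M.toStarSubalgebra τ) {p : ℝ≥0∞} (hp0 : 0 < p)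
    {u v : Seqs M} (hu : IsHardySeq τ A p u) (hv : IsHardySeq τ A p v) :
    IsHardySeq τ A p (u + v) := by
  have hg := isGauge_opNorm h hp0
  refine ⟨fun n => A.add_mem (hu.mem n) (hv.mem n), fun n => ?_, fun ε hε => ?_⟩
  · obtain ⟨K, -, hK⟩ := hg.exists_add_le
    refine (hK _ (u n) (v n) (le_max_left _ _) (le_max_right _ _)).trans_lt ?_
    exact ENNReal.mul_lt_top (by simp) (max_lt (hu.finite n) (hv.finite n))
  · obtain ⟨δ, h0, hδ⟩ := hg.exists_delta_two hε
    obtain ⟨n₁, hn₁⟩ := hu.cauchy δ h0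
    obtain ⟨n₂, hn₂⟩ := hv.cauchy δ h0
    refine ⟨max n₁ n₂, fun m hm n hn => ?_⟩
    have e : (u + v) m - (u + v) n = (u m - u n) + (v m - v n) := by
      simp only [Pi.add_apply]; abel
    simp only [e]
    exact hδ _ _ (hn₁ m (le_trans (le_max_left _ _) hm) n (le_trans (le_max_left _ _) hn)).le
      (hn₂ m (le_trans (le_max_right _ _) hm) n (le_trans (le_max_right _ _) hn)).le

theorem IsHardySeq.smul (h : IsTraceOn M.toStarSubalgebra τ) {p : ℝ≥0∞} (hp0 : 0 < p)
    {u : Seqs M} (c : ℂ) (hu : IsHardySeq τ A p u) : IsHardySeq τ A p (c • u) := by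
  have hg := isGauge_opNorm h hp0
  refine ⟨fun n => A.smul_mem (hu.mem n) c, fun n => ?_, fun ε hε => ?_⟩
  · have := hg.smul c (u n)
    rw [Pi.smul_apply, this]
    exact ENNReal.mul_lt_top (by simp) (hu.finite n)
  · rcases eq_or_ne c 0 with rfl | hc
    · refine ⟨0, fun m _ n _ => ?_⟩
      simp only [zero_smul, Pi.zero_apply, sub_self]
      exact hg.map_zero.trans_lt hε
    have hc0 : ‖c‖ₑ ≠ 0 := by simpa using hc
    obtain ⟨ε', h0, h1⟩ := exists_between hε
    obtain ⟨K, hK⟩ := hu.cauchy (ε' / ‖c‖ₑ) (ENNReal.div_pos h0.ne' (by simp))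
    refine ⟨K, fun m hm n hn => ?_⟩
    have := hg.smul c (u m - u n)
    simp only [Pi.smul_apply, ← smul_sub]
    rw [this]
    exact (mul_le_mul_right (hK m hm n hn).le _).trans_lt (ENNReal.mul_div_le.trans_lt h1)

theorem IsHardySeq.exists_bound (h : IsTraceOn M.toStarSubalgebra τ) {p : ℝ≥0∞} (hp0 : 0 < p)
    {u : Seqs M} (hu : IsHardySeq τ A p u) :
    ∃ B : ℝ≥0∞, B < ∞ ∧ ∀ᶠ n in atTop, opNorm τ p (u n) ≤ B := by
  have hg := isGauge_opNorm h hp0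
  obtain ⟨K, -, hK⟩ := hg.exists_add_le
  obtain ⟨n₀, hn₀⟩ := hu.cauchy 1 one_pos
  refine ⟨K * max 1 (opNorm τ p (u n₀)), ENNReal.mul_lt_top (by simp)
    (max_lt (by simp) (hu.finite n₀)), ?_⟩
  filter_upwards [eventually_ge_atTop n₀] with n hn
  have := hK _ (u n - u n₀) (u n₀) ((hn₀ n hn n₀ le_rfl).le.trans (le_max_left _ _))
    (le_max_right _ _)
  simpa using this

theorem IsHardySeq.lpNorm_lt_top (h : IsTraceOn M.toStarSubalgebra τ) {p : ℝ≥0∞} (hp0 : 0 < p)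
    {u : Seqs M} (hu : IsHardySeq τ A p u) : lpNorm (cls M τ p u) < ∞ := by
  obtain ⟨B, hB, hb⟩ := hu.exists_bound h hp0
  exact (lpNorm_cls_le hb).trans_lt hB

/-- The Hardy space as a subspace of the space of sequences modulo null sequences. -/
def hardySubmodule (h : IsTraceOn M.toStarSubalgebra τ)
    (hA : IsClosed (A : Set (H →L[ℂ] H))) {p : ℝ≥0∞} (hp0 : 0 < p) :
    Submodule ℂ (SeqSpace M τ p) where
  carrier := hardy M τ A p
  zero_mem' := (mem_hardy_iff h hA hp0).2 ⟨0, .zero h hp0, _root_.map_zero _⟩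
  add_mem' := by
    intro ξ η hξ hη
    obtain ⟨u, hu, rfl⟩ := (mem_hardy_iff h hA hp0).1 hξ
    obtain ⟨v, hv, rfl⟩ := (mem_hardy_iff h hA hp0).1 hη
    exact (mem_hardy_iff h hA hp0).2 ⟨u + v, hu.add h hp0 hv, cls_add u v⟩
  smul_mem' := by
    intro c ξ hξ
    obtain ⟨u, hu, rfl⟩ := (mem_hardy_iff h hA hp0).1 hξ
    exact (mem_hardy_iff h hA hp0).2 ⟨c • u, hu.smul h hp0 c, cls_smul c u⟩

theorem lpNorm_lt_top_of_mem_hardy (h : IsTraceOn M.toStarSubalgebra τ)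
    (hA : IsClosed (A : Set (H →L[ℂ] H))) {p : ℝ≥0∞} (hp0 : 0 < p) {ξ : SeqSpace M τ p}
    (hξ : ξ ∈ hardy M τ A p) : lpNorm ξ < ∞ := by
  obtain ⟨u, hu, rfl⟩ := (mem_hardy_iff h hA hp0).1 hξ
  exact hu.lpNorm_lt_top h hp0

/-- Hardy spaces are complete. -/
theorem hardy_complete (h : IsTraceOn M.toStarSubalgebra τ)
    (hA : IsClosed (A : Set (H →L[ℂ] H))) {p : ℝ≥0∞} (hp0 : 0 < p) {ξ : ℕ → SeqSpace M τ p}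
    (hξ : ∀ n, ξ n ∈ hardy M τ A p) (hc : GaugeCauchy lpNorm ξ) :
    ∃ η ∈ hardy M τ A p, Tendsto (fun n => lpNorm (ξ n - η)) atTop (𝓝 0) := by
  have hpos : ∀ n : ℕ, (0 : ℝ≥0∞) < ((n : ℝ≥0∞) + 1)⁻¹ := fun n =>
    ENNReal.inv_pos.2 (by finiteness)
  have hex : ∀ n : ℕ, ∃ a : M.toStarSubalgebra, (a : H →L[ℂ] H) ∈ A ∧ opNorm τ p a < ∞ ∧
      lpNorm (ξ n - ofOp M τ p a) ≤ ((n : ℝ≥0∞) + 1)⁻¹ := by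
    intro n
    obtain ⟨u, hu, hu'⟩ := (mem_hardy_iff h hA hp0).1 (hξ n)
    obtain ⟨k, hk⟩ := (ENNReal.tendsto_nhds_zero.1 (tendsto_lpNorm_cls_sub_ofOp hu.cauchy) _
      (hpos n)).exists
    exact ⟨u k, hu.mem k, hu.finite k, by rwa [← hu']⟩
  choose a ha haf han using hex
  have hlim : Tendsto (fun n : ℕ => ((n : ℝ≥0∞) + 1)⁻¹) atTop (𝓝 0) := by
    have := (tendsto_add_atTop_iff_nat 1).2 ENNReal.tendsto_inv_nat_nhds_zero
    simpa using this
  have hx : Tendsto (fun n => lpNorm (ξ n - ofOp M τ p (a n))) atTop (𝓝 0) :=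
    tendsto_of_tendsto_of_tendsto_of_le_of_le tendsto_const_nhds hlim (fun _ => zero_le) han
  -- The limit is the class of the approximants `a n`, taken within `1/(n+1)` of `ξ n`.
  obtain ⟨h1, h2⟩ := tendsto_cls_of_asymptotic h hp0 hc hx
  exact ⟨_, (mem_hardy_iff h hA hp0).2 ⟨a, ⟨ha, haf, h1⟩, rfl⟩, h2⟩

/-! ### The product of Hardy spaces -/

section Mul

variable {p q r : ℝ≥0∞}

theorem tendsto_opNorm_mul_left (h : IsTraceOn M.toStarSubalgebra τ) (hp0 : 0 < p) (hq0 : 0 < q)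
    (hr0 : 0 < r) (hpqr : r⁻¹ = p⁻¹ + q⁻¹) {u v : Seqs M} {B : ℝ≥0∞} (hB : B < ∞)
    (hu : ∀ᶠ n in atTop, opNorm τ p (u n) ≤ B)
    (hv : Tendsto (fun n => opNorm τ q (v n)) atTop (𝓝 0)) :
    Tendsto (fun n => opNorm τ r ((u n : H →L[ℂ] H) * v n)) atTop (𝓝 0) := by
  obtain ⟨K, hK⟩ := exists_opNorm_mul_le h hp0 hq0 hr0 hpqr
  have hlim : Tendsto (fun n => (K : ℝ≥0∞) * (B * opNorm τ q (v n))) atTop (𝓝 0) := by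
    have := ENNReal.Tendsto.const_mul (a := (K : ℝ≥0∞))
      (ENNReal.Tendsto.const_mul (a := B) hv (Or.inr hB.ne)) (Or.inr (by simp))
    simpa using this
  refine tendsto_of_tendsto_of_tendsto_of_le_of_le' tendsto_const_nhds hlim
    (Eventually.of_forall fun _ => zero_le) ?_
  filter_upwards [hu, ENNReal.tendsto_nhds_zero.1 hv 1 one_pos] with n h1 h2
  refine (hK _ (u n).2 _ (v n).2 (h1.trans_lt hB) (h2.trans_lt (by simp))).trans ?_
  gcongr

theorem tendsto_opNorm_mul_right (h : IsTraceOn M.toStarSubalgebra τ) (hp0 : 0 < p) (hq0 : 0 < q)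
    (hr0 : 0 < r) (hpqr : r⁻¹ = p⁻¹ + q⁻¹) {u v : Seqs M} {B : ℝ≥0∞} (hB : B < ∞)
    (hu : Tendsto (fun n => opNorm τ p (u n)) atTop (𝓝 0))
    (hv : ∀ᶠ n in atTop, opNorm τ q (v n) ≤ B) :
    Tendsto (fun n => opNorm τ r ((u n : H →L[ℂ] H) * v n)) atTop (𝓝 0) := by
  obtain ⟨K, hK⟩ := exists_opNorm_mul_le h hp0 hq0 hr0 hpqr
  have hlim : Tendsto (fun n => (K : ℝ≥0∞) * (opNorm τ p (u n) * B)) atTop (𝓝 0) := by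
    have := ENNReal.Tendsto.const_mul (a := (K : ℝ≥0∞))
      (ENNReal.Tendsto.mul_const (b := B) hu (Or.inr hB.ne)) (Or.inr (by simp))
    simpa using this
  refine tendsto_of_tendsto_of_tendsto_of_le_of_le' tendsto_const_nhds hlim
    (Eventually.of_forall fun _ => zero_le) ?_
  filter_upwards [hv, ENNReal.tendsto_nhds_zero.1 hu 1 one_pos] with n h1 h2
  refine (hK _ (u n).2 _ (v n).2 (h2.trans_lt (by simp)) (h1.trans_lt hB)).trans ?_
  gcongr

theorem exists_bound_of_lpNorm_lt_top (h : IsTraceOn M.toStarSubalgebra τ) (hp0 : 0 < p)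
    {u : Seqs M} (hu : lpNorm (cls M τ p u) < ∞) :
    ∃ B : ℝ≥0∞, B < ∞ ∧ ∀ᶠ n in atTop, opNorm τ p (u n) ≤ B := by
  obtain ⟨K, -, hK⟩ := exists_eventually_opNorm_le h hp0
  obtain ⟨b, hb1, hb2⟩ := exists_between hu
  exact ⟨K * b, ENNReal.mul_lt_top (by simp) hb2, hK u b hb1⟩

/-- Frees the product from its chosen representatives: `u'v' - uv = u'(v' - v) + (u' - u)v`, and
each term is an eventually bounded sequence times a null one. -/
theorem lpMul_cls (h : IsTraceOn M.toStarSubalgebra τ) (hp0 : 0 < p) (hq0 : 0 < q)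
    (hr0 : 0 < r) (hpqr : r⁻¹ = p⁻¹ + q⁻¹) {u v : Seqs M} (hu : lpNorm (cls M τ p u) < ∞)
    (hv : lpNorm (cls M τ q v) < ∞) :
    lpMul r (cls M τ p u) (cls M τ q v) = cls M τ r (u * v) := by
  set u' := Function.surjInv (nullSeqs M τ p).mkQ_surjective (cls M τ p u) with hu'
  set v' := Function.surjInv (nullSeqs M τ q).mkQ_surjective (cls M τ q v) with hv'
  have eu : cls M τ p u' = cls M τ p u := Function.surjInv_eq _ _
  have ev : cls M τ q v' = cls M τ q v := Function.surjInv_eq _ _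
  obtain ⟨B, hB, hb⟩ := exists_bound_of_lpNorm_lt_top h hp0 (eu ▸ hu)
  obtain ⟨B', hB', hb'⟩ := exists_bound_of_lpNorm_lt_top h hq0 hv
  have h1 := tendsto_opNorm_mul_left h hp0 hq0 hr0 hpqr (v := v' - v) hB hb
    ((cls_eq_iff h hq0).1 ev)
  have h2 := tendsto_opNorm_mul_right h hp0 hq0 hr0 hpqr (u := u' - u) hB'
    ((cls_eq_iff h hp0).1 eu) hb'
  change cls M τ r (u' * v') = _
  rw [cls_eq_iff h hr0]
  have := (isGauge_opNorm h hr0).tendsto_add (u := fun n => u' n * (v' - v) n)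
    (v := fun n => (u' - u) n * v n) h1 h2
  refine this.congr fun n => ?_
  congr 2
  simp only [Pi.sub_apply, Pi.mul_apply]
  noncomm_ring

theorem IsHardySeq.mul (h : IsTraceOn M.toStarSubalgebra τ) (hp0 : 0 < p) (hq0 : 0 < q)
    (hr0 : 0 < r) (hpqr : r⁻¹ = p⁻¹ + q⁻¹) {u v : Seqs M} (hu : IsHardySeq τ A p u)
    (hv : IsHardySeq τ A q v) : IsHardySeq τ A r (u * v) := by
  obtain ⟨K, hK⟩ := exists_opNorm_mul_le h hp0 hq0 hr0 hpqr
  have hg := isGauge_opNorm h hr0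
  refine ⟨fun n => A.mul_mem (hu.mem n) (hv.mem n), fun n => ?_, fun ε hε => ?_⟩
  · refine (hK _ (u n).2 _ (v n).2 (hu.finite n) (hv.finite n)).trans_lt ?_
    exact ENNReal.mul_lt_top (by simp) (ENNReal.mul_lt_top (hu.finite n) (hv.finite n))
  · obtain ⟨B, hB, hb⟩ := hu.exists_bound h hp0
    obtain ⟨B', hB', hb'⟩ := hv.exists_bound h hq0
    obtain ⟨δ, h0, hδ⟩ := hg.exists_delta_two hε
    obtain ⟨k, hk⟩ := eventually_atTop.1 (hb.and hb')
    -- A common constant for the two terms of the product rule, so a single threshold `δ / L` serves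
    -- both.
    set L : ℝ≥0∞ := K * (B + B') with hL
    have hLt : L ≠ ∞ := ENNReal.mul_ne_top (by simp) (ENNReal.add_ne_top.2 ⟨hB.ne, hB'.ne⟩)
    have hδL : 0 < δ / L := ENNReal.div_pos h0.ne' hLt
    obtain ⟨n₁, hn₁⟩ := hu.cauchy _ hδL
    obtain ⟨n₂, hn₂⟩ := hv.cauchy _ hδL
    refine ⟨max k (max n₁ n₂), fun m hm n hn => ?_⟩
    have e : (u * v) m - (u * v) n = u m * (v m - v n) + (u m - u n) * v n := by
      simp only [Pi.mul_apply]; noncomm_ring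
    simp only [e]
    have hmk : k ≤ m := (le_max_left _ _).trans hm
    have hnk : k ≤ n := (le_max_left _ _).trans hn
    have hm1 : n₁ ≤ m := (le_max_left _ _).trans ((le_max_right _ _).trans hm)
    have hn1 : n₁ ≤ n := (le_max_left _ _).trans ((le_max_right _ _).trans hn)
    have hm2 : n₂ ≤ m := (le_max_right _ _).trans ((le_max_right _ _).trans hm)
    have hn2 : n₂ ≤ n := (le_max_right _ _).trans ((le_max_right _ _).trans hn)
    have hu1 := hn₁ m hm1 n hn1
    have hv1 := hn₂ m hm2 n hn2
    refine hδ _ _ ?_ ?_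
    · refine (hK _ (u m).2 _ (v m - v n).2 (hu.finite m) (hv1.trans_le le_top)).trans ?_
      calc (K : ℝ≥0∞) * (opNorm τ p (u m) * opNorm τ q ((v m - v n : M.toStarSubalgebra) : H →L[ℂ] H))
          ≤ K * ((B + B') * (δ / L)) := by
            gcongr
            exact (hk m hmk).1.trans le_self_add
        _ = L * (δ / L) := by rw [hL, mul_assoc]
        _ ≤ δ := ENNReal.mul_div_le
    · refine (hK _ (u m - u n).2 _ (v n).2 (hu1.trans_le le_top) (hv.finite n)).trans ?_
      calc (K : ℝ≥0∞) * (opNorm τ p ((u m - u n : M.toStarSubalgebra) : H →L[ℂ] H) * opNorm τ q (v n))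
          ≤ K * ((δ / L) * (B + B')) := by
            gcongr
            exact (hk n hnk).2.trans le_add_self
        _ = L * (δ / L) := by rw [hL]; ring
        _ ≤ δ := ENNReal.mul_div_le

theorem lpMul_mem_hardy (h : IsTraceOn M.toStarSubalgebra τ) (hA : IsClosed (A : Set (H →L[ℂ] H)))
    (hp0 : 0 < p) (hq0 : 0 < q) (hr0 : 0 < r) (hpqr : r⁻¹ = p⁻¹ + q⁻¹) {ξ : SeqSpace M τ p}
    {η : SeqSpace M τ q} (hξ : ξ ∈ hardy M τ A p) (hη : η ∈ hardy M τ A q) :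
    lpMul r ξ η ∈ hardy M τ A r := by
  obtain ⟨u, hu, rfl⟩ := (mem_hardy_iff h hA hp0).1 hξ
  obtain ⟨v, hv, rfl⟩ := (mem_hardy_iff h hA hq0).1 hη
  rw [lpMul_cls h hp0 hq0 hr0 hpqr (hu.lpNorm_lt_top h hp0) (hv.lpNorm_lt_top h hq0)]
  exact (mem_hardy_iff h hA hr0).2 ⟨u * v, hu.mul h hp0 hq0 hr0 hpqr hv, rfl⟩

theorem smul_lpMul (h : IsTraceOn M.toStarSubalgebra τ) (hA : IsClosed (A : Set (H →L[ℂ] H)))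
    (hp0 : 0 < p) (hq0 : 0 < q) (hr0 : 0 < r) (hpqr : r⁻¹ = p⁻¹ + q⁻¹) {ξ : SeqSpace M τ p}
    {η : SeqSpace M τ q} (hξ : ξ ∈ hardy M τ A p) (hη : η ∈ hardy M τ A q) (c : ℂ) :
    lpMul r (c • ξ) η = c • lpMul r ξ η := by
  obtain ⟨u, hu, rfl⟩ := (mem_hardy_iff h hA hp0).1 hξ
  obtain ⟨v, hv, rfl⟩ := (mem_hardy_iff h hA hq0).1 hη
  rw [lpMul_cls h hp0 hq0 hr0 hpqr (hu.lpNorm_lt_top h hp0) (hv.lpNorm_lt_top h hq0), ← cls_smul,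
    ← cls_smul, lpMul_cls h hp0 hq0 hr0 hpqr ((hu.smul h hp0 c).lpNorm_lt_top h hp0)
      (hv.lpNorm_lt_top h hq0), smul_mul_assoc]

theorem exists_lpNorm_lpMul_le (h : IsTraceOn M.toStarSubalgebra τ) (hp0 : 0 < p) (hq0 : 0 < q)
    (hr0 : 0 < r) (hpqr : r⁻¹ = p⁻¹ + q⁻¹) : ∃ K : ℝ≥0, ∀ (ξ : SeqSpace M τ p) (η : SeqSpace M τ q),
      lpNorm ξ < ∞ → lpNorm η < ∞ → lpNorm (lpMul r ξ η) ≤ K * (lpNorm ξ * lpNorm η) := by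
  obtain ⟨K, hK⟩ := exists_opNorm_mul_le h hp0 hq0 hr0 hpqr
  obtain ⟨K₁, -, hK₁⟩ := exists_eventually_opNorm_le h hp0
  obtain ⟨K₂, -, hK₂⟩ := exists_eventually_opNorm_le h hq0
  refine ⟨K * K₁ * K₂, fun ξ η hξ hη => ?_⟩
  obtain ⟨u, rfl⟩ := exists_cls_eq ξ
  obtain ⟨v, rfl⟩ := exists_cls_eq η
  rw [lpMul_cls h hp0 hq0 hr0 hpqr hξ hη]
  have step : ∀ a b : ℝ≥0, lpNorm (cls M τ p u) < a → lpNorm (cls M τ q v) < b →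
      lpNorm (cls M τ r (u * v)) ≤ ((K * K₁ * K₂ : ℝ≥0) : ℝ≥0∞) * ((a : ℝ≥0∞) * b) := by
    intro a b ha hb
    refine lpNorm_cls_le ?_
    filter_upwards [hK₁ u a ha, hK₂ v b hb] with n h1 h2
    refine (hK _ (u n).2 _ (v n).2 (h1.trans_lt (ENNReal.mul_lt_top (by simp) (by simp)))
      (h2.trans_lt (ENNReal.mul_lt_top (by simp) (by simp)))).trans ?_
    calc (K : ℝ≥0∞) * (opNorm τ p (u n) * opNorm τ q (v n)) ≤ K * ((K₁ * a) * (K₂ * b)) := by gcongr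
      _ = _ := by push_cast; ring
  have hlim : Tendsto (fun δ : ℝ≥0 => ((K * K₁ * K₂ : ℝ≥0) : ℝ≥0∞) *
      ((((lpNorm (cls M τ p u)).toNNReal + δ : ℝ≥0) : ℝ≥0∞) *
        (((lpNorm (cls M τ q v)).toNNReal + δ : ℝ≥0) : ℝ≥0∞)))
      (𝓝[>] 0) (𝓝 (((K * K₁ * K₂ : ℝ≥0) : ℝ≥0∞) *
      ((((lpNorm (cls M τ p u)).toNNReal + 0 : ℝ≥0) : ℝ≥0∞) *
        (((lpNorm (cls M τ q v)).toNNReal + 0 : ℝ≥0) : ℝ≥0∞)))) := by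
    simp only [← ENNReal.coe_mul]
    refine Tendsto.mono_left (Continuous.tendsto ?_ _) nhdsWithin_le_nhds
    fun_prop
  have := ge_of_tendsto hlim (eventually_nhdsWithin_of_forall fun δ (hδ : 0 < δ) => step _ _ ?_ ?_)
  · simpa [ENNReal.coe_toNNReal hξ.ne, ENNReal.coe_toNNReal hη.ne] using this
  · rw [ENNReal.coe_add, ENNReal.coe_toNNReal hξ.ne]
    exact ENNReal.lt_add_right hξ.ne (by simpa using hδ.ne')
  · rw [ENNReal.coe_add, ENNReal.coe_toNNReal hη.ne]
    exact ENNReal.lt_add_right hη.ne (by simpa using hδ.ne')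

end Mul

end

/-! ### Sums of atoms in a normed group -/

section

section Atoms

variable {G P : Type*} [NormedAddCommGroup G] {m : P → G} {w : P → ℝ≥0∞}

/-- `x` is the sum of the atoms `m (i n)`, of total weight `∑ w (i n) < ∞`. -/
def IsAtomicSum (m : P → G) (w : P → ℝ≥0∞) (x : G) (i : ℕ → P) : Prop :=
  ∑' n, w (i n) < ∞ ∧ HasSum (fun n => m (i n)) x

/-- The least total weight of a representation of `x` as a sum of atoms. -/
def atomicCost (m : P → G) (w : P → ℝ≥0∞) (x : G) : ℝ≥0∞ :=
  ⨅ (i : ℕ → P) (_ : IsAtomicSum m w x i), ∑' n, w (i n)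

theorem exists_of_atomicCost_lt {x : G} {b : ℝ≥0∞} (hb : atomicCost m w x < b) :
    ∃ i, IsAtomicSum m w x i ∧ ∑' n, w (i n) < b := by
  obtain ⟨i, hi⟩ := iInf_lt_iff.1 hb
  obtain ⟨h1, h2⟩ := iInf_lt_iff.1 hi
  exact ⟨i, h1, h2⟩

theorem IsAtomicSum.cost_le {x : G} {i : ℕ → P} (h : IsAtomicSum m w x i) :
    atomicCost m w x ≤ ∑' n, w (i n) := iInf₂_le i h

/-- The two series are interleaved on even and odd indices, so no weight is lost. -/
theorem IsAtomicSum.exists_add {x y : G} {i j : ℕ → P} (hx : IsAtomicSum m w x i)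
    (hy : IsAtomicSum m w y j) : ∃ k, IsAtomicSum m w (x + y) k ∧
      ∑' n, w (k n) = ∑' n, w (i n) + ∑' n, w (j n) := by
  let k : ℕ → P := fun n => if Even n then i (n / 2) else j (n / 2)
  have he : ∀ n, k (2 * n) = i n := fun n => by simp [k]
  have ho : ∀ n, k (2 * n + 1) = j n := fun n => by
    have : (2 * n + 1) / 2 = n := by omega
    simp [k, this]
  have hcost : ∑' n, w (k n) = ∑' n, w (i n) + ∑' n, w (j n) := by
    refine HasSum.tsum_eq (HasSum.even_add_odd ?_ ?_)
    · simp only [he]; exact ENNReal.summable.hasSum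
    · simp only [ho]; exact ENNReal.summable.hasSum
  refine ⟨k, ⟨?_, HasSum.even_add_odd ?_ ?_⟩, hcost⟩
  · rw [hcost]; exact ENNReal.add_lt_top.2 ⟨hx.1, hy.1⟩
  · simpa only [he] using hx.2
  · simpa only [ho] using hy.2

theorem atomicCost_add_le (x y : G) :
    atomicCost m w (x + y) ≤ atomicCost m w x + atomicCost m w y := by
  refine le_of_forall_gt fun b hb => ?_
  by_cases hx : atomicCost m w x = ∞
  · simp [hx] at hb
  by_cases hy : atomicCost m w y = ∞
  · simp [hy] at hb
  obtain ⟨b₁, hb₁, b₂, hb₂, h12⟩ : ∃ b₁, atomicCost m w x < b₁ ∧ ∃ b₂, atomicCost m w y < b₂ ∧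
      b₁ + b₂ ≤ b := by
    obtain ⟨c, hc, hcb⟩ := ENNReal.lt_iff_exists_add_pos_lt.1 hb
    have h2 : ((c / 2 : ℝ≥0) : ℝ≥0∞) ≠ 0 := by simpa using hc.ne'
    refine ⟨_, ENNReal.lt_add_right hx h2, _, ENNReal.lt_add_right hy h2, ?_⟩
    refine le_trans (le_of_eq ?_) hcb.le
    rw [add_add_add_comm, ← ENNReal.coe_add, add_halves]
  obtain ⟨i, hi, hi'⟩ := exists_of_atomicCost_lt hb₁
  obtain ⟨j, hj, hj'⟩ := exists_of_atomicCost_lt hb₂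
  obtain ⟨k, hk, hk'⟩ := hi.exists_add hj
  exact (hk.cost_le.trans_eq hk').trans_lt ((ENNReal.add_lt_add hi' hj').trans_le h12)

theorem enorm_le_tsum {ι : Type*} {f : ι → G} {x : G} (hf : HasSum f x) :
    ‖x‖ₑ ≤ ∑' n, ‖f n‖ₑ := by
  refine le_of_tendsto hf.enorm (Eventually.of_forall fun F => ?_)
  exact (enorm_sum_le _ _).trans (ENNReal.sum_le_tsum F)

/-- The norm of `x` is at most `K` times the weight of any representing series. -/
theorem eq_zero_of_atomicCost_eq_zero {K : ℝ≥0} (hw : ∀ i, ‖m i‖ₑ ≤ K * w i) {x : G}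
    (hx : atomicCost m w x = 0) : x = 0 := by
  have key : ∀ b : ℝ≥0∞, 0 < b → ‖x‖ₑ ≤ K * b := by
    intro b hb
    obtain ⟨i, hi, hi'⟩ := exists_of_atomicCost_lt (hx.trans_lt hb)
    calc ‖x‖ₑ ≤ ∑' n, ‖m (i n)‖ₑ := enorm_le_tsum hi.2
      _ ≤ ∑' n, K * w (i n) := ENNReal.tsum_le_tsum fun n => hw _
      _ = K * ∑' n, w (i n) := ENNReal.tsum_mul_left
      _ ≤ K * b := by gcongr
  have hlim : Tendsto (fun n : ℕ => (K : ℝ≥0∞) * (n : ℝ≥0∞)⁻¹) atTop (𝓝 0) := by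
    simpa using ENNReal.Tendsto.const_mul (a := (K : ℝ≥0∞))
      ENNReal.tendsto_inv_nat_nhds_zero (Or.inr (by simp))
  exact enorm_eq_zero.1 (nonpos_iff_eq_zero.1 (ge_of_tendsto' hlim fun n => key _ (by simp)))

theorem summable_atoms [CompleteSpace G] {K : ℝ≥0} (hw : ∀ i, ‖m i‖ₑ ≤ K * w i) {ι : Type*}
    {i : ι → P} (hi : ∑' n, w (i n) < ∞) : Summable fun n => m (i n) := by
  refine Summable.of_nnnorm (ENNReal.tsum_coe_ne_top_iff_summable.1 (ne_of_lt ?_))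
  calc ∑' n, (‖m (i n)‖₊ : ℝ≥0∞) ≤ ∑' n, K * w (i n) := ENNReal.tsum_le_tsum fun n => hw _
    _ = K * ∑' n, w (i n) := ENNReal.tsum_mul_left
    _ < ∞ := ENNReal.mul_lt_top (by simp) hi

/-- Completeness of the space of sums of atoms. -/
theorem atomicCost_complete [CompleteSpace G] {K : ℝ≥0} (hw : ∀ i, ‖m i‖ₑ ≤ K * w i) {u : ℕ → G}
    (hu : ∀ n, atomicCost m w (u n) < ∞) (hc : GaugeCauchy (atomicCost m w) u) :
    ∃ x, atomicCost m w x < ∞ ∧ Tendsto (fun n => atomicCost m w (x - u n)) atTop (𝓝 0) := by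
  have hpos : ∀ j : ℕ, (0 : ℝ≥0∞) < 2⁻¹ ^ j := fun j =>
    pos_iff_ne_zero.2 (pow_ne_zero _ (by simp))
  choose ψ hψ using fun j : ℕ => hc (2⁻¹ ^ j) (hpos j)
  -- Running maxima of the Cauchy thresholds give a monotone choice of indices.
  obtain ⟨φ, hφψ, hφmono⟩ : ∃ φ : ℕ → ℕ, (∀ j, ψ j ≤ φ j) ∧ Monotone φ :=
    ⟨fun j => (Finset.range (j + 1)).sup ψ, fun j => Finset.le_sup (f := ψ) (by simp),
      fun a b hab => Finset.sup_mono (by simpa using hab)⟩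
  have hφ : ∀ j, ∀ a ≥ φ j, ∀ b ≥ φ j, atomicCost m w (u a - u b) < 2⁻¹ ^ j := fun j a ha b hb =>
    hψ j a ((hφψ j).trans ha) b ((hφψ j).trans hb)
  have hd : ∀ j, atomicCost m w (u (φ (j + 1)) - u (φ j)) < 2⁻¹ ^ j := fun j =>
    hφ j _ (hφmono (Nat.le_succ j)) _ le_rfl
  choose i hi hicost using fun j => exists_of_atomicCost_lt (hd j)
  have hcost : ∀ J : ℕ, ∑' a : ℕ × ℕ, w (i (J + a.1) a.2) ≤ 2 * 2⁻¹ ^ J := by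
    intro J
    rw [ENNReal.tsum_prod (f := fun a b => w (i (J + a) b))]
    calc ∑' a, ∑' b, w (i (J + a) b) ≤ ∑' a : ℕ, 2⁻¹ ^ J * 2⁻¹ ^ a :=
          ENNReal.tsum_le_tsum fun a => by rw [← pow_add]; exact (hicost _).le
      _ = 2 * 2⁻¹ ^ J := by
        rw [ENNReal.tsum_mul_left, ENNReal.tsum_geometric, ENNReal.one_sub_inv_two, inv_inv, mul_comm]
  have hlt : ∀ J : ℕ, (2 : ℝ≥0∞) * 2⁻¹ ^ J < ∞ := fun J =>
    ENNReal.mul_lt_top (by simp) (ENNReal.pow_lt_top (by simp))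
  have hsum : ∀ J : ℕ, Summable fun a : ℕ × ℕ => m (i (J + a.1) a.2) := fun J =>
    summable_atoms (i := fun a : ℕ × ℕ => i (J + a.1) a.2) hw ((hcost J).trans_lt (hlt J))
  -- `y J` sums the atoms of all the differences from stage `J` on; it is the limit of the
  -- subsequence minus `u (φ J)`, and its cost is at most `2 · 2^(-J)`.
  choose y hy using hsum
  have hycost : ∀ J, atomicCost m w (y J) ≤ 2 * 2⁻¹ ^ J := by
    intro J
    obtain ⟨s⟩ : Nonempty (ℕ ≃ ℕ × ℕ) := ⟨Nat.pairEquiv.symm⟩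
    have e : ∑' n : ℕ, w (i (J + (s n).1) (s n).2) = ∑' a : ℕ × ℕ, w (i (J + a.1) a.2) :=
      s.tsum_eq (fun a : ℕ × ℕ => w (i (J + a.1) a.2))
    have h1 : IsAtomicSum m w (y J) (fun n => i (J + (s n).1) (s n).2) :=
      ⟨by rw [e]; exact (hcost J).trans_lt (hlt J),
        (s.hasSum_iff (f := fun a : ℕ × ℕ => m (i (J + a.1) a.2))).2 (hy J)⟩
    exact h1.cost_le.trans (e.le.trans (hcost J))
  have hyd : ∀ J, HasSum (fun j => u (φ (J + j + 1)) - u (φ (J + j))) (y J) := fun J =>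
    HasSum.prod_fiberwise (f := fun a : ℕ × ℕ => m (i (J + a.1) a.2)) (hy J)
      fun j => (hi (J + j)).2
  have hlim : ∀ J, Tendsto (fun n => u (φ (J + n))) atTop (𝓝 (u (φ J) + y J)) := by
    intro J
    have h1 := (hyd J).tendsto_sum_nat
    have e : ∀ n, ∑ j ∈ Finset.range n, (u (φ (J + j + 1)) - u (φ (J + j)))
        = u (φ (J + n)) - u (φ J) := fun n => by
      simpa [add_assoc] using Finset.sum_range_sub (fun j => u (φ (J + j))) n
    simp only [e] at h1
    simpa using h1.const_add (u (φ J))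
  -- Both sides are the limit of the subsequence, so one limit has small cost distance to `u (φ J)`
  -- for every `J`.
  have hx : ∀ J, u (φ 0) + y 0 = u (φ J) + y J := by
    intro J
    have h1 := (tendsto_add_atTop_iff_nat J).2 (hlim 0)
    refine tendsto_nhds_unique h1 ((hlim J).congr fun n => ?_)
    rw [zero_add, add_comm]
  refine ⟨u (φ 0) + y 0, (atomicCost_add_le _ _).trans_lt
    (ENNReal.add_lt_top.2 ⟨hu _, (hycost 0).trans_lt (hlt 0)⟩), ?_⟩
  have hsmall : Tendsto (fun J : ℕ => (2 : ℝ≥0∞) * 2⁻¹ ^ J + 2⁻¹ ^ J) atTop (𝓝 0) := by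
    have h1 : Tendsto (fun J : ℕ => (2⁻¹ : ℝ≥0∞) ^ J) atTop (𝓝 0) :=
      ENNReal.tendsto_pow_atTop_nhds_zero_of_lt_one (by simp)
    have h2 := (ENNReal.Tendsto.const_mul (a := 2) h1 (Or.inr (by simp))).add h1
    simpa using h2
  rw [ENNReal.tendsto_nhds_zero]
  intro ε hε
  obtain ⟨J, hJ⟩ := (ENNReal.tendsto_nhds_zero.1 hsmall ε hε).exists
  filter_upwards [eventually_ge_atTop (φ J)] with n hn
  have e : u (φ 0) + y 0 - u n = y J + (u (φ J) - u n) := by rw [hx J]; abel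
  rw [e]
  exact (atomicCost_add_le _ _).trans
    ((add_le_add (hycost J) (hφ J _ le_rfl _ hn).le).trans hJ)

end Atoms

/-! ### Sums of atoms for a gauge -/

section GaugeSum

variable {G P : Type*} [AddCommGroup G] {g : G → ℝ≥0∞}

/-- `x` is the sum, for the gauge `g`, of the atoms `m (i n)`, of total weight `∑ w (i n) < ∞`. -/
def IsGaugeSum (g : G → ℝ≥0∞) (m : P → G) (w : P → ℝ≥0∞) (x : G) (i : ℕ → P) : Prop :=
  ∑' n, w (i n) < ∞ ∧ Tendsto (fun k => g (x - ∑ n ∈ Finset.range k, m (i n))) atTop (𝓝 0)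

/-- The least total weight of a representation of `x` as a sum of atoms. -/
def gaugeCost (g : G → ℝ≥0∞) (m : P → G) (w : P → ℝ≥0∞) (x : G) : ℝ≥0∞ :=
  ⨅ (i : ℕ → P) (_ : IsGaugeSum g m w x i), ∑' n, w (i n)

theorem exists_of_gaugeCost_lt {m : P → G} {w : P → ℝ≥0∞} {x : G} {b : ℝ≥0∞}
    (hb : gaugeCost g m w x < b) : ∃ i, IsGaugeSum g m w x i ∧ ∑' n, w (i n) < b := by
  obtain ⟨i, hi⟩ := iInf_lt_iff.1 hb
  obtain ⟨h1, h2⟩ := iInf_lt_iff.1 hi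
  exact ⟨i, h1, h2⟩

theorem IsGaugeSum.cost_le {m : P → G} {w : P → ℝ≥0∞} {x : G} {i : ℕ → P}
    (h : IsGaugeSum g m w x i) : gaugeCost g m w x ≤ ∑' n, w (i n) := iInf₂_le i h

end GaugeSum

section Gauge

variable {G P : Type*} [AddCommGroup G] [Module ℂ G] {e : ℝ} {C : ℝ≥0} {g : G → ℝ≥0∞}

/-- The power `g^e` of a gauge is equivalent to a group norm. -/
theorem IsGauge.exists_addGroupNorm (hg : IsGauge e C g) (hfin : ∀ x, g x < ∞)
    (hzero : ∀ x, g x = 0 → x = 0) : ∃ n : AddGroupNorm G, ∀ x,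
      ENNReal.ofReal (n x) ≤ g x ^ e ∧ g x ^ e ≤ C * ENNReal.ofReal (n x) := by
  -- The infimum over finite decompositions is subadditive by construction. It stays above `g^e / C`
  -- because the constant `C` is independent of the number of summands.
  let n₀ : G → ℝ≥0∞ := fun x => ⨅ (k : ℕ) (f : Fin k → G) (_ : ∑ j, f j = x), ∑ j, g (f j) ^ e
  have n₀_le : ∀ (k : ℕ) (f : Fin k → G), n₀ (∑ j, f j) ≤ ∑ j, g (f j) ^ e := fun k f =>
    iInf_le_of_le k (iInf₂_le_of_le f rfl le_rfl)
  have exists_of_lt : ∀ x b, n₀ x < b → ∃ (k : ℕ) (f : Fin k → G), ∑ j, f j = x ∧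
      ∑ j, g (f j) ^ e < b := by
    intro x b hb
    obtain ⟨k, hk⟩ := iInf_lt_iff.1 hb
    obtain ⟨f, hf⟩ := iInf_lt_iff.1 hk
    obtain ⟨h1, h2⟩ := iInf_lt_iff.1 hf
    exact ⟨k, f, h1, h2⟩
  have le_g : ∀ x, n₀ x ≤ g x ^ e := by
    intro x
    simpa using n₀_le 1 fun _ => x
  have g_le : ∀ x, g x ^ e ≤ C * n₀ x := by
    intro x
    have hC : (C : ℝ≥0∞) ≠ 0 := by
      have : 0 < C := one_pos.trans_le hg.one_le
      simpa using this.ne'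
    rw [mul_comm, ← ENNReal.div_le_iff hC (by simp)]
    refine le_of_forall_gt fun b hb => ?_
    obtain ⟨k, f, rfl, hf⟩ := exists_of_lt x b hb
    refine lt_of_le_of_lt ?_ hf
    rw [ENNReal.div_le_iff hC (by simp), mul_comm]
    exact hg.sum_le _ _ _
  have hn₀fin : ∀ x, n₀ x ≠ ∞ := fun x =>
    ((le_g x).trans_lt (ENNReal.rpow_lt_top_of_nonneg hg.pos.le (hfin x).ne)).ne
  have g0 : g 0 ^ e = 0 := by rw [hg.map_zero, ENNReal.zero_rpow_of_pos hg.pos]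
  have add : ∀ x y, n₀ (x + y) ≤ n₀ x + n₀ y := by
    intro x y
    refine ENNReal.le_of_forall_pos_le_add fun δ hδ _ => ?_
    have h2 : ((δ / 2 : ℝ≥0) : ℝ≥0∞) ≠ 0 := by simpa using hδ.ne'
    obtain ⟨k, f, rfl, hf⟩ := exists_of_lt x _ (ENNReal.lt_add_right (hn₀fin x) h2)
    obtain ⟨l, f', rfl, hf'⟩ := exists_of_lt y _ (ENNReal.lt_add_right (hn₀fin y) h2)
    have h1 := n₀_le (k + l) (Fin.append f f')
    simp only [Fin.sum_univ_add, Fin.append_left, Fin.append_right] at h1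
    refine h1.trans ((add_le_add hf.le hf'.le).trans (le_of_eq ?_))
    rw [add_add_add_comm, ← ENNReal.coe_add, add_halves]
  have neg : ∀ x, n₀ (-x) ≤ n₀ x := by
    intro x
    refine le_of_forall_gt fun b hb => ?_
    obtain ⟨k, f, rfl, hf⟩ := exists_of_lt x b hb
    have := n₀_le k fun j => -f j
    simp only [Finset.sum_neg_distrib, hg.map_neg] at this
    exact this.trans_lt hf
  refine ⟨{ toFun := fun x => (n₀ x).toReal
            map_zero' := ?_
            add_le' := ?_
            neg' := ?_
            eq_zero_of_map_eq_zero' := ?_ }, fun x => ?_⟩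
  · have : n₀ 0 = 0 := nonpos_iff_eq_zero.1 ((le_g 0).trans g0.le)
    simp [this]
  · intro x y
    rw [← ENNReal.toReal_add (hn₀fin x) (hn₀fin y)]
    exact ENNReal.toReal_mono (ENNReal.add_ne_top.2 ⟨hn₀fin x, hn₀fin y⟩) (add x y)
  · intro x
    have := le_antisymm (neg x) (by simpa using neg (-x))
    simp only [this]
  · intro x hx
    have h0 : n₀ x = 0 := (ENNReal.toReal_eq_zero_iff _).1 hx |>.resolve_right (hn₀fin x)
    have := g_le x
    rw [h0, mul_zero, nonpos_iff_eq_zero, ENNReal.rpow_eq_zero_iff_of_pos hg.pos] at this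
    exact hzero x this
  · change ENNReal.ofReal (n₀ x).toReal ≤ _ ∧ _ ≤ C * ENNReal.ofReal (n₀ x).toReal
    rw [ENNReal.ofReal_toReal (hn₀fin x)]
    exact ⟨le_g x, g_le x⟩

/-- The cost of representations as sums of atoms is subadditive, definite and complete. -/
theorem gaugeCost_properties (hg : IsGauge e C g) (hfin : ∀ x, g x < ∞)
    (hzero : ∀ x, g x = 0 → x = 0)
    (hcomplete : ∀ u : ℕ → G, GaugeCauchy g u → ∃ x, Tendsto (fun n => g (u n - x)) atTop (𝓝 0))
    {m : P → G} {w : P → ℝ≥0∞} {K : ℝ≥0} (hw : ∀ i, g (m i) ^ e ≤ K * w i) :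
    (∀ x y, gaugeCost g m w (x + y) ≤ gaugeCost g m w x + gaugeCost g m w y) ∧
    (∀ x, gaugeCost g m w x = 0 → x = 0) ∧
    (∀ u : ℕ → G, (∀ n, gaugeCost g m w (u n) < ∞) → GaugeCauchy (gaugeCost g m w) u →
      ∃ x, gaugeCost g m w x < ∞ ∧ Tendsto (fun n => gaugeCost g m w (x - u n)) atTop (𝓝 0)) := by
  obtain ⟨n, hn⟩ := hg.exists_addGroupNorm hfin hzero
  let _ : NormedAddCommGroup G := n.toNormedAddCommGroup
  have hnorm : ∀ x : G, ‖x‖ₑ = ENNReal.ofReal (n x) := fun x => (ofReal_norm x).symm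
  have h1 : ∀ x : G, ‖x‖ₑ ≤ g x ^ e := fun x => (hnorm x).trans_le (hn x).1
  have h2 : ∀ x : G, g x ^ e ≤ C * ‖x‖ₑ := fun x => by rw [hnorm]; exact (hn x).2
  have htend : ∀ (v : ℕ → G), Tendsto (fun n => g (v n)) atTop (𝓝 0) ↔
      Tendsto (fun n => ‖v n‖ₑ) atTop (𝓝 0) := by
    intro v
    constructor
    · intro hv
      have h3 : Tendsto (fun n => g (v n) ^ e) atTop (𝓝 0) := by
        have := (ENNReal.continuous_rpow_const (y := e)).tendsto 0 |>.comp hv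
        simpa [ENNReal.zero_rpow_of_pos hg.pos, Function.comp_def] using this
      exact tendsto_of_tendsto_of_tendsto_of_le_of_le tendsto_const_nhds h3 (fun _ => zero_le)
        fun k => h1 _
    · intro hv
      have h3 : Tendsto (fun n => (C * ‖v n‖ₑ) ^ e⁻¹) atTop (𝓝 0) := by
        have h4 := ENNReal.Tendsto.const_mul (a := (C : ℝ≥0∞)) hv (Or.inr (by simp))
        have := (ENNReal.continuous_rpow_const (y := e⁻¹)).tendsto _ |>.comp h4
        simpa [ENNReal.zero_rpow_of_pos (inv_pos.2 hg.pos), Function.comp_def] using this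
      refine tendsto_of_tendsto_of_tendsto_of_le_of_le tendsto_const_nhds h3 (fun _ => zero_le)
        fun k => ?_
      exact (ENNReal.le_rpow_inv_iff hg.pos).2 (h2 _)
  have hcs : CompleteSpace G := by
    refine Metric.complete_of_cauchySeq_tendsto fun u hu => ?_
    have hc : GaugeCauchy g u := by
      rw [EMetric.cauchySeq_iff] at hu
      intro ε hε
      obtain ⟨ε', h0, h3⟩ := exists_between hε
      have hC : (C : ℝ≥0∞) ≠ 0 := by
        have : 0 < C := one_pos.trans_le hg.one_le
        simpa using this.ne'
      have h0' : 0 < ε' ^ e := ENNReal.rpow_pos_of_nonneg h0 hg.pos.le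
      obtain ⟨k, hk⟩ := hu (ε' ^ e / C) (ENNReal.div_pos h0'.ne' (by simp))
      refine ⟨k, fun a ha b hb => lt_of_le_of_lt ?_ h3⟩
      rw [← ENNReal.rpow_le_rpow_iff hg.pos]
      refine (h2 _).trans ?_
      have := (hk a ha b hb).le
      rw [edist_eq_enorm_sub] at this
      exact (mul_le_mul_right this _).trans ENNReal.mul_div_le
    obtain ⟨x, hx⟩ := hcomplete u hc
    refine ⟨x, tendsto_iff_edist_tendsto_0.2 ?_⟩
    simpa only [edist_eq_enorm_sub] using (htend _).1 hx
  have hw' : ∀ i, ‖m i‖ₑ ≤ K * w i := fun i => (h1 _).trans (hw i)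
  -- Finite weight makes the series absolutely summable for the equivalent norm, so convergence of
  -- partial sums and unconditional convergence agree. This justifies the rearrangements above.
  have hiff : ∀ x i, IsGaugeSum g m w x i ↔ IsAtomicSum m w x i := by
    intro x i
    refine and_congr_right fun hi => ?_
    have hs := summable_atoms hw' hi
    rw [hs.hasSum_iff_tendsto_nat, htend, tendsto_iff_edist_tendsto_0]
    simp only [edist_comm _ x, edist_eq_enorm_sub]
  have hcost : gaugeCost g m w = atomicCost m w := by
    funext x
    simp only [gaugeCost, atomicCost, hiff]
  rw [hcost]
  refine ⟨atomicCost_add_le, fun x hx => ?_, fun u => atomicCost_complete hw'⟩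
  exact eq_zero_of_atomicCost_eq_zero hw' hx

end Gauge

end

/-! ### The product cost and its quasi-norm -/

section

/-- A finite, subadditive, definite, `e`-homogeneous and complete functional is the power of a
complete quasi-norm. -/
theorem isCompleteQuasiNorm_rpow {V : Type*} [AddCommGroup V] [Module ℂ V] {e : ℝ} (he0 : 0 < e)
    (he1 : e ≤ 1) {c : V → ℝ≥0∞} (hfin : ∀ x, c x < ∞) (hadd : ∀ x y, c (x + y) ≤ c x + c y)
    (hzero : ∀ x, c x = 0 → x = 0) (hsmul : ∀ (z : ℂ) x, c (z • x) = ‖z‖ₑ ^ e * c x)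
    (hcomplete : ∀ u : ℕ → V, GaugeCauchy c u → ∃ x, Tendsto (fun n => c (x - u n)) atTop (𝓝 0)) :
    IsCompleteQuasiNorm (2 ^ (1 / e - 1)) fun x => (c x ^ (1 / e)).toReal := by
  have he : 0 < 1 / e := by positivity
  have hone : 1 ≤ 1 / e := (one_le_div he0).2 he1
  have hfin' : ∀ x, c x ^ (1 / e) < ∞ := fun x => ENNReal.rpow_lt_top_of_nonneg he.le (hfin x).ne
  have c0 : c 0 = 0 := by
    have := hsmul 0 0
    simpa [ENNReal.zero_rpow_of_pos he0] using this
  have hneg : ∀ x y, c (x - y) = c (y - x) := fun x y => by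
    have := hsmul (-1) (x - y)
    simpa using this.symm
  refine ⟨fun x => ENNReal.toReal_nonneg, fun x => ?_, fun z x => ?_, fun x y => ?_, fun u hu => ?_⟩
  · rw [ENNReal.toReal_eq_zero_iff, or_iff_left (hfin' x).ne, ENNReal.rpow_eq_zero_iff_of_pos he]
    exact ⟨hzero x, fun h => h ▸ c0⟩
  · rw [hsmul, ENNReal.mul_rpow_of_nonneg _ _ he.le, ← ENNReal.rpow_mul, mul_one_div_cancel he0.ne',
      ENNReal.rpow_one, ENNReal.toReal_mul, toReal_enorm]
  · have h1 : c (x + y) ^ (1 / e) ≤ 2 ^ (1 / e - 1) * (c x ^ (1 / e) + c y ^ (1 / e)) :=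
      (ENNReal.rpow_le_rpow (hadd x y) he.le).trans
        (ENNReal.rpow_add_le_mul_rpow_add_rpow _ _ hone)
    have h2 : (2 : ℝ≥0∞) ^ (1 / e - 1) * (c x ^ (1 / e) + c y ^ (1 / e)) ≠ ∞ :=
      ENNReal.mul_ne_top (ENNReal.rpow_ne_top_of_nonneg (by linarith) (by simp))
        (ENNReal.add_ne_top.2 ⟨(hfin' x).ne, (hfin' y).ne⟩)
    have h3 := ENNReal.toReal_mono h2 h1
    rwa [ENNReal.toReal_mul, ENNReal.toReal_add (hfin' x).ne (hfin' y).ne,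
      ← ENNReal.toReal_rpow 2, ENNReal.toReal_ofNat] at h3
  · have hc : GaugeCauchy c u := by
      intro ε hε
      obtain ⟨δ, h0, h1⟩ := ENNReal.lt_iff_exists_nnreal_btwn.1 hε
      have hδ : (0 : ℝ) < (δ : ℝ) ^ (1 / e) := Real.rpow_pos_of_pos (by simpa using h0) _
      obtain ⟨k, hk⟩ := hu _ hδ
      refine ⟨k, fun a ha b hb => lt_trans ?_ h1⟩
      have h2 := hk a ha b hb
      rw [← ENNReal.toReal_rpow] at h2
      replace h2 := (Real.rpow_lt_rpow_iff ENNReal.toReal_nonneg δ.2 he).1 h2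
      rw [← ENNReal.toReal_lt_toReal (hfin _).ne (by simp)]
      simpa using h2
    obtain ⟨x, hx⟩ := hcomplete u hc
    refine ⟨x, ?_⟩
    have h1 : Tendsto (fun n => c (x - u n) ^ (1 / e)) atTop (𝓝 0) := by
      have := (ENNReal.continuous_rpow_const (y := 1 / e)).tendsto 0 |>.comp hx
      rwa [ENNReal.zero_rpow_of_pos he] at this
    have h2 := (ENNReal.tendsto_toReal (by simp : (0 : ℝ≥0∞) ≠ ∞)).comp h1
    simpa [Function.comp_def, hneg x] using h2

/-- The norm topology is finer than the σ-weak topology. -/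
theorem norm_le_sigmaWeak {H : Type*} [NormedAddCommGroup H] [InnerProductSpace ℂ H] :
    (inferInstance : TopologicalSpace (H →L[ℂ] H)) ≤ sigmaWeak H := by
  refine continuous_iff_le_induced.1 (continuous_pi fun ω => ?_)
  obtain ⟨ξ, η⟩ := ω
  have hs : Summable fun n => ‖ξ n‖ * ‖η n‖ := by
    have h1 := (lp.memℓp ξ).summable (by norm_num)
    have h2 := (lp.memℓp η).summable (by norm_num)
    simp only [ENNReal.toReal_ofNat, Real.rpow_ofNat] at h1 h2
    refine Summable.of_nonneg_of_le (fun n => by positivity) (fun n => ?_) (h1.add h2)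
    nlinarith [sq_nonneg (‖ξ n‖ - ‖η n‖), sq_nonneg ‖ξ n‖, sq_nonneg ‖η n‖]
  have hb : ∀ (x : H →L[ℂ] H) n, ‖inner ℂ (η n) (x (ξ n))‖ ≤ ‖x‖ * (‖ξ n‖ * ‖η n‖) := fun x n =>
    calc ‖inner ℂ (η n) (x (ξ n))‖ ≤ ‖η n‖ * ‖x (ξ n)‖ := norm_inner_le_norm _ _
      _ ≤ ‖η n‖ * (‖x‖ * ‖ξ n‖) := by gcongr; exact x.le_opNorm _
      _ = ‖x‖ * (‖ξ n‖ * ‖η n‖) := by ring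
  have hsum : ∀ x : H →L[ℂ] H, Summable fun n => inner ℂ (η n) (x (ξ n)) := fun x =>
    Summable.of_norm_bounded (hs.mul_left ‖x‖) (hb x)
  -- Each functional defining the σ-weak topology is norm continuous, by Cauchy–Schwarz in every
  -- term.
  have hL : LipschitzWith (∑' n, ‖ξ n‖ * ‖η n‖).toNNReal
      fun x : H →L[ℂ] H => ∑' n, inner ℂ (η n) (x (ξ n)) := by
    refine LipschitzWith.of_dist_le_mul fun x y => ?_
    rw [Real.coe_toNNReal _ (tsum_nonneg fun n => by positivity), dist_eq_norm, dist_eq_norm,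
      ← (hsum x).tsum_sub (hsum y), mul_comm, ← tsum_mul_left]
    have := tsum_of_norm_bounded (hs.mul_left ‖x - y‖).hasSum (hb (x - y))
    simpa only [sub_apply, inner_sub_right] using this
  exact hL.continuous

variable {H : Type*} [NormedAddCommGroup H] [InnerProductSpace ℂ H] [CompleteSpace H]
  {M : VonNeumannAlgebra H} {τ : (H →L[ℂ] H) → ℝ≥0∞} {A : Subalgebra ℂ (H →L[ℂ] H)}
  {p q r : ℝ≥0∞}

variable (M τ A p q) in
/-- Pairs of elements of two Hardy spaces. -/
abbrev HardyPair : Type _ :=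
  {ab : SeqSpace M τ p × SeqSpace M τ q // ab.1 ∈ hardy M τ A p ∧ ab.2 ∈ hardy M τ A q}

/-- `‖a‖_p^min{1,r} ‖b‖_q^min{1,r}` for a pair `(a, b)`. -/
def pairWeight (r : ℝ≥0∞) (s : HardyPair M τ A p q) : ℝ≥0∞ :=
  lpNorm s.1.1 ^ minExp r * lpNorm s.1.2 ^ minExp r

/-- The cost of an element of `H^r(A)`: the power `min{1,r}` of its product norm. -/
def prodCost (A : Subalgebra ℂ (H →L[ℂ] H)) (p q : ℝ≥0∞) (x : SeqSpace M τ r) : ℝ≥0∞ :=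
  gaugeCost lpNorm (fun s : HardyPair M τ A p q => lpMul r s.1.1 s.1.2) (pairWeight r) x

theorem isFactorization_of_isGaugeSum {x : SeqSpace M τ r} {i : ℕ → HardyPair M τ A p q}
    (hi : IsGaugeSum lpNorm (fun s : HardyPair M τ A p q => lpMul r s.1.1 s.1.2) (pairWeight r) x i) :
    IsFactorization A x (fun n => (i n).1.1) (fun n => (i n).1.2) :=
  ⟨fun n => (i n).2.1, fun n => (i n).2.2, hi.1, hi.2⟩

theorem IsFactorization.isGaugeSum {x : SeqSpace M τ r} {a : ℕ → SeqSpace M τ p}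
    {b : ℕ → SeqSpace M τ q} (h : IsFactorization A x a b) :
    IsGaugeSum lpNorm (fun s : HardyPair M τ A p q => lpMul r s.1.1 s.1.2) (pairWeight r) x
      (fun n => ⟨(a n, b n), h.left_mem n, h.right_mem n⟩) :=
  ⟨h.cost_lt_top, h.hasSum⟩

theorem prodNorm_eq (x : SeqSpace M τ r) : prodNorm A p q x = prodCost A p q x ^ (1 / minExp r) := by
  rw [prodNorm]
  congr 1
  refine le_antisymm (le_iInf₂ fun i hi => ?_) (le_iInf fun a => le_iInf₂ fun b h => ?_)
  · exact (iInf_le_of_le _ (iInf₂_le_of_le _ (isFactorization_of_isGaugeSum hi) le_rfl))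
  · exact h.isGaugeSum.cost_le

theorem prodCost_lt_top_iff {x : SeqSpace M τ r} : prodCost A p q x < ∞ ↔
    ∃ (a : ℕ → SeqSpace M τ p) (b : ℕ → SeqSpace M τ q), IsFactorization A x a b := by
  constructor
  · intro h
    obtain ⟨i, hi, -⟩ := exists_of_gaugeCost_lt h
    exact ⟨_, _, isFactorization_of_isGaugeSum hi⟩
  · rintro ⟨a, b, h⟩
    exact h.isGaugeSum.cost_le.trans_lt h.cost_lt_top

/-- Applied to the inclusion of `H^r(A)`: the cost can be computed within the Hardy space, where the
atoms live. -/
theorem gaugeCost_map {G G' P : Type*} [AddCommGroup G] [Module ℂ G] [AddCommGroup G']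
    [Module ℂ G'] (f : G →ₗ[ℂ] G') (g : G' → ℝ≥0∞) (m : P → G) (w : P → ℝ≥0∞) (x : G) :
    gaugeCost g (fun i => f (m i)) w (f x) = gaugeCost (fun y => g (f y)) m w x := by
  simp only [gaugeCost, IsGaugeSum, map_sub, map_sum]

/-- The product cost is subadditive, definite and complete. -/
theorem prodCost_properties (h : IsTraceOn M.toStarSubalgebra τ)
    (hA : IsClosed (A : Set (H →L[ℂ] H))) (hp0 : 0 < p) (hq0 : 0 < q) (hr0 : 0 < r)
    (hpqr : r⁻¹ = p⁻¹ + q⁻¹) :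
    (∀ x ∈ hardy M τ A r, ∀ y ∈ hardy M τ A r,
      prodCost A p q (x + y) ≤ prodCost A p q x + prodCost A p q y) ∧
    (∀ x ∈ hardy M τ A r, prodCost A p q x = 0 → x = 0) ∧
    (∀ u : ℕ → SeqSpace M τ r, (∀ n, u n ∈ hardy M τ A r) → (∀ n, prodCost A p q (u n) < ∞) →
      GaugeCauchy (prodCost A p q) u → ∃ x ∈ hardy M τ A r, prodCost A p q x < ∞ ∧
        Tendsto (fun n => prodCost A p q (x - u n)) atTop (𝓝 0)) := by
  -- The abstract result needs a finite and complete gauge; both hold on `H^r(A)`, whereas `lpNorm`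
  -- may be infinite on the ambient quotient.
  let G := hardySubmodule h hA hr0
  let g : G → ℝ≥0∞ := fun x => lpNorm (G.subtype x)
  have hG := isGauge_lpNorm h hr0
  have hg : IsGauge (minExp r) 4 g :=
    ⟨hG.pos, hG.le_one, hG.one_le, fun c x => hG.smul c x.1, fun ι F x => by
      simpa only [g, map_sum] using hG.sum_le ι F fun i => G.subtype (x i)⟩
  let m : HardyPair M τ A p q → G := fun s =>
    ⟨lpMul r s.1.1 s.1.2, lpMul_mem_hardy h hA hp0 hq0 hr0 hpqr s.2.1 s.2.2⟩
  obtain ⟨K, hK⟩ := exists_lpNorm_lpMul_le h hp0 hq0 hr0 hpqr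
  have hw : ∀ s, g (m s) ^ minExp r ≤ ((K ^ minExp r : ℝ≥0) : ℝ≥0∞) * pairWeight r s := by
    intro s
    have he := (minExp_pos hr0).le
    rw [ENNReal.coe_rpow_of_nonneg _ he, pairWeight, ← ENNReal.mul_rpow_of_nonneg _ _ he,
      ← ENNReal.mul_rpow_of_nonneg _ _ he]
    exact ENNReal.rpow_le_rpow (hK _ _ (lpNorm_lt_top_of_mem_hardy h hA hp0 s.2.1)
      (lpNorm_lt_top_of_mem_hardy h hA hq0 s.2.2)) he
  have hcost : ∀ x : G, gaugeCost g m (pairWeight r) x = prodCost A p q x.1 := fun x =>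
    (gaugeCost_map G.subtype lpNorm m (pairWeight r) x).symm
  obtain ⟨h1, h2, h3⟩ := gaugeCost_properties hg
    (fun x => lpNorm_lt_top_of_mem_hardy h hA hr0 x.2)
    (fun x hx => Subtype.ext (eq_zero_of_lpNorm_eq_zero h hr0 hx))
    (fun u hu => by
      obtain ⟨η, hη, hlim⟩ := hardy_complete h hA hr0 (ξ := fun n => (u n).1) (fun n => (u n).2) hu
      exact ⟨⟨η, hη⟩, hlim⟩) hw
  simp only [hcost] at h1 h2 h3
  refine ⟨fun x hx y hy => h1 ⟨x, hx⟩ ⟨y, hy⟩, fun x hx h0 => congrArg Subtype.val (h2 ⟨x, hx⟩ h0),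
    fun u hu hfin hc => ?_⟩
  obtain ⟨x, hx, hlim⟩ := h3 (fun n => ⟨u n, hu n⟩) hfin fun ε hε => by
    obtain ⟨k, hk⟩ := hc ε hε
    exact ⟨k, fun a ha b hb => (hcost _).trans_lt (hk a ha b hb)⟩
  exact ⟨x.1, x.2, hx, hlim⟩

theorem prodCost_zero (h : IsTraceOn M.toStarSubalgebra τ) (hA : IsClosed (A : Set (H →L[ℂ] H)))
    (hp0 : 0 < p) (hq0 : 0 < q) (hr0 : 0 < r) (hpqr : r⁻¹ = p⁻¹ + q⁻¹) :
    prodCost A p q (0 : SeqSpace M τ r) = 0 := by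
  have hp := (hardySubmodule h hA hp0).zero_mem
  have hq := (hardySubmodule h hA hq0).zero_mem
  have hG := isGauge_lpNorm h hr0
  have hmul : lpMul r (0 : SeqSpace M τ p) (0 : SeqSpace M τ q) = 0 := by
    simpa using smul_lpMul h hA hp0 hq0 hr0 hpqr hp hq 0
  have hw : ∀ n : ℕ, pairWeight r (⟨(0, 0), hp, hq⟩ : HardyPair M τ A p q) = 0 := fun _ => by
    simp [pairWeight, (isGauge_lpNorm h hp0).map_zero, ENNReal.zero_rpow_of_pos (minExp_pos hr0)]
  have : IsGaugeSum lpNorm (fun s : HardyPair M τ A p q => lpMul r s.1.1 s.1.2) (pairWeight r) 0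
      fun _ => ⟨(0, 0), hp, hq⟩ := by
    refine ⟨by simp [hw 0], ?_⟩
    simp [hmul, hG.map_zero]
  refine nonpos_iff_eq_zero.1 (this.cost_le.trans ?_)
  simp [hw 0]

theorem prodCost_smul_le (h : IsTraceOn M.toStarSubalgebra τ)
    (hA : IsClosed (A : Set (H →L[ℂ] H))) (hp0 : 0 < p) (hq0 : 0 < q) (hr0 : 0 < r)
    (hpqr : r⁻¹ = p⁻¹ + q⁻¹) (c : ℂ) (x : SeqSpace M τ r) (hx : prodCost A p q x < ∞) :
    prodCost A p q (c • x) ≤ ‖c‖ₑ ^ minExp r * prodCost A p q x := by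
  have he := minExp_pos hr0
  have hG := isGauge_lpNorm h hr0
  have hc : ‖c‖ₑ ^ minExp r ≠ ∞ := ENNReal.rpow_ne_top_of_nonneg he.le (by simp)
  have key : ∀ b, prodCost A p q x < b → prodCost A p q (c • x) ≤ ‖c‖ₑ ^ minExp r * b := by
    intro b hb
    obtain ⟨i, hi, hib⟩ := exists_of_gaugeCost_lt hb
    -- Scaling the left factors alone multiplies every weight by `‖c‖^min{1,r}`.
    let j : ℕ → HardyPair M τ A p q := fun n =>
      ⟨(c • (i n).1.1, (i n).1.2), (hardySubmodule h hA hp0).smul_mem c (i n).2.1, (i n).2.2⟩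
    have hw : ∀ n, pairWeight r (j n) = ‖c‖ₑ ^ minExp r * pairWeight r (i n) := fun n => by
      simp only [pairWeight, j, (isGauge_lpNorm h hp0).smul, ENNReal.mul_rpow_of_nonneg _ _ he.le,
        mul_assoc]
    have hj : IsGaugeSum lpNorm (fun s : HardyPair M τ A p q => lpMul r s.1.1 s.1.2)
        (pairWeight r) (c • x) j := by
      refine ⟨?_, ?_⟩
      · simp only [hw, ENNReal.tsum_mul_left]
        exact ENNReal.mul_lt_top hc.lt_top hi.1
      · refine (hG.tendsto_smul c hi.2).congr fun k => ?_
        simp only [j, smul_lpMul h hA hp0 hq0 hr0 hpqr (i _).2.1 (i _).2.2, smul_sub,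
          Finset.smul_sum]
    refine hj.cost_le.trans ?_
    simp only [hw, ENNReal.tsum_mul_left]
    gcongr
  obtain ⟨b, hb1, hb2⟩ := exists_between hx
  have hlim : Tendsto (fun n : ℕ => ‖c‖ₑ ^ minExp r * (prodCost A p q x + (n : ℝ≥0∞)⁻¹)) atTop
      (𝓝 (‖c‖ₑ ^ minExp r * prodCost A p q x)) := by
    refine ENNReal.Tendsto.const_mul ?_ (Or.inr hc)
    simpa using (tendsto_const_nhds (x := prodCost A p q x)).add
      ENNReal.tendsto_inv_nat_nhds_zero
  exact ge_of_tendsto' hlim fun n => key _ (ENNReal.lt_add_right hx.ne (by simp))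

theorem prodCost_smul (h : IsTraceOn M.toStarSubalgebra τ)
    (hA : IsClosed (A : Set (H →L[ℂ] H))) (hp0 : 0 < p) (hq0 : 0 < q) (hr0 : 0 < r)
    (hpqr : r⁻¹ = p⁻¹ + q⁻¹) (c : ℂ) (x : SeqSpace M τ r) (hx : prodCost A p q x < ∞) :
    prodCost A p q (c • x) = ‖c‖ₑ ^ minExp r * prodCost A p q x := by
  have he := minExp_pos hr0
  have hle := prodCost_smul_le h hA hp0 hq0 hr0 hpqr c x hx
  refine le_antisymm hle ?_
  rcases eq_or_ne c 0 with rfl | hc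
  · simp [ENNReal.zero_rpow_of_pos he]
  have hc0 : ‖c‖ₑ ^ minExp r ≠ ∞ := ENNReal.rpow_ne_top_of_nonneg he.le (by simp)
  -- The reverse inequality is the same bound for `c⁻¹` acting on `c • x`.
  have h1 := prodCost_smul_le h hA hp0 hq0 hr0 hpqr c⁻¹ (c • x)
    (hle.trans_lt (ENNReal.mul_lt_top hc0.lt_top hx))
  rw [inv_smul_smul₀ hc] at h1
  calc ‖c‖ₑ ^ minExp r * prodCost A p q x
      ≤ ‖c‖ₑ ^ minExp r * (‖c⁻¹‖ₑ ^ minExp r * prodCost A p q (c • x)) := by gcongr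
    _ = (‖c‖ₑ * ‖c⁻¹‖ₑ) ^ minExp r * prodCost A p q (c • x) := by
      rw [ENNReal.mul_rpow_of_nonneg _ _ he.le, mul_assoc]
    _ = prodCost A p q (c • x) := by
      rw [← enorm_mul, mul_inv_cancel₀ hc]; simp

end

end NCHardy

end

/-! ### The theorem -/

theorem proposition3p1 {H : Type*} [NormedAddCommGroup H] [InnerProductSpace ℂ H] [CompleteSpace H]
    (M D : VonNeumannAlgebra H) (τ : (H →L[ℂ] H) → ℝ≥0∞)
    (E : M.toStarSubalgebra →ₗ[ℂ] M.toStarSubalgebra) (A : Subalgebra ℂ (H →L[ℂ] H))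
    (hτ : NCHardy.IsNormalFaithfulSemifiniteTrace M τ)
    (hDM : D ≤ M) (hD : NCHardy.IsSemifiniteOn D τ)
    (hE : NCHardy.IsTracePreservingCondExp M D τ E)
    (hA : NCHardy.IsSubdiagonal M D E A)
    (p q r : ℝ≥0∞) (hp : 0 < p) (hq : 0 < q) (hr : 0 < r) (hpqr : r⁻¹ = p⁻¹ + q⁻¹) :
    ∃ V : Submodule ℂ (NCHardy.SeqSpace M τ r),
      (V : Set (NCHardy.SeqSpace M τ r)) = NCHardy.hardyProd M τ A p q r ∧
      (∀ x ∈ V, NCHardy.prodNorm A p q x < ∞) ∧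
      (1 ≤ r → NCHardy.IsBanachNorm (fun x : V => (NCHardy.prodNorm A p q x.1).toReal)) ∧
      (r < 1 → NCHardy.IsQuasiBanachNorm (fun x : V => (NCHardy.prodNorm A p q x.1).toReal)) := by
  have h := hτ.isTraceOn
  have hAc : IsClosed (A : Set (H →L[ℂ] H)) := hA.closed.mono NCHardy.norm_le_sigmaWeak
  have he := NCHardy.minExp_pos hr
  obtain ⟨hadd, hzero, hcomplete⟩ := NCHardy.prodCost_properties h hAc hp hq hr hpqr
  have hsmul := NCHardy.prodCost_smul h hAc hp hq hr hpqr
  have hmem : ∀ x, x ∈ NCHardy.hardyProd M τ A p q r ↔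
      x ∈ NCHardy.hardy M τ A r ∧ NCHardy.prodCost A p q x < ∞ := fun x =>
    and_congr_right fun _ => NCHardy.prodCost_lt_top_iff.symm
  let G := NCHardy.hardySubmodule h hAc hr
  let V : Submodule ℂ (NCHardy.SeqSpace M τ r) :=
    { carrier := NCHardy.hardyProd M τ A p q r
      zero_mem' := (hmem 0).2 ⟨G.zero_mem,
        (NCHardy.prodCost_zero h hAc hp hq hr hpqr).trans_lt (by simp)⟩
      add_mem' := fun {x y} hx hy => by
        rw [hmem] at hx hy ⊢
        exact ⟨G.add_mem hx.1 hy.1, (hadd x hx.1 y hy.1).trans_lt (ENNReal.add_lt_top.2 ⟨hx.2, hy.2⟩)⟩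
      smul_mem' := fun c x hx => by
        rw [hmem] at hx ⊢
        refine ⟨G.smul_mem c hx.1, (hsmul c x hx.2).trans_lt (ENNReal.mul_lt_top ?_ hx.2)⟩
        exact ENNReal.rpow_lt_top_of_nonneg he.le (by simp) }
  have hV : ∀ x ∈ V, x ∈ NCHardy.hardy M τ A r ∧ NCHardy.prodCost A p q x < ∞ :=
    fun x hx => (hmem x).1 hx
  have main : NCHardy.IsCompleteQuasiNorm (2 ^ (1 / NCHardy.minExp r - 1))
      (fun x : V => (NCHardy.prodNorm A p q x.1).toReal) := by
    simp only [NCHardy.prodNorm_eq]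
    refine NCHardy.isCompleteQuasiNorm_rpow he (NCHardy.minExp_le_one r)
      (c := fun x : V => NCHardy.prodCost A p q x.1) (fun x => (hV _ x.2).2)
      (fun x y => hadd _ (hV _ x.2).1 _ (hV _ y.2).1)
      (fun x hx => Subtype.ext (hzero _ (hV _ x.2).1 hx))
      (fun c x => hsmul c _ (hV _ x.2).2) fun u hu => ?_
    obtain ⟨x, hx, hfin, hlim⟩ := hcomplete (fun n => (u n).1) (fun n => (hV _ (u n).2).1)
      (fun n => (hV _ (u n).2).2) hu
    exact ⟨⟨x, (hmem x).2 ⟨hx, hfin⟩⟩, hlim⟩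
  refine ⟨V, rfl, fun x hx => ?_, fun h1 => ?_, fun _ => ⟨_, main⟩⟩
  · rw [NCHardy.prodNorm_eq]
    exact ENNReal.rpow_lt_top_of_nonneg (by positivity) (hV x hx).2.ne
  · rw [NCHardy.minExp_of_one_le h1] at main
    simpa [NCHardy.IsBanachNorm] using main
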